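/- **Setting.** Let $R>0$, $L=2R$. For $h\in L^1(-R,R)$ put $(\mathcal V h)(x)=\int_{-R}^x h(t)\,dt$. For a unit vector $u\in S^1$ and $f:\mathbb R^2\to\mathbb R$ let $(\mathcal P_u f)(t)=\int_{\mathbb R} f(tu+su^\perp)\,ds$, where $u^\perp=(-u_2,u_1)$. For $f,g$ supported on the disc of radius $R$ centered at the origin, the sliced $p$-Cramér distance with respect to the uniform probability measure $\eta$ on $S^1$ is $$\mathrm{SC}_p(f,g)=\Big(\int_{S^1}\|\mathcal V(\mathcal P_uf-\mathcal P_ug)\|_{L^p(-R,R)}^p\,d\eta(u)\Big)^{1/p}\ (1\le p<\infty),\qquad \mathrm{SC}_\infty(f,g)=\sup_{u\in S^1}\|\mathcal V(\mathcal P_uf-\mathcal P_ug)\|_{L^\infty(-R,R)}.$$ For an even integer $n\ge2$ let $t_j=-R+2Rj/n$ and $\theta_\ell=\pi\ell/n$. For $x\in\mathbb R^{n\times n}$ and $\theta\in\mathbb R$ let $$\alpha_\theta[k]=\frac{L^2}{n^2}\sum_{i,j=0}^{n-1}x[i,j]\,e^{-2\pi \mathrm i k(t_i\cos\theta+t_j\sin\theta)/L},\qquad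 \beta_\theta[k]=\frac{\alpha_\theta[k]}{2\pi \mathrm i k/L}\ \ (0<|k|<n/2),$$ $$\beta_\theta[0]=-\sum_{0<|k|<n/2}\beta_\theta[k]\,e^{-2\pi \mathrm i kR/L},\qquad \nu_x(t,\theta)=\frac1L\sum_{k=-n/2+1}^{n/2-1}\beta_\theta[k]\,e^{2\pi \mathrm i tk/L},$$ $$\mathrm{SV}_p(x)=\Big(\frac1n\sum_{\ell=0}^{n-1}\frac Ln\sum_{j=0}^{n}|\nu_x(t_j,\theta_\ell)|^p\Big)^{1/p}\ (1\le p<\infty),\qquad \mathrm{SV}_\infty(x)=\max_{0\le j,\ell\le n-1}|\nu_x(t_j,\theta_\ell)|,$$ and $\widehat{\mathrm{SC}}_p(x,y)=\mathrm{SV}_p(x-y)$. **Theorem 4.2.** Suppose $f$ and $g$ are $C^\infty$ functions on $\mathbb R^2$ that are supported on the disc of radius $R$ centered at the origin and satisfy $\int_{\mathbb R^2}f=\int_{\mathbb R^2}g$. Then $\mathrm{SC}_p(f,g)<\infty$ for all $1\le p\le\infty$. Consider any jointly independent Gaussians $Z[j,k]$, $\widetilde Z[j,k]$, $j,k\ge0$,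 with mean $0$ and variances $\sigma_{jk}^2$, $\widetilde\sigma_{jk}^2$ (possibly $0$), and any $\sigma\ge0$ such that for all even $n\ge2$ $$\frac1{n^2}\sum_{k=0}^{n-1}\sum_{j=0}^{n-1}\sigma_{jk}^2+\frac1{n^2}\sum_{k=0}^{n-1}\sum_{j=0}^{n-1}\widetilde\sigma_{jk}^2\le\sigma^2 .$$ For even $n\ge 2$ let $X_n,Y_n\in\mathbb R^{n\times n}$ have entries $X_n[j,k]=f(t_j,t_k)+Z[j,k]$, $Y_n[j,k]=g(t_j,t_k)+\widetilde Z[j,k]$, $0\le j,k\le n-1$. Then, with constants depending only on $f$, $g$ and $R$ (in particular not on $\sigma$, the noise, $n$, $t$ or $p$): 1. *Expected error.* There are $A,B>0$ such that for all $\sigma\ge0$, all such noise, all even $n\ge2$ and all $1\le p\le\infty$, the error is integrable and $$\mathbb E\big[|\widehat{\mathrm{SC}}_p(X_n,Y_n)-\mathrm{SC}_p(f,g)|\big]\le A\sigma\frac{\log(n)^{m(p)}}{n}+\frac Bn,\qquad m(p)=\max\{1/2-1/p,0\}.$$ 2. *Concentration.* There are $A,B,C>0$ such that for all $\sigma>0$,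 all such noise, all $t\ge0$ and all even $n\ge2$ with $n\ge C/t$ (for $t=0$ this condition is read as always satisfied), $$\mathbb P\big(|\widehat{\mathrm{SC}}_p(X_n,Y_n)-\mathrm{SC}_p(f,g)|\ge t\big)\le A\exp\Big(-B\frac{n^2t^2}{\sigma^2}\Big)\quad\text{for }1\le p\le2,$$ $$\mathbb P\big(|\widehat{\mathrm{SC}}_p(X_n,Y_n)-\mathrm{SC}_p(f,g)|\ge t\big)\le A\,n^2\exp\Big(-B\frac{n^2t^2}{\sigma^2}\Big)\quad\text{for }2<p\le\infty.$$ 3. *Almost sure limit.* For all such noise and every $1\le p\le\infty$, $\widehat{\mathrm{SC}}_p(X_n,Y_n)\to\mathrm{SC}_p(f,g)$ almost surely as $n\to\infty$ through the even integers. -/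

import Mathlib

open Real Set Filter Topology MeasureTheory ProbabilityTheory
open scoped NNReal ENNReal

noncomputable section

namespace SlicedCramer

/-- The Euclidean plane `ℝ²`. -/
abbrev Plane : Type := EuclideanSpace ℝ (Fin 2)

/-- The unit circle `S¹ ⊂ ℝ²`. -/
abbrev UnitCircle : Type := Metric.sphere (0 : Plane) 1

/-! ### The continuous distances -/

/-- The Volterra operator `(𝒱 h)(x) = ∫_a^x h(t) dt` on functions on `[a, b]`. -/
def volterra (a : ℝ) (h : ℝ → ℝ) (x : ℝ) : ℝ := ∫ t in a..x, h t

/-- The Volterra `p`-norm `‖h‖_{V^p} = ‖𝒱 h‖_{L^p(a, b)}`. -/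
def volterraNorm (a b : ℝ) (p : ℝ≥0∞) (h : ℝ → ℝ) : ℝ≥0∞ :=
  eLpNorm (volterra a h) p (volume.restrict (Ioo a b))

/-- The `p`-Cramér distance on the interval `(a, b)`. -/
def cramer (a b : ℝ) (p : ℝ≥0∞) (h₁ h₂ : ℝ → ℝ) : ℝ≥0∞ :=
  volterraNorm a b p (fun t => h₁ t - h₂ t)

/-- The tomographic projection `(𝒫_u f)(t) = ∫_ℝ f(t u + s u^⊥) ds`, where `u^⊥ = (-u₂, u₁)`. -/
def proj (u : Plane) (f : Plane → ℝ) (t : ℝ) : ℝ :=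
  ∫ s : ℝ, f (t • u + s • !₂[-u 1, u 0])

/-- The sliced `p`-Cramér distance with respect to a measure `η` on the unit circle, between
functions on the plane that are supported on the disc of radius `R` centered at the origin
(so that their projections live on `(-R, R)`). -/
def slicedCramer (η : Measure UnitCircle) (R : ℝ) (p : ℝ≥0∞) (f g : Plane → ℝ) : ℝ≥0∞ :=
  if p = ∞ then ⨆ u : UnitCircle, cramer (-R) R ∞ (proj u f) (proj u g)
  else (∫⁻ u : UnitCircle, cramer (-R) R p (proj u f) (proj u g) ^ p.toReal ∂η) ^ (1 / p.toReal)

/-- The unit vector `(cos θ, sin θ)`. -/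
def dir (θ : ℝ) : UnitCircle :=
  ⟨!₂[cos θ, sin θ], by simp [EuclideanSpace.norm_eq]⟩

/-- The uniform probability measure on the unit circle: the law of `(cos θ, sin θ)` for `θ`
uniformly distributed on `(0, 2π]`. -/
def uniformCircle : Measure UnitCircle :=
  (ENNReal.ofReal (2 * π))⁻¹ • (volume.restrict (Ioc 0 (2 * π))).map dir

/-! ### The discrete distances -/

/-- The grid points `t_j = -R + 2 R j / n`. -/
def grid (R : ℝ) (n j : ℕ) : ℝ := -R + 2 * R * j / n

/-- The angles `θ_ℓ = π ℓ / n`. -/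
def angle (n l : ℕ) : ℝ := π * l / n

/-- The (non-uniform) discrete Fourier coefficients `α_θ[k]` of the array `x`, where `L = 2 R`. -/
def alpha (R : ℝ) {n : ℕ} (x : Fin n → Fin n → ℝ) (θ : ℝ) (k : ℤ) : ℂ :=
  (((2 * R) ^ 2 / (n : ℝ) ^ 2 : ℝ) : ℂ) * ∑ i : Fin n, ∑ j : Fin n,
    (x i j : ℂ) * Complex.exp (-(2 * (π : ℂ) * Complex.I * (k : ℂ) *
      ((grid R n i * cos θ + grid R n j * sin θ : ℝ) : ℂ) / ((2 * R : ℝ) : ℂ)))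

/-- `α_θ[k] / (2 π i k / L)`, to be used for `k ≠ 0`. -/
def betaNonzero (R : ℝ) {n : ℕ} (x : Fin n → Fin n → ℝ) (θ : ℝ) (k : ℤ) : ℂ :=
  alpha R x θ k / (2 * (π : ℂ) * Complex.I * (k : ℂ) / ((2 * R : ℝ) : ℂ))

/-- The frequencies `-n/2 + 1, …, n/2 - 1` (for even `n`). -/
def freqs (n : ℕ) : Finset ℤ := Finset.Icc (-((n / 2 : ℕ) : ℤ) + 1) (((n / 2 : ℕ) : ℤ) - 1)

/-- The coefficients `β_θ[k]`, `|k| < n/2`. -/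
def betaCoef (R : ℝ) {n : ℕ} (x : Fin n → Fin n → ℝ) (θ : ℝ) (k : ℤ) : ℂ :=
  if k = 0 then
    -∑ m ∈ (freqs n).erase 0, betaNonzero R x θ m *
      Complex.exp (-(2 * (π : ℂ) * Complex.I * (m : ℂ) * (R : ℂ) / ((2 * R : ℝ) : ℂ)))
  else betaNonzero R x θ k

/-- The approximate Volterra transform `ν_x(t, θ)`. -/
def nu (R : ℝ) {n : ℕ} (x : Fin n → Fin n → ℝ) (t θ : ℝ) : ℂ :=
  1 / ((2 * R : ℝ) : ℂ) * ∑ k ∈ freqs n, betaCoef R x θ k *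
    Complex.exp (2 * (π : ℂ) * Complex.I * (t : ℂ) * (k : ℂ) / ((2 * R : ℝ) : ℂ))

/-- The discrete sliced Volterra norm `SV_p(x)`. -/
def discreteSV (R : ℝ) {n : ℕ} (p : ℝ≥0∞) (x : Fin n → Fin n → ℝ) : ℝ :=
  if p = ∞ then ⨆ q : Fin n × Fin n, ‖nu R x (grid R n q.1) (angle n q.2)‖
  else (1 / (n : ℝ) * ∑ l ∈ Finset.range n, 2 * R / (n : ℝ) * ∑ j ∈ Finset.range (n + 1),
    ‖nu R x (grid R n j) (angle n l)‖ ^ p.toReal) ^ (1 / p.toReal)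

/-- The discrete sliced Cramér distance between two `n × n` arrays. -/
def discreteSC (R : ℝ) {n : ℕ} (p : ℝ≥0∞) (x y : Fin n → Fin n → ℝ) : ℝ :=
  discreteSV R p (fun i j => x i j - y i j)

/-! ### The noise model -/

/-- The arrays `Z[j,k]`, `Z'[j,k]` (`j, k ≥ 0`) consist of jointly independent centered Gaussians
with variances `s[j,k]²` and `s'[j,k]²` (a Gaussian of variance `0` is the constant `0`), and for
every even `n ≥ 2` the average noise level over the first `n × n` entries is at most `σ²`. -/
structure IsNoise {Ω : Type*} [MeasurableSpace Ω] (P : Measure Ω) (Z Z' : ℕ → ℕ → Ω → ℝ)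
    (s s' : ℕ → ℕ → ℝ≥0) (σ : ℝ) : Prop where
  law : ∀ j k, HasLaw (Z j k) (gaussianReal 0 (s j k ^ 2)) P
  law' : ∀ j k, HasLaw (Z' j k) (gaussianReal 0 (s' j k ^ 2)) P
  indep : iIndepFun (fun q : (ℕ × ℕ) ⊕ (ℕ × ℕ) =>
    Sum.elim (fun a => Z a.1 a.2) (fun a => Z' a.1 a.2) q) P
  bound : ∀ n : ℕ, 2 ≤ n → Even n →
    1 / (n : ℝ) ^ 2 * ∑ k ∈ Finset.range n, ∑ j ∈ Finset.range n, (s j k : ℝ) ^ 2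
      + 1 / (n : ℝ) ^ 2 * ∑ k ∈ Finset.range n, ∑ j ∈ Finset.range n, (s' j k : ℝ) ^ 2 ≤ σ ^ 2

/-- The noisy samples `f(t_j, t_k) + Z[j,k]`, `0 ≤ j, k ≤ n - 1`, at the sample point `ω`. -/
def noisySamples {Ω : Type*} (R : ℝ) (f : Plane → ℝ) (Z : ℕ → ℕ → Ω → ℝ) (n : ℕ) (ω : Ω) :
    Fin n → Fin n → ℝ :=
  fun j k => f !₂[grid R n j, grid R n k] + Z j k ω

/-- The error `|SĈ_p(X_n, Y_n) - SC_p(f, g)|` at the sample point `ω`. -/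
def err {Ω : Type*} (R : ℝ) (f g : Plane → ℝ) (Z Z' : ℕ → ℕ → Ω → ℝ) (n : ℕ) (p : ℝ≥0∞)
    (ω : Ω) : ℝ :=
  |discreteSC R p (noisySamples R f Z n ω) (noisySamples R g Z' n ω)
    - (slicedCramer uniformCircle R p f g).toReal|

/-- The exponent `m(p) = max {1/2 - 1/p, 0}`, with `1/∞ = 0`. -/
def logExp (p : ℝ≥0∞) : ℝ := max (1 / 2 - (1 / p).toReal) 0

end SlicedCramer

end

/-!
The error splits into a deterministic discretization error and the discrete norm of the noise,
because `ν` is linear in the array: `nu_eq_kernel` writes `ν_x(t, θ)` as a real linear combination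
of the entries of `x`, whose weights are `O(n⁻²)` since the partial sums of the sawtooth series
`∑ sin (k x) / k` are uniformly bounded (`abs_sawSum_le`).

*Discretization.* Let `d = f - g` and let `F_u = 𝒱 𝒫_u d` be its cumulative projections. By Poisson
summation, sampling the smooth function `d` on the square grid computes its Fourier transform up to
`O(n⁻²)`, uniformly below the Nyquist frequency (`IsBump.exists_norm_grid_sum_sub_le`). By the
Fourier slice theorem the coefficients `α_θ[k]` thus approximate the Fourier coefficients of
`𝒫_u d`, and `β_θ[k]` those of `F_u`. As `d` has total mass zero, `F_u` is supported in `[-R, R]`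
and its Fourier transform decays cubically, uniformly in `u`; truncating its Fourier series at `n/2`
costs at most `O(1/n)`. Hence `ν` of the samples is within `O(1/n)` of `F_u`
(`IsBump.exists_norm_nu_sub_cumProj_le`). Since `F_u(t)` is Lipschitz in `u` and `t`, the step
function with the values of `ν` at the grid points is within `O(1/n)` of `F_u` too. The discrete
norm is the `L^p` norm of this step function for a measure of total mass `2 R` on angles and
heights, and opposite directions give reflected cumulative projections, so that the half circle
`[0, π)` of angles suffices; the triangle inequality in `L^p` then gives
`exists_abs_discreteSV_sub_le`, uniformly in `p`.

*Noise.* At each grid point the noise enters through a centered Gaussian whose variance is at most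
`V = O(σ² / n²)` (`IsNoise.exists_hasLaw_nu`), so that `exp (|ν|² / (4 V))` has mean at most `2`.
By convexity of the exponential function the same bound holds for the mean square of `ν` over the
grid (`IsNoise.integral_exp_meanSq_le`), and by a union bound its maximum satisfies it with `2 n²`
in place of `2` (`IsNoise.integral_exp_top_le`). The discrete `p`-norm is at most a constant times
the root mean square for `p ≤ 2`, and times a geometric mean of the root mean square and the maximum
for `p ≥ 2`. Jensen's inequality turns the exponential moments into bounds on the mean, where the
interpolation produces the power `m(p)` of `log n`; Markov's inequality turns them into tail bounds;
and the fourth moments of the maximum are `O(n⁻²)`, hence summable, which gives almost sure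
convergence.
-/

noncomputable section

namespace SlicedCramer

/-! ### Partial sums of the sawtooth series -/

/-- The partial sum `∑_{k=1}^N sin (k x) / k` of the Fourier series of the sawtooth function. -/
def sawSum (N : ℕ) (x : ℝ) : ℝ := ∑ k ∈ Finset.range N, sin ((k + 1) * x) / (k + 1)

lemma abs_sin_nat_mul_le (k : ℕ) (y : ℝ) : |sin (k * y)| ≤ k * |sin y| := by
  induction k with
  | zero => simp
  | succ k ih =>
    have h : ((k + 1 : ℕ) : ℝ) * y = k * y + y := by push_cast; ring
    rw [h, sin_add]
    have h1 : |sin (k * y) * cos y| ≤ |sin (k * y)| := by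
      rw [abs_mul]; exact mul_le_of_le_one_right (abs_nonneg _) (abs_cos_le_one _)
    have h2 : |cos (k * y) * sin y| ≤ |sin y| := by
      rw [abs_mul]; exact mul_le_of_le_one_left (abs_nonneg _) (abs_cos_le_one _)
    calc _ ≤ |sin (k * y) * cos y| + |cos (k * y) * sin y| := abs_add_le _ _
      _ ≤ k * |sin y| + |sin y| := by linarith
      _ = _ := by push_cast; ring

lemma abs_sawSum_low_le (m : ℕ) (x : ℝ) : |sawSum m x| ≤ 2 * m * |sin (x / 2)| := by
  have : ∀ k ∈ Finset.range m, |sin (((k : ℕ) + 1) * x) / (k + 1)| ≤ 2 * |sin (x / 2)| := by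
    intro k _
    have h := abs_sin_nat_mul_le (k + 1) x
    have hx : |sin x| ≤ 2 * |sin (x / 2)| := by
      conv_lhs => rw [show x = 2 * (x / 2) by ring]
      simpa using abs_sin_nat_mul_le 2 (x / 2)
    have hk : (0 : ℝ) < k + 1 := by positivity
    rw [abs_div, abs_of_pos hk, div_le_iff₀ hk]
    push_cast at h
    nlinarith [abs_nonneg (sin (x / 2))]
  calc |sawSum m x| ≤ ∑ k ∈ Finset.range m, |sin (((k : ℕ) + 1) * x) / (k + 1)| :=
        Finset.abs_sum_le_sum_abs _ _
    _ ≤ ∑ _k ∈ Finset.range m, 2 * |sin (x / 2)| := Finset.sum_le_sum this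
    _ = _ := by simp; ring

/-- Summation by parts, with the boundary term kept on the left so that the bound telescopes. -/
lemma abs_sawSum_high_le (m d : ℕ) (x : ℝ) :
    |2 * sin (x / 2) * (sawSum (m + d) x - sawSum m x)
      + cos ((m + d + 1 / 2) * x) / (m + d + 1)| ≤ 2 / (m + 1) - 1 / (m + d + 1) := by
  induction d with
  | zero =>
    have hm : (0 : ℝ) < m + 1 := by positivity
    simp only [add_zero, sub_self, mul_zero, zero_add, Nat.cast_zero, abs_div, abs_of_pos hm]
    rw [← sub_div]
    gcongr
    linarith [abs_cos_le_one ((m + 1 / 2) * x)]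
  | succ d ih =>
    have hs : 2 * sin (x / 2) * sin ((m + d + 1) * x)
        = cos ((m + d + 1 / 2) * x) - cos ((m + d + 1 + 1 / 2) * x) := by
      have e1 : (m + d + 1 / 2 : ℝ) * x = (m + d + 1) * x - x / 2 := by ring
      have e2 : (m + d + 1 + 1 / 2 : ℝ) * x = (m + d + 1) * x + x / 2 := by ring
      rw [e1, e2, cos_sub, cos_add]; ring
    have hS : sawSum (m + (d + 1)) x = sawSum (m + d) x
        + sin ((m + d + 1) * x) / (m + d + 1) := by
      rw [← add_assoc, sawSum, Finset.sum_range_succ, ← sawSum]; push_cast; ring_nf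
    have hp : (0 : ℝ) < m + d + 1 := by positivity
    have hc := abs_cos_le_one ((m + d + 1 + 1 / 2 : ℝ) * x)
    have key : 2 * sin (x / 2) * (sawSum (m + (d + 1)) x - sawSum m x)
        + cos ((m + (d + 1 : ℕ) + 1 / 2) * x) / (m + (d + 1 : ℕ) + 1)
        = (2 * sin (x / 2) * (sawSum (m + d) x - sawSum m x)
          + cos ((m + d + 1 / 2) * x) / (m + d + 1))
          - cos ((m + d + 1 + 1 / 2) * x) * (1 / (m + d + 1) - 1 / (m + d + 1 + 1)) := by
      rw [hS]
      have : 2 * sin (x / 2) * (sawSum (m + d) x + sin ((m + d + 1) * x) / (m + d + 1)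
          - sawSum m x) = 2 * sin (x / 2) * (sawSum (m + d) x - sawSum m x)
          + (2 * sin (x / 2) * sin ((m + d + 1) * x)) / (m + d + 1) := by ring
      rw [this, hs]; push_cast; ring_nf
    rw [key]
    have hpos : 0 ≤ 1 / (m + d + 1 : ℝ) - 1 / (m + d + 1 + 1) := by
      rw [sub_nonneg]; exact one_div_le_one_div_of_le hp (by linarith)
    calc _ ≤ _ := abs_sub _ _
      _ ≤ (2 / (m + 1) - 1 / (m + d + 1)) + 1 * (1 / (m + d + 1 : ℝ) - 1 / (m + d + 1 + 1)) := by
        rw [abs_mul, abs_of_nonneg hpos]; gcongr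
      _ = _ := by push_cast; ring

/-- The partial sums of the sawtooth series are bounded uniformly: the terms with
`k ≤ 1 / |sin (x / 2)|` are small one by one, the others cancel. -/
lemma abs_sawSum_le (N : ℕ) (x : ℝ) : |sawSum N x| ≤ 4 := by
  set y := |sin (x / 2)| with hy
  have hy0 : 0 ≤ y := abs_nonneg _
  have hlow : ∀ m : ℕ, (m : ℝ) * y ≤ 1 → |sawSum m x| ≤ 2 := fun m hm =>
    (abs_sawSum_low_le m x).trans (by rw [← hy]; linarith)
  by_cases hN : (N : ℝ) * y ≤ 1
  · linarith [hlow N hN]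
  push Not at hN
  have hypos : 0 < y := by
    rcases hy0.lt_or_eq with h | h
    · exact h
    · rw [← h] at hN; norm_num at hN
  set m := ⌊1 / y⌋₊ with hm
  have hmy : (m : ℝ) * y ≤ 1 := by
    rw [← le_div_iff₀ hypos]; exact Nat.floor_le (by positivity)
  have hmy' : 1 < (m + 1 : ℝ) * y := by
    rw [← div_lt_iff₀ hypos]; exact Nat.lt_floor_add_one _
  have hmN : m ≤ N := by
    by_contra h
    push Not at h
    have : (N : ℝ) ≤ m := by exact_mod_cast h.le
    nlinarith
  obtain ⟨d, rfl⟩ := Nat.exists_eq_add_of_le hmN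
  have h1 := abs_sawSum_high_le m d x
  have hp : (0 : ℝ) < m + d + 1 := by positivity
  have h2 : |cos ((m + d + 1 / 2) * x) / (m + d + 1)| ≤ 1 / (m + d + 1) := by
    rw [abs_div, abs_of_pos hp]; gcongr; exact abs_cos_le_one _
  have h3 : |2 * sin (x / 2) * (sawSum (m + d) x - sawSum m x)| ≤ 2 / (m + 1) := by
    have := abs_sub (2 * sin (x / 2) * (sawSum (m + d) x - sawSum m x)
      + cos ((m + d + 1 / 2) * x) / (m + d + 1)) (cos ((m + d + 1 / 2) * x) / (m + d + 1))
    rw [add_sub_cancel_right] at this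
    linarith
  rw [abs_mul, abs_mul, abs_two, ← hy, le_div_iff₀ (by positivity)] at h3
  have h4 : |sawSum (m + d) x - sawSum m x| ≤ 1 := by
    nlinarith [abs_nonneg (sawSum (m + d) x - sawSum m x)]
  have h5 := hlow m hmy
  have := abs_add_le (sawSum (m + d) x - sawSum m x) (sawSum m x)
  rw [sub_add_cancel] at this
  linarith

lemma sawSum_add_two_pi (N : ℕ) (x : ℝ) : sawSum N (x + 2 * π) = sawSum N x := by
  refine Finset.sum_congr rfl fun k _ => ?_
  have : ((k : ℝ) + 1) * (x + 2 * π) = (k + 1) * x + ((k + 1 : ℕ) : ℝ) * (2 * π) := by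
    push_cast; ring
  rw [this, sin_add_nat_mul_two_pi]

/-! ### The approximate Volterra transform as a kernel sum -/

lemma freqs_erase_zero {n : ℕ} :
    (freqs n).erase 0 = (Finset.range (n / 2 - 1)).image (fun k : ℕ => (k + 1 : ℤ))
      ∪ (Finset.range (n / 2 - 1)).image (fun k : ℕ => -(k + 1 : ℤ)) := by
  ext k
  simp only [freqs, Finset.mem_erase, Finset.mem_Icc, Finset.mem_union, Finset.mem_image,
    Finset.mem_range]
  constructor
  · rintro ⟨h0, h1, h2⟩
    rcases lt_or_gt_of_ne h0 with h | h
    · exact Or.inr ⟨(-k - 1).toNat, by omega, by omega⟩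
    · exact Or.inl ⟨(k - 1).toNat, by omega, by omega⟩
  · rintro (⟨a, ha, rfl⟩ | ⟨a, ha, rfl⟩) <;> omega

lemma sum_freqs_erase_zero {n : ℕ} (φ : ℤ → ℂ) :
    ∑ k ∈ (freqs n).erase 0, φ k
      = ∑ k ∈ Finset.range (n / 2 - 1), (φ (k + 1 : ℤ) + φ (-(k + 1 : ℤ))) := by
  rw [freqs_erase_zero, Finset.sum_union, Finset.sum_image, Finset.sum_image,
    Finset.sum_add_distrib]
  · intro a _ b _ h; simpa using h
  · intro a _ b _ h; simpa using h
  · rw [Finset.disjoint_left]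
    intro k h1 h2
    simp only [Finset.mem_image, Finset.mem_range] at h1 h2
    obtain ⟨a, _, ha⟩ := h1
    obtain ⟨b, _, hb⟩ := h2
    omega

/-- Opposite frequencies combine into a sine. -/
lemma sum_freqs_exp_div {n : ℕ} (R x : ℝ) (hR : R ≠ 0) :
    ∑ k ∈ (freqs n).erase 0, Complex.exp (Complex.I * (k : ℂ) * (x : ℂ)) /
      (2 * (π : ℂ) * Complex.I * (k : ℂ) / ((2 * R : ℝ) : ℂ))
      = ((2 * R / π * sawSum (n / 2 - 1) x : ℝ) : ℂ) := by
  rw [sum_freqs_erase_zero, sawSum, Finset.mul_sum, Complex.ofReal_sum]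
  refine Finset.sum_congr rfl fun k _ => ?_
  have hk : (k + 1 : ℂ) ≠ 0 := by exact_mod_cast Nat.succ_ne_zero k
  have hπ : (π : ℂ) ≠ 0 := by exact_mod_cast pi_ne_zero
  have hR' : (R : ℂ) ≠ 0 := by exact_mod_cast hR
  push_cast
  generalize (k + 1 : ℂ) = c at hk ⊢
  rw [Complex.sin, show Complex.I * c * (x : ℂ) = c * x * Complex.I by ring,
    show Complex.I * -c * (x : ℂ) = -(c * x) * Complex.I by ring]
  field_simp
  rw [Complex.I_sq]
  ring

/-- The weight with which the entry `x[i, j]` enters `ν_x(t, θ)`; here `τ` is the height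
`t_i cos θ + t_j sin θ` of the grid point. -/
def nuKernel (R : ℝ) (n : ℕ) (t τ : ℝ) : ℝ :=
  4 * R ^ 2 / (π * n ^ 2) * (sawSum (n / 2 - 1) (2 * π * (t - τ) / (2 * R))
    - sawSum (n / 2 - 1) (2 * π * (-R - τ) / (2 * R)))

/-- The weights are `O(n⁻²)` without a logarithm, by the uniform bound on the sawtooth sums. -/
lemma abs_nuKernel_le (R : ℝ) (n : ℕ) (t τ : ℝ) :
    |nuKernel R n t τ| ≤ 32 * R ^ 2 / (π * n ^ 2) := by
  have h1 := abs_sawSum_le (n / 2 - 1) (2 * π * (t - τ) / (2 * R))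
  have h2 := abs_sawSum_le (n / 2 - 1) (2 * π * (-R - τ) / (2 * R))
  have h3 := abs_sub (sawSum (n / 2 - 1) (2 * π * (t - τ) / (2 * R)))
    (sawSum (n / 2 - 1) (2 * π * (-R - τ) / (2 * R)))
  have hn : 0 ≤ 4 * R ^ 2 / (π * n ^ 2) := by positivity
  rw [nuKernel, abs_mul, abs_of_nonneg hn]
  calc _ ≤ 4 * R ^ 2 / (π * n ^ 2) * 8 := by gcongr; linarith
    _ = _ := by ring

lemma nuKernel_right {R : ℝ} (hR : R ≠ 0) (n : ℕ) (τ : ℝ) : nuKernel R n R τ = 0 := by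
  have : 2 * π * (R - τ) / (2 * R) = 2 * π * (-R - τ) / (2 * R) + 2 * π := by
    field_simp; ring
  rw [nuKernel, this, sawSum_add_two_pi, sub_self, mul_zero]

/-- `ν_x(t, θ)` as a sum over the nonzero frequencies. -/
lemma nu_eq_sum_freqs (R : ℝ) {n : ℕ} (hn : 2 ≤ n) (x : Fin n → Fin n → ℝ) (t θ : ℝ) :
    nu R x t θ = 1 / ((2 * R : ℝ) : ℂ) * ∑ k ∈ (freqs n).erase 0, betaNonzero R x θ k *
      (Complex.exp (2 * (π : ℂ) * Complex.I * (t : ℂ) * (k : ℂ) / ((2 * R : ℝ) : ℂ)) -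
        Complex.exp (2 * (π : ℂ) * Complex.I * ((-R : ℝ) : ℂ) * (k : ℂ) / ((2 * R : ℝ) : ℂ))) := by
  have h0 : (0 : ℤ) ∈ freqs n := by
    simp only [freqs, Finset.mem_Icc]; omega
  have h1 : ∀ k ∈ (freqs n).erase 0, betaCoef R x θ k = betaNonzero R x θ k := by
    intro k hk
    rw [betaCoef, if_neg (Finset.ne_of_mem_erase hk)]
  rw [nu, ← Finset.add_sum_erase _ _ h0,
    Finset.sum_congr rfl (fun k hk => by rw [h1 k hk])]
  congr 1
  simp only [betaCoef, if_true, Int.cast_zero, mul_zero, zero_div, Complex.exp_zero, mul_one,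
    mul_sub, Finset.sum_sub_distrib]
  rw [neg_add_eq_sub]
  congr 1
  refine Finset.sum_congr rfl fun k _ => ?_
  congr 2
  push_cast
  ring

/-- `ν_x(t, θ)` is real, and linear in `x` with an explicit kernel. -/
lemma nu_eq_kernel {R : ℝ} (hR : 0 < R) {n : ℕ} (hn : 2 ≤ n) (x : Fin n → Fin n → ℝ) (t θ : ℝ) :
    nu R x t θ = ((∑ i : Fin n, ∑ j : Fin n, x i j *
      nuKernel R n t (grid R n i * cos θ + grid R n j * sin θ) : ℝ) : ℂ) := by
  have hR' : (R : ℂ) ≠ 0 := by exact_mod_cast hR.ne'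
  have key : ∀ τ : ℝ, ((nuKernel R n t τ : ℝ) : ℂ) = 1 / ((2 * R : ℝ) : ℂ) *
      (((2 * R) ^ 2 / (n : ℝ) ^ 2 : ℝ) : ℂ) * ∑ k ∈ (freqs n).erase 0,
        Complex.exp (-(2 * (π : ℂ) * Complex.I * (k : ℂ) * (τ : ℂ) / ((2 * R : ℝ) : ℂ))) /
          (2 * (π : ℂ) * Complex.I * (k : ℂ) / ((2 * R : ℝ) : ℂ)) *
      (Complex.exp (2 * (π : ℂ) * Complex.I * (t : ℂ) * (k : ℂ) / ((2 * R : ℝ) : ℂ)) -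
        Complex.exp (2 * (π : ℂ) * Complex.I * ((-R : ℝ) : ℂ) * (k : ℂ) / ((2 * R : ℝ) : ℂ))) := by
    intro τ
    have e : ∀ (s : ℝ) (k : ℤ),
        Complex.exp (-(2 * (π : ℂ) * Complex.I * (k : ℂ) * (τ : ℂ) / ((2 * R : ℝ) : ℂ))) /
          (2 * (π : ℂ) * Complex.I * (k : ℂ) / ((2 * R : ℝ) : ℂ)) *
        Complex.exp (2 * (π : ℂ) * Complex.I * (s : ℂ) * (k : ℂ) / ((2 * R : ℝ) : ℂ))
        = Complex.exp (Complex.I * (k : ℂ) * ((2 * π * (s - τ) / (2 * R) : ℝ) : ℂ)) /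
          (2 * (π : ℂ) * Complex.I * (k : ℂ) / ((2 * R : ℝ) : ℂ)) := by
      intro s k
      rw [div_mul_eq_mul_div, ← Complex.exp_add]
      congr 2
      push_cast
      ring
    simp only [mul_sub, Finset.sum_sub_distrib, e]
    rw [sum_freqs_exp_div R _ hR.ne', sum_freqs_exp_div R _ hR.ne', ← mul_sub, nuKernel]
    push_cast
    field_simp
    ring
  rw [nu_eq_sum_freqs R hn]
  push_cast [key]
  simp only [betaNonzero, alpha, Finset.mul_sum, Finset.sum_mul, Finset.sum_div]
  rw [Finset.sum_comm]
  refine Finset.sum_congr rfl fun i _ => ?_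
  rw [Finset.sum_comm]
  refine Finset.sum_congr rfl fun j _ => ?_
  refine Finset.sum_congr rfl fun k _ => ?_
  push_cast
  ring

/-- The choice of `β_θ[0]` makes `ν_x` vanish at `-R`, hence by periodicity at `R`. -/
lemma nu_right {R : ℝ} (hR : 0 < R) {n : ℕ} (hn : 2 ≤ n) (x : Fin n → Fin n → ℝ) (θ : ℝ) :
    nu R x (grid R n n) θ = 0 := by
  have : grid R n n = R := by
    have : (n : ℝ) ≠ 0 := by positivity
    rw [grid]; field_simp; ring
  simp [nu_eq_kernel hR hn, this, nuKernel_right hR.ne']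

lemma nu_add {R : ℝ} (hR : 0 < R) {n : ℕ} (hn : 2 ≤ n) (x y : Fin n → Fin n → ℝ) (t θ : ℝ) :
    nu R (fun i j => x i j + y i j) t θ = nu R x t θ + nu R y t θ := by
  simp only [nu_eq_kernel hR hn, add_mul, Finset.sum_add_distrib, Complex.ofReal_add]

/-! ### Fourier transforms and sampling of functions supported in `[-R, R]` -/

open scoped FourierTransform

lemma continuous_fourierChar_smul {X : Type*} [TopologicalSpace X] {a : X → ℝ} {φ : X → ℂ}
    (ha : Continuous a) (hφ : Continuous φ) : Continuous fun x => 𝐞 (a x) • φ x := by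
  simp only [Circle.smul_def]
  exact (continuous_subtype_val.comp (continuous_fourierChar.comp ha)).smul hφ

lemma eq_zero_of_notMem_Ioo {E : Type*} [NormedAddCommGroup E] {φ : ℝ → E} {R : ℝ}
    (hc : Continuous φ) (hs : Function.support φ ⊆ Icc (-R) R) {x : ℝ} (hx : x ∉ Ioo (-R) R) :
    φ x = 0 := by
  have : Function.support φ ⊆ Ioo (-R) R := by
    rw [← interior_Icc]
    exact interior_maximal hs (hc.isOpen_support)
  by_contra h
  exact hx (this h)

lemma support_deriv_subset {E : Type*} [NormedAddCommGroup E] [NormedSpace ℝ E]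
    {φ φ' : ℝ → E} {R : ℝ} (hd : ∀ x, HasDerivAt φ (φ' x) x)
    (hs : Function.support φ ⊆ Icc (-R) R) : Function.support φ' ⊆ Icc (-R) R := by
  intro x hx
  by_contra h
  refine hx ((hd x).unique ?_)
  refine (hasDerivAt_const x (0 : E)).congr_of_eventuallyEq ?_
  filter_upwards [isClosed_Icc.isOpen_compl.mem_nhds h] with y hy
  by_contra h'
  exact hy (hs h')

lemma hasCompactSupport_of_Icc {E : Type*} [NormedAddCommGroup E] {φ : ℝ → E} {R : ℝ}
    (hs : Function.support φ ⊆ Icc (-R) R) : HasCompactSupport φ :=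
  HasCompactSupport.of_support_subset_isCompact isCompact_Icc hs

lemma norm_integral_le_of_support {E : Type*} [NormedAddCommGroup E] [NormedSpace ℝ E]
    {φ : ℝ → E} {R M : ℝ} (hR : 0 < R) (hs : Function.support φ ⊆ Icc (-R) R)
    (hM : ∀ x, ‖φ x‖ ≤ M) : ‖∫ x, φ x‖ ≤ 2 * R * M := by
  rw [← setIntegral_eq_integral_of_forall_compl_eq_zero (s := Icc (-R) R)
    (fun x hx => by by_contra h; exact hx (hs h))]
  refine (norm_setIntegral_le_of_norm_le_const (by simp) (fun x _ => hM x)).trans_eq ?_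
  rw [Measure.real, Real.volume_Icc, ENNReal.toReal_ofReal (by linarith)]
  ring

lemma norm_fourier_le {φ : ℝ → ℂ} {R M : ℝ} (hR : 0 < R)
    (hs : Function.support φ ⊆ Icc (-R) R) (hM : ∀ x, ‖φ x‖ ≤ M) (ξ : ℝ) :
    ‖𝓕 φ ξ‖ ≤ 2 * R * M := by
  rw [fourier_real_eq]
  refine norm_integral_le_of_support hR (fun x hx => hs fun h => hx ?_) (fun x => ?_)
  · simp [h]
  · rw [Circle.norm_smul]; exact hM x

lemma norm_fourier_deriv {φ φ' : ℝ → ℂ} {R : ℝ} (hd : ∀ x, HasDerivAt φ (φ' x) x)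
    (hc : Continuous φ') (hs : Function.support φ ⊆ Icc (-R) R) (ξ : ℝ) :
    2 * π * |ξ| * ‖𝓕 φ ξ‖ = ‖𝓕 φ' ξ‖ := by
  have hdiff : Differentiable ℝ φ := fun x => (hd x).differentiableAt
  have he : deriv φ = φ' := funext fun x => (hd x).deriv
  have h := fourier_deriv (f := φ)
    (hdiff.continuous.integrable_of_hasCompactSupport (hasCompactSupport_of_Icc hs)) hdiff
    (by rw [he]; exact hc.integrable_of_hasCompactSupport
          (hasCompactSupport_of_Icc (support_deriv_subset hd hs)))
  rw [← he, h]
  simp [abs_of_pos pi_pos]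

lemma norm_fourier_le_of_hasDerivAt_two {φ φ' φ'' : ℝ → ℂ} {R M : ℝ} (hR : 0 < R)
    (hd : ∀ x, HasDerivAt φ (φ' x) x) (hd' : ∀ x, HasDerivAt φ' (φ'' x) x)
    (hc : Continuous φ'') (hs : Function.support φ ⊆ Icc (-R) R) (hM : ∀ x, ‖φ'' x‖ ≤ M)
    (ξ : ℝ) : (2 * π * |ξ|) ^ 2 * ‖𝓕 φ ξ‖ ≤ 2 * R * M := by
  have hc' : Continuous φ' :=
    continuous_iff_continuousAt.2 fun x => (hd' x).continuousAt
  have hs' := support_deriv_subset hd hs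
  rw [pow_two, mul_assoc, norm_fourier_deriv hd hc' hs, norm_fourier_deriv hd' hc hs']
  exact norm_fourier_le hR (support_deriv_subset hd' hs') hM ξ

/-- Poisson summation with step `T`, for functions supported in `[-R, R]`. -/
lemma tsum_eq_tsum_fourier_step {ψ : ℝ → ℂ} {R T : ℝ} (hT : 0 < T) (hc : Continuous ψ)
    (hs : Function.support ψ ⊆ Icc (-R) R) (hsum : Summable fun k : ℤ => 𝓕 ψ (k / T)) (x : ℝ) :
    ∑' m : ℤ, ψ (x + T * m) = (1 / T : ℂ) *
      ∑' k : ℤ, 𝓕 ψ (k / T) * Complex.exp (2 * π * Complex.I * k * x / T) := by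
  have hT' : (T : ℂ) ≠ 0 := by exact_mod_cast hT.ne'
  set f : ℝ → ℂ := fun y => ψ (T * y) with hf
  have hF : ∀ k : ℤ, 𝓕 f k = (1 / T : ℂ) * 𝓕 ψ (k / T) := by
    intro k
    rw [fourier_real_eq, fourier_real_eq]
    have := Measure.integral_comp_mul_left (fun v : ℝ => 𝐞 (-(v * (k / T))) • ψ v) T
    rw [abs_of_pos (inv_pos.2 hT)] at this
    rw [one_div, ← Complex.ofReal_inv, ← Complex.real_smul, ← this]
    congr 1
    ext v
    congr 3
    field_simp
  have hfs : Function.support f ⊆ Icc (-(R / T)) (R / T) := by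
    intro y hy
    have := hs (show ψ (T * y) ≠ 0 from hy)
    rw [mem_Icc] at this ⊢
    rw [← neg_div, div_le_iff₀ hT, le_div_iff₀ hT]
    constructor <;> nlinarith [this.1, this.2]
  have hO : f =O[cocompact ℝ] fun x : ℝ => |x| ^ (-2 : ℝ) := by
    refine Asymptotics.IsBigO.of_bound 1 ?_
    filter_upwards [(isCompact_Icc (a := -(R / T)) (b := R / T)).compl_mem_cocompact] with y hy
    have : f y = 0 := by by_contra h; exact hy (hfs h)
    rw [this, norm_zero]; positivity
  have hFs : Summable fun k : ℤ => 𝓕 f k := by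
    simp_rw [hF]; exact hsum.mul_left _
  have key := Real.tsum_eq_tsum_fourier_of_rpow_decay_of_summable (f := f)
    (hc.comp (continuous_const.mul continuous_id)) one_lt_two hO hFs (x / T)
  have e1 : ∀ m : ℤ, f (x / T + m) = ψ (x + T * m) := by
    intro m; simp only [hf]; congr 1; field_simp
  simp_rw [e1, hF] at key
  rw [key, ← tsum_mul_left]
  refine tsum_congr fun k => ?_
  rw [fourier_coe_apply, mul_assoc]
  congr 3
  push_cast
  field_simp

/-- The sum `∑_{k ≠ 0} 1 / k²` over the integers; the term at `k = 0` is `1 / 0 = 0`. -/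
def zetaSum : ℝ := ∑' k : ℤ, 1 / (k : ℝ) ^ 2

lemma summable_one_div_int_sq : Summable fun k : ℤ => 1 / (k : ℝ) ^ 2 :=
  Real.summable_one_div_int_pow.2 one_lt_two

lemma zetaSum_nonneg : 0 ≤ zetaSum := tsum_nonneg fun _ => by positivity

/-- The error of a partial sum of a series over the integers whose other terms decay
quadratically. -/
lemma norm_tsum_sub_sum_le {a : ℤ → ℂ} {C : ℝ} (hC : 0 ≤ C) (s : Finset ℤ)
    (h : ∀ k ∉ s, ‖a k‖ ≤ C * (1 / (k : ℝ) ^ 2)) :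
    Summable a ∧ ‖∑' k, a k - ∑ k ∈ s, a k‖ ≤ C * zetaSum := by
  have hb : Summable fun k : ℤ => C * (1 / (k : ℝ) ^ 2) := summable_one_div_int_sq.mul_left C
  have hle : ∀ k, ‖if k ∈ s then 0 else a k‖ ≤ C * (1 / (k : ℝ) ^ 2) := by
    intro k
    split_ifs with hk
    · rw [norm_zero]; positivity
    · exact h k hk
  have h1 : Summable fun k => if k ∈ s then 0 else a k := Summable.of_norm_bounded hb hle
  have h2 : HasSum (fun k => if k ∈ s then a k else 0) (∑ k ∈ s, if k ∈ s then a k else 0) :=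
    hasSum_sum_of_ne_finset_zero fun k hk => by rw [if_neg hk]
  rw [Finset.sum_congr rfl (g := a) (fun k hk => by rw [if_pos hk])] at h2
  have h3 := h1.hasSum.add h2
  have e : (fun k => (if k ∈ s then 0 else a k) + if k ∈ s then a k else 0) = a := by
    ext k; split_ifs <;> simp
  rw [e] at h3
  refine ⟨h3.summable, ?_⟩
  rw [h3.tsum_eq, add_sub_cancel_right, zetaSum, ← tsum_mul_left]
  exact tsum_of_norm_bounded hb.hasSum hle

/-- Sampling a `C²` function supported in `[-R, R]` at the grid points integrates it against the
character of frequency `ξ` up to `O(n⁻²)`, uniformly for `|ξ|` below the Nyquist frequency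
`n / (4 R)`. By Poisson summation the error consists of the values of the Fourier transform at
the aliases of `ξ`. -/
lemma norm_grid_sum_sub_fourier_le {φ φ' φ'' : ℝ → ℂ} {R M : ℝ} (hR : 0 < R)
    (hd : ∀ x, HasDerivAt φ (φ' x) x) (hd' : ∀ x, HasDerivAt φ' (φ'' x) x)
    (hc : Continuous φ'') (hs : Function.support φ ⊆ Icc (-R) R) (hM : ∀ x, ‖φ'' x‖ ≤ M)
    {n : ℕ} (hn : 0 < n) {ξ : ℝ} (hξ : |ξ| ≤ n / (4 * R)) :
    ‖((2 * R / n : ℝ) : ℂ) * ∑ j : Fin n, 𝐞 (-(grid R n j * ξ)) • φ (grid R n j) - 𝓕 φ ξ‖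
      ≤ 8 * R ^ 3 * zetaSum * M / n ^ 2 := by
  set h : ℝ := 2 * R / n with hh
  have hn' : (0 : ℝ) < n := by exact_mod_cast hn
  have hpos : 0 < h := by positivity
  have hφc : Continuous φ := continuous_iff_continuousAt.2 fun x => (hd x).continuousAt
  set ψ : ℝ → ℂ := fun t => 𝐞 (-(t * ξ)) • φ t with hψ
  have hψs : Function.support ψ ⊆ Icc (-R) R := fun x hx => hs fun h0 => hx (by simp [hψ, h0])
  have hψc : Continuous ψ := by
    exact continuous_fourierChar_smul (by fun_prop) hφc
  have hF : ∀ η, 𝓕 ψ η = 𝓕 φ (ξ + η) := by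
    intro η
    rw [fourier_real_eq, fourier_real_eq]
    congr 1
    ext v
    rw [hψ, smul_smul, ← AddChar.map_add_eq_mul]
    congr 2
    ring
  have hbound : ∀ k : ℤ, k ≠ 0 → ‖𝓕 ψ (k / h)‖ ≤ (2 * R * M * h ^ 2) * (1 / (k : ℝ) ^ 2) := by
    intro k hk
    have hk' : (0 : ℝ) < |(k : ℝ)| := abs_pos.2 (by exact_mod_cast hk)
    have hk1 : (1 : ℝ) ≤ |(k : ℝ)| := by
      exact_mod_cast Int.one_le_abs hk
    have hfr : |(k : ℝ)| / (2 * h) ≤ |ξ + k / h| := by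
      have h1 : |ξ| ≤ 1 / (2 * h) := by
        refine hξ.trans_eq ?_
        rw [hh]; field_simp; ring
      have h2 : |(k : ℝ) / h| ≤ |ξ + k / h| + |ξ| := by
        have := abs_sub (ξ + k / h) ξ
        rwa [add_sub_cancel_left] at this
      rw [abs_div, abs_of_pos hpos] at h2
      have h3 : 1 / (2 * h) ≤ |(k : ℝ)| / (2 * h) := by gcongr
      have h4 : |(k : ℝ)| / h = |(k : ℝ)| / (2 * h) + |(k : ℝ)| / (2 * h) := by
        field_simp; ring
      linarith
    have hdec := norm_fourier_le_of_hasDerivAt_two hR hd hd' hc hs hM (ξ + k / h)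
    have h5 : |(k : ℝ)| / h ≤ 2 * π * |ξ + k / h| := by
      have : |(k : ℝ)| / h = 2 * (|(k : ℝ)| / (2 * h)) := by field_simp
      rw [this, mul_assoc]
      gcongr
      nlinarith [pi_gt_three, abs_nonneg (ξ + k / h)]
    rw [hF, ← sq_abs (k : ℝ), mul_one_div, le_div_iff₀ (by positivity)]
    have h6 : (|(k : ℝ)| / h) ^ 2 * ‖𝓕 φ (ξ + k / h)‖ ≤ 2 * R * M :=
      le_trans (by gcongr) hdec
    rw [div_pow, div_mul_eq_mul_div, div_le_iff₀ (by positivity)] at h6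
    linarith
  have hM0 : 0 ≤ M := (norm_nonneg _).trans (hM 0)
  obtain ⟨hsum, -⟩ := norm_tsum_sub_sum_le (by positivity) {0}
    (fun k hk => hbound k (by simpa using hk))
  have hP := tsum_eq_tsum_fourier_step hpos hψc hψs hsum (-R)
  have hbound' : ∀ k : ℤ, k ≠ 0 →
      ‖𝓕 ψ (k / h) * Complex.exp (2 * π * Complex.I * k * (-R : ℝ) / h)‖
        ≤ (2 * R * M * h ^ 2) * (1 / (k : ℝ) ^ 2) := by
    intro k hk
    have : (2 * π * Complex.I * k * (-R : ℝ) / h : ℂ)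
        = ((2 * π * k * (-R) / h : ℝ) : ℂ) * Complex.I := by push_cast; ring
    rw [norm_mul, this, Complex.norm_exp_ofReal_mul_I, mul_one]
    exact hbound k hk
  obtain ⟨-, hle⟩ := norm_tsum_sub_sum_le (by positivity) {0}
    (fun k hk => hbound' k (by simpa using hk))
  have hL : ∑' m : ℤ, ψ (-R + h * m) = ∑ j : Fin n, ψ (grid R n j) := by
    rw [tsum_eq_sum (s := (Finset.range n).image (fun j : ℕ => (j : ℤ)))]
    · rw [Finset.sum_image (fun a _ b _ hab => by simpa using hab), Finset.sum_range]
      refine Finset.sum_congr rfl fun j _ => ?_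
      congr 1
      rw [grid, hh]; push_cast; ring
    · intro m hm
      refine eq_zero_of_notMem_Ioo hψc hψs fun hm' => hm ?_
      rw [mem_Ioo] at hm'
      have h1 : (0 : ℝ) < m := by
        by_contra hcon
        push Not at hcon
        nlinarith [hm'.1]
      have h2 : (m : ℝ) < n := by
        by_contra hcon
        push Not at hcon
        have : h * n = 2 * R := by rw [hh]; field_simp
        nlinarith [hm'.2]
      have h1' : 0 < m := by exact_mod_cast h1
      have h2' : m < (n : ℤ) := by exact_mod_cast h2
      rw [Finset.mem_image]
      exact ⟨m.toNat, by rw [Finset.mem_range]; omega, by omega⟩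
  rw [hL] at hP
  have hne : (h : ℂ) ≠ 0 := by exact_mod_cast hpos.ne'
  rw [hP, ← mul_assoc, mul_one_div_cancel hne, one_mul]
  simp only [Finset.sum_singleton, Int.cast_zero, zero_div, mul_zero, zero_mul, Complex.exp_zero,
    mul_one, hF, add_zero] at hle ⊢
  refine hle.trans_eq ?_
  rw [hh]; field_simp; ring

/-! ### Sampling smooth functions on the disc -/

/-- The smooth functions on the plane that are supported on the disc of radius `R`. -/
structure IsBump (R : ℝ) (d : Plane → ℝ) : Prop where
  contDiff : ContDiff ℝ ((⊤ : ℕ∞) : WithTop ℕ∞) d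
  support : Function.support d ⊆ Metric.closedBall 0 R

namespace IsBump

variable {R : ℝ} {d : Plane → ℝ}

lemma continuous (h : IsBump R d) : Continuous d := h.contDiff.continuous

lemma hasCompactSupport (h : IsBump R d) : HasCompactSupport d :=
  HasCompactSupport.of_support_subset_isCompact (isCompact_closedBall 0 R) h.support

lemma eq_zero (h : IsBump R d) {p : Plane} (hp : R < ‖p‖) : d p = 0 := by
  by_contra h0
  have := h.support h0
  rw [mem_closedBall_zero_iff] at this
  linarith

lemma exists_bound (h : IsBump R d) : ∃ B, 0 ≤ B ∧ ∀ p, |d p| ≤ B := by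
  obtain ⟨B, hB⟩ := h.hasCompactSupport.exists_bound_of_continuous h.continuous
  exact ⟨B, (norm_nonneg _).trans (hB 0), hB⟩

lemma sub {d' : Plane → ℝ} (h : IsBump R d) (h' : IsBump R d') :
    IsBump R (fun p => d p - d' p) where
  contDiff := h.contDiff.sub h'.contDiff
  support p hp := by
    by_contra hc
    have h1 : d p = 0 := by by_contra h0; exact hc (h.support h0)
    have h2 : d' p = 0 := by by_contra h0; exact hc (h'.support h0)
    exact hp (by simp [h1, h2])

/-- Directional derivatives of bumps are bumps. -/
lemma fderiv_apply (h : IsBump R d) (v : Plane) : IsBump R (fun p => fderiv ℝ d p v) where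
  contDiff := (h.contDiff.fderiv_right (m := ((⊤ : ℕ∞) : WithTop ℕ∞)) (by simp)).clm_apply
    contDiff_const
  support p hp := by
    by_contra hc
    refine hp ?_
    have : fderiv ℝ d p = 0 := by
      have : p ∉ tsupport d := fun ht =>
        hc (closure_minimal h.support Metric.isClosed_closedBall ht)
      by_contra h0
      exact this (support_fderiv_subset ℝ h0)
    simp [this]

lemma hasDerivAt_line (h : IsBump R d) (q v : Plane) (t : ℝ) :
    HasDerivAt (fun s : ℝ => d (q + s • v)) (fderiv ℝ d (q + t • v) v) t := by
  have h1 : HasFDerivAt d (fderiv ℝ d (q + t • v)) (q + t • v) :=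
    (h.contDiff.differentiable (by simp)).differentiableAt.hasFDerivAt
  have h2 : HasDerivAt (fun s : ℝ => q + s • v) v t := by
    simpa using ((hasDerivAt_id t).smul_const v).const_add q
  exact h1.comp_hasDerivAt t h2

end IsBump

lemma abs_coord_le_norm (x y : ℝ) : |x| ≤ ‖(!₂[x, y] : Plane)‖ ∧ |y| ≤ ‖(!₂[x, y] : Plane)‖ :=
  ⟨by simpa using PiLp.norm_apply_le (!₂[x, y] : Plane) 0,
    by simpa using PiLp.norm_apply_le (!₂[x, y] : Plane) 1⟩

lemma continuous_pair : Continuous fun q : ℝ × ℝ => (!₂[q.1, q.2] : Plane) := by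
  fun_prop

/-- The sampling error of a bump along a line is controlled by its second derivative. -/
lemma IsBump.norm_line_sum_sub_fourier_le {R M : ℝ} {d : Plane → ℝ} (hR : 0 < R)
    (h : IsBump R d) (q v : Plane) (hq : ∀ t : ℝ, |t| ≤ ‖q + t • v‖)
    (hM : ∀ p, |fderiv ℝ (fun p => fderiv ℝ d p v) p v| ≤ M)
    {n : ℕ} (hn : 0 < n) {ξ : ℝ} (hξ : |ξ| ≤ n / (4 * R)) :
    ‖((2 * R / n : ℝ) : ℂ) * ∑ j : Fin n,
      𝐞 (-(grid R n j * ξ)) • ((d (q + grid R n j • v) : ℝ) : ℂ)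
      - ∫ t : ℝ, 𝐞 (-(t * ξ)) • ((d (q + t • v) : ℝ) : ℂ)‖
      ≤ 8 * R ^ 3 * zetaSum * M / n ^ 2 := by
  have h1 := h.fderiv_apply v
  have h2 := h1.fderiv_apply v
  have hs : Function.support (fun t : ℝ => ((d (q + t • v) : ℝ) : ℂ)) ⊆ Icc (-R) R := by
    intro t ht
    by_contra hc
    refine ht ?_
    have : R < |t| := by
      rw [← not_le, abs_le]; exact hc
    simp [h.eq_zero (this.trans_le (hq t))]
  have := norm_grid_sum_sub_fourier_le (φ := fun t => ((d (q + t • v) : ℝ) : ℂ))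
    (φ' := fun t => ((fderiv ℝ d (q + t • v) v : ℝ) : ℂ))
    (φ'' := fun t => ((fderiv ℝ (fun p => fderiv ℝ d p v) (q + t • v) v : ℝ) : ℂ)) hR
    (fun t => (h.hasDerivAt_line q v t).ofReal_comp)
    (fun t => (h1.hasDerivAt_line q v t).ofReal_comp)
    (Complex.continuous_ofReal.comp (h2.continuous.comp (by fun_prop))) hs
    (fun t => by rw [Complex.norm_real]; exact hM _) hn hξ
  rwa [fourier_real_eq] at this

/-- Sampling a bump on the square grid computes its Fourier transform up to `O(n⁻²)`, uniformly
for frequencies below the Nyquist frequency. The sampling error is split into one along each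
coordinate, so that no derivative of a partial integral is needed. -/
lemma IsBump.exists_norm_grid_sum_sub_le {R : ℝ} {d : Plane → ℝ} (hR : 0 < R) (h : IsBump R d) :
    ∃ C, 0 ≤ C ∧ ∀ n : ℕ, 0 < n → ∀ ξ η : ℝ, |ξ| ≤ n / (4 * R) → |η| ≤ n / (4 * R) →
      ‖((2 * R / n : ℝ) : ℂ) ^ 2 * ∑ i : Fin n, ∑ j : Fin n,
          𝐞 (-(grid R n i * ξ + grid R n j * η)) • ((d !₂[grid R n i, grid R n j] : ℝ) : ℂ)
        - ∫ x : ℝ, ∫ y : ℝ, 𝐞 (-(x * ξ + y * η)) • ((d !₂[x, y] : ℝ) : ℂ)‖ ≤ C / n ^ 2 := by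
  set e₁ : Plane := !₂[1, 0]
  set e₂ : Plane := !₂[0, 1]
  obtain ⟨M₁, hM₁0, hM₁⟩ := ((h.fderiv_apply e₁).fderiv_apply e₁).exists_bound
  obtain ⟨M₂, hM₂0, hM₂⟩ := ((h.fderiv_apply e₂).fderiv_apply e₂).exists_bound
  have hv₁ : ∀ x y : ℝ, (!₂[0, y] : Plane) + x • e₁ = !₂[x, y] := by
    intro x y; ext i; fin_cases i <;> simp [e₁]
  have hv₂ : ∀ x y : ℝ, (!₂[x, 0] : Plane) + y • e₂ = !₂[x, y] := by
    intro x y; ext i; fin_cases i <;> simp [e₂]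
  set K := 8 * R ^ 3 * zetaSum
  have hK : 0 ≤ K := by have := zetaSum_nonneg; positivity
  refine ⟨2 * R * (K * M₁) + 2 * R * (K * M₂), by positivity, fun n hn ξ η hξ hη => ?_⟩
  have hn' : (0 : ℝ) < n := by exact_mod_cast hn
  have hsplit : ∀ x y : ℝ, 𝐞 (-(x * ξ + y * η)) • ((d !₂[x, y] : ℝ) : ℂ)
      = 𝐞 (-(y * η)) • 𝐞 (-(x * ξ)) • ((d !₂[x, y] : ℝ) : ℂ) := by
    intro x y
    rw [smul_smul, ← AddChar.map_add_eq_mul]; congr 2; ring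
  have hsplit' : ∀ x y : ℝ, 𝐞 (-(x * ξ + y * η)) • ((d !₂[x, y] : ℝ) : ℂ)
      = 𝐞 (-(x * ξ)) • 𝐞 (-(y * η)) • ((d !₂[x, y] : ℝ) : ℂ) := by
    intro x y
    rw [smul_smul, ← AddChar.map_add_eq_mul]; congr 2; ring
  -- the error of the sum over `x`, for each row
  have hX : ∀ y : ℝ, ‖((2 * R / n : ℝ) : ℂ) * ∑ i : Fin n,
      𝐞 (-(grid R n i * ξ)) • ((d !₂[grid R n i, y] : ℝ) : ℂ)
      - ∫ x : ℝ, 𝐞 (-(x * ξ)) • ((d !₂[x, y] : ℝ) : ℂ)‖ ≤ K * M₁ / n ^ 2 := by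
    intro y
    have := h.norm_line_sum_sub_fourier_le hR !₂[0, y] e₁
      (fun t => by rw [hv₁]; exact (abs_coord_le_norm t y).1) hM₁ hn hξ
    simpa only [hv₁] using this
  have hY : ∀ x : ℝ, ‖((2 * R / n : ℝ) : ℂ) * ∑ j : Fin n,
      𝐞 (-(grid R n j * η)) • ((d !₂[x, grid R n j] : ℝ) : ℂ)
      - ∫ y : ℝ, 𝐞 (-(y * η)) • ((d !₂[x, y] : ℝ) : ℂ)‖ ≤ K * M₂ / n ^ 2 := by
    intro x
    have := h.norm_line_sum_sub_fourier_le hR !₂[x, 0] e₂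
      (fun t => by rw [hv₂]; exact (abs_coord_le_norm x t).2) hM₂ hn hη
    simpa only [hv₂] using this
  have hcont : Continuous fun q : ℝ × ℝ =>
      𝐞 (-(q.1 * ξ + q.2 * η)) • ((d !₂[q.1, q.2] : ℝ) : ℂ) := by
    exact continuous_fourierChar_smul (by fun_prop)
      (Complex.continuous_ofReal.comp (h.continuous.comp continuous_pair))
  have hd0 : ∀ x y : ℝ, x ∉ Icc (-R) R ∨ y ∉ Icc (-R) R → d !₂[x, y] = 0 := by
    intro x y hxy
    refine h.eq_zero ?_
    rcases hxy with hx | hx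
    · have : R < |x| := by rw [← not_le, abs_le]; exact hx
      exact this.trans_le (abs_coord_le_norm x y).1
    · have : R < |y| := by rw [← not_le, abs_le]; exact hx
      exact this.trans_le (abs_coord_le_norm x y).2
  have hint : Integrable (fun q : ℝ × ℝ =>
      𝐞 (-(q.1 * ξ + q.2 * η)) • ((d !₂[q.1, q.2] : ℝ) : ℂ)) (volume.prod volume) := by
    refine hcont.integrable_of_hasCompactSupport ?_
    refine HasCompactSupport.of_support_subset_isCompact
      ((isCompact_Icc (a := -R) (b := R)).prod (isCompact_Icc (a := -R) (b := R))) ?_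
    intro q hq
    by_contra hc
    refine hq ?_
    rw [mem_prod, not_and_or] at hc
    simp [hd0 _ _ hc]
  have hIx : Integrable fun x : ℝ => ∫ y : ℝ, 𝐞 (-(x * ξ + y * η)) • ((d !₂[x, y] : ℝ) : ℂ) :=
    hint.integral_prod_left
  have hrow : ∀ y : ℝ, Integrable fun x : ℝ => 𝐞 (-(x * ξ + y * η)) • ((d !₂[x, y] : ℝ) : ℂ) := by
    intro y
    refine Continuous.integrable_of_hasCompactSupport
      (hcont.comp (by fun_prop : Continuous fun x : ℝ => (x, y))) ?_
    refine hasCompactSupport_of_Icc (R := R) fun x hx => ?_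
    by_contra hc
    exact hx (by simp [hd0 x y (Or.inl hc)])
  set H : ℂ := ((2 * R / n : ℝ) : ℂ) with hH
  have hHn : ‖H‖ = 2 * R / n := by
    rw [hH, Complex.norm_real, Real.norm_of_nonneg (by positivity)]
  -- the two halves of the error
  have hA : ‖H ^ 2 * ∑ i : Fin n, ∑ j : Fin n,
        𝐞 (-(grid R n i * ξ + grid R n j * η)) • ((d !₂[grid R n i, grid R n j] : ℝ) : ℂ)
      - H * ∑ j : Fin n, ∫ x : ℝ,
        𝐞 (-(x * ξ + grid R n j * η)) • ((d !₂[x, grid R n j] : ℝ) : ℂ)‖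
      ≤ 2 * R * (K * M₁) / n ^ 2 := by
    have e : H ^ 2 * ∑ i : Fin n, ∑ j : Fin n,
        𝐞 (-(grid R n i * ξ + grid R n j * η)) • ((d !₂[grid R n i, grid R n j] : ℝ) : ℂ)
      - H * ∑ j : Fin n, ∫ x : ℝ,
        𝐞 (-(x * ξ + grid R n j * η)) • ((d !₂[x, grid R n j] : ℝ) : ℂ)
      = H * ∑ j : Fin n, 𝐞 (-(grid R n j * η)) • (H * ∑ i : Fin n,
      𝐞 (-(grid R n i * ξ)) • ((d !₂[grid R n i, grid R n j] : ℝ) : ℂ)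
      - ∫ x : ℝ, 𝐞 (-(x * ξ)) • ((d !₂[x, grid R n j] : ℝ) : ℂ)) := by
      rw [Finset.sum_comm, pow_two, mul_assoc, ← mul_sub, Finset.mul_sum,
        ← Finset.sum_sub_distrib]
      congr 1
      refine Finset.sum_congr rfl fun j _ => ?_
      simp_rw [hsplit]
      rw [smul_sub, ← Finset.smul_sum]
      congr 1
      · rw [mul_smul_comm]
      · simp only [Circle.smul_def, integral_smul]
    rw [e, norm_mul, hHn]
    have : ‖∑ j : Fin n, 𝐞 (-(grid R n j * η)) • (H * ∑ i : Fin n,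
      𝐞 (-(grid R n i * ξ)) • ((d !₂[grid R n i, grid R n j] : ℝ) : ℂ)
      - ∫ x : ℝ, 𝐞 (-(x * ξ)) • ((d !₂[x, grid R n j] : ℝ) : ℂ))‖ ≤ ∑ _j : Fin n,
        K * M₁ / n ^ 2 := by
      refine norm_sum_le_of_le _ fun j _ => ?_
      rw [Circle.norm_smul]
      exact hX _
    rw [Finset.sum_const, Finset.card_univ, Fintype.card_fin, nsmul_eq_mul] at this
    calc _ ≤ 2 * R / n * (n * (K * M₁ / n ^ 2)) := by gcongr
      _ = _ := by field_simp
  have hB : ‖(H * ∑ j : Fin n, ∫ x : ℝ,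
        𝐞 (-(x * ξ + grid R n j * η)) • ((d !₂[x, grid R n j] : ℝ) : ℂ))
      - ∫ x : ℝ, ∫ y : ℝ, 𝐞 (-(x * ξ + y * η)) • ((d !₂[x, y] : ℝ) : ℂ)‖
      ≤ 2 * R * (K * M₂) / n ^ 2 := by
    rw [← integral_finsetSum _ (fun j _ => hrow _), ← integral_const_mul, ← integral_sub
      ((integrable_finsetSum _ (fun j _ => hrow _)).const_mul _) hIx, mul_div_assoc]
    refine norm_integral_le_of_support hR ?_ fun x => ?_
    · intro x hx
      by_contra hc
      exact hx (by simp [fun y => hd0 x y (Or.inl hc)])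
    · have e : H * ∑ j : Fin n, 𝐞 (-(x * ξ + grid R n j * η)) • ((d !₂[x, grid R n j] : ℝ) : ℂ)
          - ∫ y : ℝ, 𝐞 (-(x * ξ + y * η)) • ((d !₂[x, y] : ℝ) : ℂ)
          = 𝐞 (-(x * ξ)) • (H * ∑ j : Fin n,
            𝐞 (-(grid R n j * η)) • ((d !₂[x, grid R n j] : ℝ) : ℂ)
            - ∫ y : ℝ, 𝐞 (-(y * η)) • ((d !₂[x, y] : ℝ) : ℂ)) := by
        simp_rw [hsplit']
        rw [smul_sub, ← Finset.smul_sum, mul_smul_comm]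
        simp only [Circle.smul_def, integral_smul]
      rw [e, Circle.norm_smul]
      exact hY x
  have := (norm_sub_le_norm_sub_add_norm_sub _ _ _).trans (add_le_add hA hB)
  refine this.trans_eq ?_
  ring

/-! ### Projections of bumps -/

/-- The unit vector `u` rotated by a right angle. -/
def perp (u : Plane) : Plane := !₂[-u 1, u 0]

lemma norm_sq_eq_one {u : Plane} (hu : ‖u‖ = 1) : u 0 ^ 2 + u 1 ^ 2 = 1 := by
  have := EuclideanSpace.norm_sq_eq u
  rw [hu, Fin.sum_univ_two] at this
  simpa using this.symm

lemma norm_sq_smul_add_smul_perp {u : Plane} (hu : ‖u‖ = 1) (t s : ℝ) :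
    ‖t • u + s • perp u‖ ^ 2 = t ^ 2 + s ^ 2 := by
  have h := norm_sq_eq_one hu
  rw [EuclideanSpace.norm_sq_eq, Fin.sum_univ_two]
  simp only [perp, PiLp.add_apply, PiLp.smul_apply, smul_eq_mul, Real.norm_eq_abs, sq_abs,
    Matrix.cons_val_zero, Matrix.cons_val_one]
  linear_combination (t ^ 2 + s ^ 2) * h

lemma abs_le_norm_smul_add_smul_perp {u : Plane} (hu : ‖u‖ = 1) (t s : ℝ) :
    |t| ≤ ‖t • u + s • perp u‖ ∧ |s| ≤ ‖t • u + s • perp u‖ := by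
  have h := norm_sq_smul_add_smul_perp hu t s
  constructor <;> refine abs_le_of_sq_le_sq (by nlinarith) (norm_nonneg _)

lemma norm_perp {u : Plane} (hu : ‖u‖ = 1) : ‖perp u‖ = 1 := by
  have h := norm_sq_smul_add_smul_perp hu 0 1
  simp only [zero_smul, one_smul, zero_add] at h
  nlinarith [norm_nonneg (perp u)]

lemma norm_perp_sub (u v : Plane) : ‖perp u - perp v‖ = ‖u - v‖ := by
  rw [← sq_eq_sq₀ (norm_nonneg _) (norm_nonneg _), EuclideanSpace.norm_sq_eq,
    EuclideanSpace.norm_sq_eq, Fin.sum_univ_two, Fin.sum_univ_two]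
  simp only [perp, PiLp.sub_apply, Real.norm_eq_abs, sq_abs,
    Matrix.cons_val_zero, Matrix.cons_val_one]
  ring

/-- Lebesgue measure on the plane in the coordinates `(t, s) ↦ t u + s u^⊥`. -/
lemma exists_measurePreserving_rotation {u : Plane} (hu : ‖u‖ = 1) :
    ∃ e : ℝ × ℝ ≃ᵐ Plane, MeasurePreserving e (volume.prod volume) volume ∧
      ∀ q, e q = q.1 • u + q.2 • perp u := by
  have hon : Orthonormal ℝ ((univ : Set (Fin 2)).domRestrict ![u, perp u]) := by
    rw [orthonormal_iff_ite]
    rintro ⟨i, -⟩ ⟨j, -⟩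
    fin_cases i <;> fin_cases j <;>
      simp [EuclideanSpace.inner_eq_star_dotProduct, perp, dotProduct, Fin.sum_univ_two] <;>
      first | exact Or.inl hu | exact Or.inl (norm_perp hu) | ring
  obtain ⟨b, hb⟩ := hon.exists_orthonormalBasis_extension_of_card_eq (by simp)
  refine ⟨(MeasurableEquiv.finTwoArrow.symm.trans (MeasurableEquiv.toLp 2 (Fin 2 → ℝ))).trans
    b.measurableEquiv.symm, ?_, ?_⟩
  · refine MeasurePreserving.trans (MeasurePreserving.trans
      (volume_preserving_finTwoArrow ℝ).symm ?_) b.measurePreserving_measurableEquiv.symm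
    exact (EuclideanSpace.volume_preserving_symm_measurableEquiv_toLp (Fin 2)).symm
  · intro q
    change b.repr.symm (!₂[q.1, q.2]) = _
    rw [← OrthonormalBasis.sum_repr_symm, Fin.sum_univ_two, hb 0 (mem_univ _), hb 1 (mem_univ _)]
    simp

lemma integral_plane_eq {E : Type*} [NormedAddCommGroup E] [NormedSpace ℝ E]
    {u : Plane} (hu : ‖u‖ = 1) {G : Plane → E} (hG : Integrable G) :
    Integrable (fun t : ℝ => ∫ s : ℝ, G (t • u + s • perp u)) ∧
    ∫ p, G p = ∫ t : ℝ, ∫ s : ℝ, G (t • u + s • perp u) := by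
  obtain ⟨e, he, heq⟩ := exists_measurePreserving_rotation hu
  have hint : Integrable (fun q => G (e q)) (volume.prod volume) :=
    (he.integrable_comp_emb e.measurableEmbedding).2 hG
  rw [← he.integral_comp e.measurableEmbedding, integral_prod _ hint]
  simp only [heq] at hint ⊢
  exact ⟨hint.integral_prod_left, trivial⟩

/-- The integral over the plane in Cartesian coordinates. -/
lemma integral_plane_eq_cartesian {E : Type*} [NormedAddCommGroup E] [NormedSpace ℝ E]
    {G : Plane → E} (hG : Integrable G) :
    ∫ p, G p = ∫ x : ℝ, ∫ y : ℝ, G !₂[x, y] := by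
  have hu : ‖(!₂[1, 0] : Plane)‖ = 1 := by simp [EuclideanSpace.norm_eq]
  rw [(integral_plane_eq hu hG).2]
  congr 1; ext x; congr 1; ext y; congr 1
  ext i
  fin_cases i <;> simp [perp]

lemma proj_eq (u : Plane) (d : Plane → ℝ) (t : ℝ) :
    proj u d t = ∫ s : ℝ, d (t • u + s • perp u) := rfl

namespace IsBump

variable {R : ℝ} {d : Plane → ℝ} {u : Plane}

lemma integrable (h : IsBump R d) : Integrable d :=
  h.continuous.integrable_of_hasCompactSupport h.hasCompactSupport

lemma eq_zero_of_notMem (h : IsBump R d) (hu : ‖u‖ = 1) {t s : ℝ}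
    (hts : t ∉ Icc (-R) R ∨ s ∉ Icc (-R) R) : d (t • u + s • perp u) = 0 := by
  refine h.eq_zero ?_
  obtain ⟨h1, h2⟩ := abs_le_norm_smul_add_smul_perp hu t s
  rcases hts with hx | hx
  · exact lt_of_lt_of_le (by rw [← not_le, abs_le]; exact hx) h1
  · exact lt_of_lt_of_le (by rw [← not_le, abs_le]; exact hx) h2

lemma continuous_line (h : IsBump R d) (t : ℝ) : Continuous fun s : ℝ => d (t • u + s • perp u) :=
  h.continuous.comp (by fun_prop)

lemma support_line (h : IsBump R d) (hu : ‖u‖ = 1) (t : ℝ) :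
    Function.support (fun s : ℝ => d (t • u + s • perp u)) ⊆ Icc (-R) R := fun s hs => by
  by_contra hc
  exact hs (h.eq_zero_of_notMem hu (Or.inr hc))

lemma integrable_line (h : IsBump R d) (hu : ‖u‖ = 1) (t : ℝ) :
    Integrable fun s : ℝ => d (t • u + s • perp u) :=
  (h.continuous_line t).integrable_of_hasCompactSupport
    (hasCompactSupport_of_Icc (h.support_line hu t))

lemma support_proj (h : IsBump R d) (hu : ‖u‖ = 1) :
    Function.support (proj u d) ⊆ Icc (-R) R := fun t ht => by
  by_contra hc
  exact ht (by simp [proj_eq, fun s => h.eq_zero_of_notMem hu (s := s) (Or.inl hc)])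

lemma abs_proj_le (hR : 0 < R) (h : IsBump R d) (hu : ‖u‖ = 1) {B : ℝ} (hB : ∀ p, |d p| ≤ B)
    (t : ℝ) : |proj u d t| ≤ 2 * R * B :=
  norm_integral_le_of_support hR (h.support_line hu t) fun _ => hB _

/-- The derivative of a projection is the projection of the directional derivative. -/
lemma hasDerivAt_proj (h : IsBump R d) (hu : ‖u‖ = 1) (t : ℝ) :
    HasDerivAt (proj u d) (proj u (fun p => fderiv ℝ d p u) t) t := by
  have h' := h.fderiv_apply u
  obtain ⟨B, -, hB⟩ := h'.exists_bound
  refine (hasDerivAt_integral_of_dominated_loc_of_deriv_le (s := univ)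
    (F := fun t s => d (t • u + s • perp u))
    (F' := fun t s => fderiv ℝ d (t • u + s • perp u) u)
    (bound := (Icc (-R) R).indicator fun _ => B) univ_mem
    (Eventually.of_forall fun x => (h.continuous_line x).aestronglyMeasurable)
    (h.integrable_line hu t) (h'.continuous_line t).aestronglyMeasurable
    (Eventually.of_forall fun s x _ => ?_) ?_ (Eventually.of_forall fun s x _ => ?_)).2
  · by_cases hs : s ∈ Icc (-R) R
    · rw [indicator_of_mem hs]; exact hB _
    · have := h'.eq_zero_of_notMem hu (t := x) (Or.inr hs)
      rw [indicator_of_notMem hs, this, norm_zero]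
  · exact (integrable_indicator_iff measurableSet_Icc).2 (integrable_const B)
  · have := h.hasDerivAt_line (s • perp u) u x
    simpa only [add_comm] using this

lemma continuous_proj (h : IsBump R d) (hu : ‖u‖ = 1) : Continuous (proj u d) :=
  continuous_iff_continuousAt.2 fun t => (h.hasDerivAt_proj hu t).continuousAt

lemma integral_proj (h : IsBump R d) (hu : ‖u‖ = 1) : ∫ t, proj u d t = ∫ p, d p :=
  (integral_plane_eq hu h.integrable).2.symm

lemma integrable_proj (h : IsBump R d) (hu : ‖u‖ = 1) : Integrable (proj u d) :=
  (integral_plane_eq hu h.integrable).1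

/-- The Fourier slice theorem. -/
lemma fourier_proj (h : IsBump R d) (hu : ‖u‖ = 1) (ξ : ℝ) :
    𝓕 (fun t => ((proj u d t : ℝ) : ℂ)) ξ
      = ∫ x : ℝ, ∫ y : ℝ, 𝐞 (-(x * (ξ * u 0) + y * (ξ * u 1))) • ((d !₂[x, y] : ℝ) : ℂ) := by
  have hG : Integrable fun p : Plane => 𝐞 (-(p 0 * (ξ * u 0) + p 1 * (ξ * u 1))) •
      ((d p : ℝ) : ℂ) := by
    refine Continuous.integrable_of_hasCompactSupport (continuous_fourierChar_smul (by fun_prop)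
      (Complex.continuous_ofReal.comp h.continuous)) ?_
    refine HasCompactSupport.of_support_subset_isCompact (isCompact_closedBall 0 R)
      fun p hp => h.support fun h0 => hp (by simp [h0])
  have h1 := integral_plane_eq_cartesian hG
  simp only [Matrix.cons_val_zero, Matrix.cons_val_one] at h1
  rw [← h1, (integral_plane_eq hu hG).2, fourier_real_eq]
  congr 1; ext t
  rw [proj_eq, ← integral_complex_ofReal, Circle.smul_def, ← integral_smul]
  congr 1; ext s
  rw [Circle.smul_def]
  congr 4
  have := norm_sq_eq_one hu
  simp only [perp, PiLp.add_apply, PiLp.smul_apply, smul_eq_mul, Matrix.cons_val_zero,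
    Matrix.cons_val_one]
  linear_combination -t * ξ * this

end IsBump

/-! ### Cumulative projections -/

/-- The Volterra transform of the projection of `d` along `u`. -/
def cumProj (R : ℝ) (d : Plane → ℝ) (u : Plane) (t : ℝ) : ℝ := volterra (-R) (proj u d) t

namespace IsBump

variable {R : ℝ} {d : Plane → ℝ} {u : Plane}

lemma hasDerivAt_cumProj (h : IsBump R d) (hu : ‖u‖ = 1) (t : ℝ) :
    HasDerivAt (cumProj R d u) (proj u d t) t :=
  (h.continuous_proj hu).integral_hasStrictDerivAt (-R) t |>.hasDerivAt

lemma continuous_cumProj (h : IsBump R d) (hu : ‖u‖ = 1) : Continuous (cumProj R d u) :=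
  continuous_iff_continuousAt.2 fun t => (h.hasDerivAt_cumProj hu t).continuousAt

/-- A bump of total mass zero has compactly supported cumulative projections. -/
lemma support_cumProj (h : IsBump R d) (h0 : ∫ p, d p = 0) (hu : ‖u‖ = 1) :
    Function.support (cumProj R d u) ⊆ Icc (-R) R := by
  intro t ht
  by_contra hc
  refine ht ?_
  have hz : ∀ x, x ∉ Ioo (-R) R → proj u d x = 0 := fun x hx =>
    eq_zero_of_notMem_Ioo (h.continuous_proj hu) (h.support_proj hu) hx
  rw [mem_Icc, not_and_or, not_le, not_le] at hc
  rw [cumProj, volterra]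
  rcases le_or_gt t (-R) with h1 | h1
  · rw [intervalIntegral.integral_symm, intervalIntegral.integral_of_le h1,
      setIntegral_eq_zero_of_forall_eq_zero, neg_zero]
    intro x hx
    exact hz x fun hx' => by linarith [hx.2, hx'.1]
  · have h2 : R < t := hc.resolve_left (by linarith)
    rw [intervalIntegral.integral_of_le h1.le, setIntegral_eq_integral_of_forall_compl_eq_zero,
      h.integral_proj hu, h0]
    intro x hx
    exact hz x fun hx' => hx ⟨hx'.1, by linarith [hx'.2]⟩

lemma cumProj_eq_zero (h : IsBump R d) (h0 : ∫ p, d p = 0) (hu : ‖u‖ = 1) {t : ℝ}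
    (ht : t ∉ Ioo (-R) R) : cumProj R d u t = 0 :=
  eq_zero_of_notMem_Ioo (h.continuous_cumProj hu) (h.support_cumProj h0 hu) ht

lemma fourier_proj_eq (h : IsBump R d) (h0 : ∫ p, d p = 0) (hu : ‖u‖ = 1) (ξ : ℝ) :
    𝓕 (fun t => ((proj u d t : ℝ) : ℂ)) ξ
      = (2 * π * Complex.I * ξ) * 𝓕 (fun t => ((cumProj R d u t : ℝ) : ℂ)) ξ := by
  have hd : ∀ t, HasDerivAt (fun t => ((cumProj R d u t : ℝ) : ℂ)) ((proj u d t : ℝ) : ℂ) t :=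
    fun t => (h.hasDerivAt_cumProj hu t).ofReal_comp
  have he : deriv (fun t => ((cumProj R d u t : ℝ) : ℂ)) = fun t => ((proj u d t : ℝ) : ℂ) :=
    funext fun t => (hd t).deriv
  have hs : Function.support (fun t => ((cumProj R d u t : ℝ) : ℂ)) ⊆ Icc (-R) R := fun t ht =>
    h.support_cumProj h0 hu fun hz => ht (by simp [hz])
  have hdiff : Differentiable ℝ (fun t => ((cumProj R d u t : ℝ) : ℂ)) :=
    fun t => (hd t).differentiableAt
  have key := fourier_deriv
    (hdiff.continuous.integrable_of_hasCompactSupport (hasCompactSupport_of_Icc hs)) hdiff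
    (by rw [he]; exact (h.integrable_proj hu).ofReal)
  rw [he] at key
  simp only [key, smul_eq_mul]

/-- The Fourier transforms of the cumulative projections decay cubically, uniformly in the
direction. -/
lemma exists_norm_fourier_cumProj_le (hR : 0 < R) (h : IsBump R d) (h0 : ∫ p, d p = 0) :
    ∃ D, 0 ≤ D ∧ ∀ u : Plane, ‖u‖ = 1 → ∀ ξ : ℝ,
      |ξ| ^ 3 * ‖𝓕 (fun t => ((cumProj R d u t : ℝ) : ℂ)) ξ‖ ≤ D := by
  -- uniformity in `u`: expand the second derivative along `u` in coordinates
  obtain ⟨B, hB⟩ := (h.hasCompactSupport.iteratedFDeriv (𝕜 := ℝ) 2).exists_bound_of_continuous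
    (h.contDiff.continuous_iteratedFDeriv (m := 2) (WithTop.coe_le_coe.2 (le_top : (2 : ℕ∞) ≤ ⊤)))
  have hB0 : 0 ≤ B := (norm_nonneg _).trans (hB 0)
  refine ⟨2 * R * (2 * R * B), by positivity, fun u hu ξ => ?_⟩
  have h1 := h.fderiv_apply u
  have h2 := h1.fderiv_apply u
  have hbd : ∀ p, |fderiv ℝ (fun p => fderiv ℝ d p u) p u| ≤ B := by
    intro p
    have e : fderiv ℝ (fun p => fderiv ℝ d p u) p u = iteratedFDeriv ℝ 2 d p ![u, u] := by
      rw [iteratedFDeriv_two_apply, fderiv_clm_apply]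
      · simp
      · exact ((h.contDiff.fderiv_right (m := ((⊤ : ℕ∞) : WithTop ℕ∞)) (by simp)).differentiable
          (by simp)).differentiableAt
      · exact differentiableAt_const _
    rw [e, ← Real.norm_eq_abs]
    refine ((iteratedFDeriv ℝ 2 d p).le_opNorm _).trans ?_
    simpa [Fin.prod_univ_two, hu] using hB p
  have hd : ∀ t, HasDerivAt (fun t => ((cumProj R d u t : ℝ) : ℂ)) ((proj u d t : ℝ) : ℂ) t :=
    fun t => (h.hasDerivAt_cumProj hu t).ofReal_comp
  have hs : Function.support (fun t => ((cumProj R d u t : ℝ) : ℂ)) ⊆ Icc (-R) R := fun t ht =>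
    h.support_cumProj h0 hu fun hz => ht (by simp [hz])
  have e1 := norm_fourier_deriv hd (Complex.continuous_ofReal.comp (h.continuous_proj hu)) hs ξ
  have e2 := norm_fourier_le_of_hasDerivAt_two hR (fun t => (h.hasDerivAt_proj hu t).ofReal_comp)
    (fun t => (h1.hasDerivAt_proj hu t).ofReal_comp)
    (Complex.continuous_ofReal.comp (h2.continuous_proj hu)) (support_deriv_subset hd hs)
    (fun t => by rw [Complex.norm_real]; exact h2.abs_proj_le hR hu hbd t) ξ
  rw [← e1] at e2
  refine le_trans ?_ e2
  rw [← mul_assoc, ← pow_succ]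
  gcongr
  nlinarith [pi_gt_three, abs_nonneg ξ]

end IsBump

/-! ### The discrete Volterra transform of noiseless samples -/

/-- The samples of `d` on the square grid. -/
def samples (R : ℝ) (n : ℕ) (d : Plane → ℝ) : Fin n → Fin n → ℝ :=
  fun i j => d !₂[grid R n i, grid R n j]

lemma norm_dir (θ : ℝ) : ‖(dir θ : Plane)‖ = 1 := by
  simp

lemma fourierChar_eq_exp (x : ℝ) :
    ((𝐞 x : Circle) : ℂ) = Complex.exp (2 * π * Complex.I * x) := by
  rw [Real.fourierChar_apply]; congr 1; push_cast; ring

/-- Below the Nyquist frequency, the discrete Fourier coefficients of the samples of a bump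
approximate those of its projections up to `O(n⁻²)`. -/
lemma IsBump.exists_norm_alpha_sub_le {R : ℝ} {d : Plane → ℝ} (hR : 0 < R) (h : IsBump R d) :
    ∃ C, 0 ≤ C ∧ ∀ n : ℕ, 0 < n → ∀ (θ : ℝ) (k : ℤ), 2 * |(k : ℝ)| ≤ n →
      ‖alpha R (samples R n d) θ k
          - 𝓕 (fun t => ((proj (dir θ : Plane) d t : ℝ) : ℂ)) (k / (2 * R))‖
        ≤ C / n ^ 2 := by
  obtain ⟨C, hC, hle⟩ := h.exists_norm_grid_sum_sub_le hR
  refine ⟨C, hC, fun n hn θ k hk => ?_⟩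
  have hn' : (0 : ℝ) < n := by exact_mod_cast hn
  have hfreq : ∀ c : ℝ, |c| ≤ 1 → |(k : ℝ) / (2 * R) * c| ≤ n / (4 * R) := by
    intro c hc
    rw [abs_mul, abs_div, abs_of_pos (by positivity : 0 < 2 * R)]
    calc |(k : ℝ)| / (2 * R) * |c| ≤ |(k : ℝ)| / (2 * R) * 1 := by gcongr
      _ = 2 * |(k : ℝ)| / (4 * R) := by ring
      _ ≤ n / (4 * R) := by gcongr
  have key := hle n hn (k / (2 * R) * cos θ) (k / (2 * R) * sin θ)
    (hfreq _ (abs_cos_le_one θ)) (hfreq _ (abs_sin_le_one θ))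
  have e : alpha R (samples R n d) θ k = ((2 * R / n : ℝ) : ℂ) ^ 2 * ∑ i : Fin n, ∑ j : Fin n,
      𝐞 (-(grid R n i * (k / (2 * R) * cos θ) + grid R n j * (k / (2 * R) * sin θ))) •
        ((d !₂[grid R n i, grid R n j] : ℝ) : ℂ) := by
    rw [alpha]
    congr 1
    · push_cast; ring
    · refine Finset.sum_congr rfl fun i _ => Finset.sum_congr rfl fun j _ => ?_
      rw [Circle.smul_def, smul_eq_mul, mul_comm, samples, fourierChar_eq_exp]
      congr 2
      push_cast
      ring
  rw [h.fourier_proj (norm_dir θ), e]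
  simpa [dir] using key

/-- The Fourier series of a cumulative projection, normalized to vanish at the left end. -/
lemma IsBump.cumProj_eq_tsum {R : ℝ} {d : Plane → ℝ} {u : Plane} (hR : 0 < R) (h : IsBump R d)
    (h0 : ∫ p, d p = 0) (hu : ‖u‖ = 1)
    (hsum : Summable fun k : ℤ => 𝓕 (fun t => ((cumProj R d u t : ℝ) : ℂ)) (k / (2 * R)))
    {t : ℝ} (ht : t ∈ Icc (-R) R) :
    ((cumProj R d u t : ℝ) : ℂ) = (1 / ((2 * R : ℝ) : ℂ)) * ∑' k : ℤ,
      𝓕 (fun t => ((cumProj R d u t : ℝ) : ℂ)) (k / (2 * R)) *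
      (Complex.exp (2 * π * Complex.I * t * k / ((2 * R : ℝ) : ℂ)) -
        Complex.exp (2 * π * Complex.I * ((-R : ℝ) : ℂ) * k / ((2 * R : ℝ) : ℂ))) := by
  have hs : Function.support (fun t => ((cumProj R d u t : ℝ) : ℂ)) ⊆ Icc (-R) R := fun t ht =>
    h.support_cumProj h0 hu fun hz => ht (by simp [hz])
  have hz : ∀ x ∈ Icc (-R) R, ∑' m : ℤ, ((cumProj R d u (x + 2 * R * m) : ℝ) : ℂ)
      = ((cumProj R d u x : ℝ) : ℂ) := by
    intro x hx
    rw [tsum_eq_single 0]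
    · simp
    · intro m hm
      rw [h.cumProj_eq_zero h0 hu, Complex.ofReal_zero]
      intro hx'
      rcases lt_or_gt_of_ne hm with hm' | hm'
      · have : (m : ℝ) ≤ -1 := by exact_mod_cast (by omega : m ≤ -1)
        nlinarith [hx'.1, hx.2]
      · have : (1 : ℝ) ≤ m := by exact_mod_cast (by omega : 1 ≤ m)
        nlinarith [hx'.2, hx.1]
  have hP := fun x => tsum_eq_tsum_fourier_step (ψ := fun t => ((cumProj R d u t : ℝ) : ℂ))
    (T := 2 * R) (by positivity)
    (Complex.continuous_ofReal.comp (h.continuous_cumProj hu)) hs hsum x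
  have hexp : ∀ x : ℝ, Summable fun k : ℤ =>
      𝓕 (fun t => ((cumProj R d u t : ℝ) : ℂ)) (k / (2 * R)) *
        Complex.exp (2 * π * Complex.I * x * k / ((2 * R : ℝ) : ℂ)) := by
    intro x
    refine Summable.of_norm_bounded hsum.norm fun k => ?_
    have : (2 * π * Complex.I * x * k / ((2 * R : ℝ) : ℂ) : ℂ)
        = ((2 * π * x * k / (2 * R) : ℝ) : ℂ) * Complex.I := by push_cast; ring
    rw [norm_mul, this, Complex.norm_exp_ofReal_mul_I, mul_one]
  have hend : cumProj R d u (-R) = 0 := h.cumProj_eq_zero h0 hu (by simp)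
  have h1 := hP t
  have h2 := hP (-R)
  rw [hz t ht] at h1
  rw [hz (-R) ⟨le_rfl, by linarith⟩, hend, Complex.ofReal_zero] at h2
  have hcomm : ∀ (x : ℝ) (k : ℤ), (2 * π * Complex.I * k * x / ((2 * R : ℝ) : ℂ) : ℂ)
      = 2 * π * Complex.I * x * k / ((2 * R : ℝ) : ℂ) := fun x k => by ring
  simp only [hcomm] at h1 h2
  simp only [mul_sub]
  rw [(hexp t).tsum_sub (hexp (-R)), mul_sub, ← h2, sub_zero]
  exact h1

lemma norm_exp_sub_exp_le (R t : ℝ) (k : ℤ) :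
    ‖Complex.exp (2 * π * Complex.I * t * k / ((2 * R : ℝ) : ℂ)) -
      Complex.exp (2 * π * Complex.I * ((-R : ℝ) : ℂ) * k / ((2 * R : ℝ) : ℂ))‖ ≤ 2 := by
  have : ∀ x : ℝ, ‖Complex.exp (2 * π * Complex.I * x * k / ((2 * R : ℝ) : ℂ))‖ = 1 := by
    intro x
    have e : (2 * π * Complex.I * x * k / ((2 * R : ℝ) : ℂ) : ℂ)
        = ((2 * π * x * k / (2 * R) : ℝ) : ℂ) * Complex.I := by push_cast; ring
    rw [e, Complex.norm_exp_ofReal_mul_I]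
  refine (norm_sub_le _ _).trans ?_
  rw [this, this]; norm_num

/-- The approximate Volterra transform of the samples of a bump of total mass zero is uniformly
`O(1/n)`-close to its cumulative projections. -/
lemma IsBump.exists_norm_nu_sub_cumProj_le {R : ℝ} {d : Plane → ℝ} (hR : 0 < R) (h : IsBump R d)
    (h0 : ∫ p, d p = 0) :
    ∃ C, 0 ≤ C ∧ ∀ n : ℕ, 2 ≤ n → ∀ θ : ℝ, ∀ t ∈ Icc (-R) R,
      ‖nu R (samples R n d) t θ - ((cumProj R d (dir θ) t : ℝ) : ℂ)‖ ≤ C / n := by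
  obtain ⟨C, hC, hα⟩ := h.exists_norm_alpha_sub_le hR
  obtain ⟨D, hD, hF⟩ := h.exists_norm_fourier_cumProj_le hR h0
  refine ⟨C + 1 / (2 * R) * (8 * (2 * R) ^ 3 * D * zetaSum),
    by have := zetaSum_nonneg; positivity, fun n hn θ t ht => ?_⟩
  have hn' : (0 : ℝ) < n := by positivity
  set L : ℂ := ((2 * R : ℝ) : ℂ) with hL
  have hLn : ‖1 / L‖ = 1 / (2 * R) := by
    rw [hL, norm_div, norm_one, Complex.norm_real, Real.norm_of_nonneg (by positivity)]
  set F : ℤ → ℂ := fun k =>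
    𝓕 (fun t => ((cumProj R d (dir θ) t : ℝ) : ℂ)) (k / (2 * R)) with hFdef
  set E : ℤ → ℂ := fun k => Complex.exp (2 * π * Complex.I * t * k / L) -
        Complex.exp (2 * π * Complex.I * ((-R : ℝ) : ℂ) * k / L) with hE
  have hE2 : ∀ k, ‖E k‖ ≤ 2 := fun k => norm_exp_sub_exp_le R t k
  have hE0 : E 0 = 0 := by simp [hE]
  have hFk : ∀ k : ℤ, k ≠ 0 → ‖F k‖ ≤ (2 * R) ^ 3 * D / |(k : ℝ)| ^ 3 := by
    intro k hk
    have hk' : (0 : ℝ) < |(k : ℝ)| := abs_pos.2 (by exact_mod_cast hk)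
    have := hF _ (norm_dir θ) (k / (2 * R))
    rw [abs_div, abs_of_pos (by positivity : 0 < 2 * R), div_pow, div_mul_eq_mul_div,
      div_le_iff₀ (by positivity)] at this
    rw [le_div_iff₀ (by positivity)]
    linarith
  have hsumF : Summable F := by
    refine (norm_tsum_sub_sum_le (C := (2 * R) ^ 3 * D) (by positivity) {0} fun k hk => ?_).1
    have hk0 : k ≠ 0 := by simpa using hk
    have hk1 : (1 : ℝ) ≤ |(k : ℝ)| := by exact_mod_cast Int.one_le_abs hk0
    refine (hFk k hk0).trans ?_
    rw [← sq_abs (k : ℝ), mul_one_div]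
    gcongr
    · norm_num
  have hmem : ∀ k ∉ (freqs n).erase 0, k ≠ 0 → (n : ℝ) ≤ 4 * |(k : ℝ)| := by
    intro k hk hk0
    simp only [freqs, Finset.mem_erase, Finset.mem_Icc] at hk
    have : (n : ℤ) ≤ 4 * |k| := by
      rcases abs_cases k with ⟨h1, _⟩ | ⟨h1, _⟩ <;> omega
    exact_mod_cast this
  have htail : ‖∑' k, F k * E k - ∑ k ∈ (freqs n).erase 0, F k * E k‖
      ≤ 8 * (2 * R) ^ 3 * D / n * zetaSum := by
    refine (norm_tsum_sub_sum_le (by positivity) _ fun k hk => ?_).2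
    by_cases hk0 : k = 0
    · subst hk0; rw [hE0]; simp
    have hk' : (0 : ℝ) < |(k : ℝ)| := abs_pos.2 (by exact_mod_cast hk0)
    have h4 := hmem k hk hk0
    rw [norm_mul]
    calc ‖F k‖ * ‖E k‖ ≤ (2 * R) ^ 3 * D / |(k : ℝ)| ^ 3 * 2 :=
          mul_le_mul (hFk k hk0) (hE2 k) (norm_nonneg _) (by positivity)
      _ = 2 * (2 * R) ^ 3 * D * (1 / |(k : ℝ)|) * (1 / |(k : ℝ)| ^ 2) := by field_simp
      _ ≤ 2 * (2 * R) ^ 3 * D * (4 / n) * (1 / |(k : ℝ)| ^ 2) := by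
          gcongr ?_ * _
          gcongr 2 * (2 * R) ^ 3 * D * ?_
          rw [div_le_div_iff₀ hk' hn']; linarith
      _ = 8 * (2 * R) ^ 3 * D / n * (1 / (k : ℝ) ^ 2) := by rw [sq_abs]; ring
  have hβ : ∀ k ∈ (freqs n).erase 0,
      ‖betaNonzero R (samples R n d) θ k - F k‖ ≤ R * C / n ^ 2 := by
    intro k hk
    have hk0 : k ≠ 0 := Finset.ne_of_mem_erase hk
    have hk1 : (1 : ℝ) ≤ |(k : ℝ)| := by exact_mod_cast Int.one_le_abs hk0
    have h2k : 2 * |(k : ℝ)| ≤ n := by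
      simp only [freqs, Finset.mem_erase, Finset.mem_Icc] at hk
      have : 2 * |k| ≤ (n : ℤ) := by
        rcases abs_cases k with ⟨h1, _⟩ | ⟨h1, _⟩ <;> omega
      exact_mod_cast this
    have hA := hα n (by omega) θ k h2k
    rw [h.fourier_proj_eq h0 (norm_dir θ)] at hA
    set w : ℂ := 2 * π * Complex.I * k / L with hw
    have hw' : (2 * π * Complex.I * ((k / (2 * R) : ℝ) : ℂ) : ℂ) = w := by
      rw [hw, hL]; push_cast; ring
    have hwn : ‖w‖ = 2 * π * |(k : ℝ)| / (2 * R) := by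
      rw [hw, hL, norm_div, Complex.norm_real, Real.norm_of_nonneg (by positivity : 0 ≤ 2 * R)]
      simp [abs_of_pos pi_pos]
    have hw1 : 1 / R ≤ ‖w‖ := by
      rw [hwn, div_le_div_iff₀ hR (by positivity)]
      have : 1 ≤ π * |(k : ℝ)| := by nlinarith [pi_gt_three]
      nlinarith
    have hw0 : w ≠ 0 := by
      rw [← norm_pos_iff]; exact lt_of_lt_of_le (by positivity) hw1
    rw [hw'] at hA
    have e : betaNonzero R (samples R n d) θ k - F k
        = (alpha R (samples R n d) θ k - w * F k) / w := by
      rw [betaNonzero, ← hw, sub_div, mul_div_cancel_left₀ _ hw0]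
    rw [e, norm_div, div_le_iff₀ (norm_pos_iff.2 hw0)]
    refine hA.trans ?_
    calc C / n ^ 2 = R * C / n ^ 2 * (1 / R) := by field_simp
      _ ≤ _ := by gcongr
  have hcard : (((freqs n).erase 0).card : ℝ) ≤ n := by
    have h1 : ((freqs n).erase 0).card ≤ (freqs n).card :=
      Finset.card_le_card (Finset.erase_subset _ _)
    have h2 : (freqs n).card ≤ n := by rw [freqs, Int.card_Icc]; omega
    exact_mod_cast h1.trans h2
  have hhead : ‖∑ k ∈ (freqs n).erase 0, betaNonzero R (samples R n d) θ k * E k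
      - ∑ k ∈ (freqs n).erase 0, F k * E k‖ ≤ n * (R * C / n ^ 2 * 2) := by
    rw [← Finset.sum_sub_distrib]
    refine (norm_sum_le_of_le _ (f := fun k => betaNonzero R (samples R n d) θ k * E k - F k * E k)
      (n := fun _ => R * C / n ^ 2 * 2) fun k hk => ?_).trans ?_
    · rw [← sub_mul, norm_mul]
      exact mul_le_mul (hβ k hk) (hE2 k) (norm_nonneg _) (by positivity)
    · rw [Finset.sum_const, nsmul_eq_mul]
      gcongr
  rw [h.cumProj_eq_tsum hR h0 (norm_dir θ) hsumF ht, nu_eq_sum_freqs R hn, ← mul_sub, norm_mul,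
    hLn]
  have htot := norm_sub_le_norm_sub_add_norm_sub
    (∑ k ∈ (freqs n).erase 0, betaNonzero R (samples R n d) θ k * E k)
    (∑ k ∈ (freqs n).erase 0, F k * E k) (∑' k, F k * E k)
  rw [norm_sub_rev (∑ k ∈ (freqs n).erase 0, F k * E k)] at htot
  calc _ ≤ 1 / (2 * R) * (n * (R * C / n ^ 2 * 2) + 8 * (2 * R) ^ 3 * D / n * zetaSum) := by
        gcongr
        exact htot.trans (add_le_add hhead htail)
    _ = _ := by field_simp

/-! ### Regularity of the cumulative projections -/

namespace IsBump

variable {R : ℝ} {d : Plane → ℝ} {u : Plane}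

/-- The cumulative projections of a bump of total mass zero depend on the direction and the
height in a Lipschitz way. -/
lemma exists_abs_cumProj_sub_le (hR : 0 < R) (h : IsBump R d) (h0 : ∫ p, d p = 0) :
    ∃ K, 0 ≤ K ∧ ∀ u v : Plane, ‖u‖ = 1 → ‖v‖ = 1 → ∀ t t' : ℝ,
      |cumProj R d u t - cumProj R d v t'| ≤ K * (‖u - v‖ + |t - t'|) := by
  obtain ⟨B, hB0, hB⟩ := h.exists_bound
  obtain ⟨K, hK⟩ := h.contDiff.lipschitzWith_of_hasCompactSupport h.hasCompactSupport (by simp)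
  have hproj : ∀ u v : Plane, ‖u‖ = 1 → ‖v‖ = 1 → ∀ t, |t| ≤ R →
      |proj u d t - proj v d t| ≤ 2 * R * (K * (2 * R * ‖u - v‖)) := by
    intro u v hu hv t ht
    rw [proj_eq, proj_eq, ← integral_sub (h.integrable_line hu t) (h.integrable_line hv t)]
    have hs : Function.support (fun s : ℝ => d (t • u + s • perp u) - d (t • v + s • perp v))
        ⊆ Icc (-R) R := by
      intro s hs
      by_contra hc
      exact hs (by simp [h.eq_zero_of_notMem hu (t := t) (Or.inr hc),
        h.eq_zero_of_notMem hv (t := t) (Or.inr hc)])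
    refine norm_integral_le_of_support hR hs fun s => ?_
    by_cases hsR : s ∈ Icc (-R) R
    · refine (hK.norm_sub_le _ _).trans ?_
      gcongr
      have e : t • u + s • perp u - (t • v + s • perp v)
          = t • (u - v) + s • (perp u - perp v) := by
        rw [smul_sub, smul_sub]; abel
      rw [e]
      refine (norm_add_le _ _).trans ?_
      rw [norm_smul, norm_smul, norm_perp_sub, Real.norm_eq_abs, Real.norm_eq_abs]
      have : |s| ≤ R := abs_le.2 hsR
      nlinarith [norm_nonneg (u - v)]
    · have : d (t • u + s • perp u) - d (t • v + s • perp v) = 0 := by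
        by_contra hc; exact hsR (hs hc)
      rw [this, norm_zero]
      positivity
  have hdir : ∀ u v : Plane, ‖u‖ = 1 → ‖v‖ = 1 → ∀ t,
      |cumProj R d u t - cumProj R d v t| ≤ 8 * R ^ 3 * K * ‖u - v‖ := by
    intro u v hu hv t
    by_cases ht : t ∈ Ioo (-R) R
    · have hint : ∀ w : Plane, ‖w‖ = 1 → IntervalIntegrable (proj w d) volume (-R) t :=
        fun w hw => (h.continuous_proj hw).intervalIntegrable _ _
      rw [cumProj, cumProj, volterra, volterra,
        ← intervalIntegral.integral_sub (hint u hu) (hint v hv)]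
      have := intervalIntegral.norm_integral_le_of_norm_le_const (a := -R) (b := t)
        (f := fun t => proj u d t - proj v d t) (C := 2 * R * (K * (2 * R * ‖u - v‖)))
        (fun x hx => by
          rw [uIoc_of_le ht.1.le] at hx
          exact hproj u v hu hv x (abs_le.2 ⟨hx.1.le, hx.2.trans ht.2.le⟩))
      refine this.trans ?_
      have h2 : |t - -R| ≤ 2 * R := by
        rw [abs_of_nonneg (by linarith [ht.1])]; linarith [ht.2]
      calc _ ≤ 2 * R * (K * (2 * R * ‖u - v‖)) * (2 * R) := by gcongr
        _ = _ := by ring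
    · rw [h.cumProj_eq_zero h0 hu ht, h.cumProj_eq_zero h0 hv ht, sub_zero, abs_zero]
      positivity
  refine ⟨8 * R ^ 3 * K + 2 * R * B, by positivity, fun u v hu hv t t' => ?_⟩
  have h1 := hdir u v hu hv t
  have h2 : |cumProj R d v t - cumProj R d v t'| ≤ 2 * R * B * |t - t'| :=
    convex_univ.norm_image_sub_le_of_norm_hasDerivWithin_le
      (fun x _ => (h.hasDerivAt_cumProj hv x).hasDerivWithinAt)
      (fun x _ => h.abs_proj_le hR hv hB x) (mem_univ t') (mem_univ t)
  have h3 := abs_sub_le (cumProj R d u t) (cumProj R d v t) (cumProj R d v t')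
  have h4 : 0 ≤ 8 * R ^ 3 * K * |t - t'| := by positivity
  have h5 : 0 ≤ 2 * R * B * ‖u - v‖ := by positivity
  nlinarith

lemma exists_abs_cumProj_le (hR : 0 < R) (h : IsBump R d) (h0 : ∫ p, d p = 0) :
    ∃ B, 0 ≤ B ∧ ∀ u : Plane, ‖u‖ = 1 → ∀ t, |cumProj R d u t| ≤ B := by
  obtain ⟨K, hK, hle⟩ := h.exists_abs_cumProj_sub_le hR h0
  refine ⟨K * (2 * R), by positivity, fun u hu t => ?_⟩
  by_cases ht : t ∈ Ioo (-R) R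
  · have := hle u u hu hu t (-R)
    rw [h.cumProj_eq_zero h0 hu (t := -R) (by simp), sub_zero, sub_self, norm_zero, zero_add,
      abs_of_nonneg (by linarith [ht.1] : 0 ≤ t - -R)] at this
    refine this.trans ?_
    gcongr
    linarith [ht.2]
  · rw [h.cumProj_eq_zero h0 hu ht, abs_zero]; positivity

lemma continuous_cumProj_prod (hR : 0 < R) (h : IsBump R d) (h0 : ∫ p, d p = 0) :
    Continuous fun q : UnitCircle × ℝ => cumProj R d q.1 q.2 := by
  obtain ⟨K, hK, hle⟩ := h.exists_abs_cumProj_sub_le hR h0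
  rw [continuous_iff_continuousAt]
  intro q
  rw [ContinuousAt, tendsto_iff_dist_tendsto_zero]
  have hlim : Tendsto (fun q' : UnitCircle × ℝ =>
      K * (‖(q'.1 : Plane) - q.1‖ + |q'.2 - q.2|)) (𝓝 q) (𝓝 0) := by
    have hc : Continuous fun q' : UnitCircle × ℝ =>
      K * (‖(q'.1 : Plane) - q.1‖ + |q'.2 - q.2|) := by fun_prop
    have := hc.tendsto q
    simpa using this
  refine squeeze_zero (fun _ => dist_nonneg) (fun q' => ?_) hlim
  rw [Real.dist_eq]
  exact hle _ _ (by simp) (by simp) _ _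

lemma proj_neg (u : Plane) (d : Plane → ℝ) (t : ℝ) : proj (-u) d t = proj u d (-t) := by
  have hp : perp (-u) = -perp u := by
    ext i; fin_cases i <;> simp [perp]
  rw [proj_eq, proj_eq, ← integral_neg_eq_self]
  simp [hp]

/-- Opposite directions see the reflected cumulative projection. -/
lemma abs_cumProj_neg (h : IsBump R d) (h0 : ∫ p, d p = 0) (hu : ‖u‖ = 1) (t : ℝ) :
    |cumProj R d (-u) t| = |cumProj R d u (-t)| := by
  have hi : ∀ a b, IntervalIntegrable (proj u d) volume a b :=
    fun a b => (h.continuous_proj hu).intervalIntegrable _ _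
  have hend : cumProj R d u R = 0 := h.cumProj_eq_zero h0 hu (by simp)
  have e : cumProj R d (-u) t = -cumProj R d u (-t) := by
    rw [cumProj, volterra]
    simp_rw [proj_neg]
    rw [intervalIntegral.integral_comp_neg, neg_neg]
    have := intervalIntegral.integral_add_adjacent_intervals (hi (-R) (-t)) (hi (-t) R)
    rw [cumProj, volterra] at hend ⊢
    linarith
  rw [e, abs_neg]

end IsBump

lemma dir_add_pi (θ : ℝ) : (dir (θ + π) : Plane) = -(dir θ : Plane) := by
  ext i; fin_cases i <;> simp [dir]

lemma norm_dir_sub_le (θ θ' : ℝ) : ‖(dir θ : Plane) - dir θ'‖ ≤ 2 * |θ - θ'| := by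
  have h1 := abs_cos_sub_cos_le θ θ'
  have h2 := abs_sin_sub_sin_le θ θ'
  refine le_of_sq_le_sq ?_ (by positivity)
  rw [EuclideanSpace.norm_sq_eq, Fin.sum_univ_two]
  simp only [dir, PiLp.sub_apply, Real.norm_eq_abs, Matrix.cons_val_zero, Matrix.cons_val_one]
  nlinarith [abs_nonneg (cos θ - cos θ'), abs_nonneg (sin θ - sin θ'), abs_nonneg (θ - θ')]

lemma continuous_dir : Continuous dir := by
  unfold dir
  fun_prop

/-- Every direction is, up to sign, at an angle in `[0, π)`. -/
lemma exists_dir_eq {u : Plane} (hu : ‖u‖ = 1) :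
    ∃ θ ∈ Ico 0 π, u = dir θ ∨ u = -(dir θ : Plane) := by
  have h1 := norm_sq_eq_one hu
  set z : ℂ := ⟨u 0, u 1⟩ with hz
  have hzn : ‖z‖ = 1 := by
    rw [Complex.norm_def, Complex.normSq_mk, ← pow_two, ← pow_two, h1, sqrt_one]
  have hz0 : z ≠ 0 := by rw [← norm_pos_iff, hzn]; norm_num
  have hdir : u = dir z.arg := by
    have hc : cos z.arg = u 0 := by rw [Complex.cos_arg hz0, hzn, div_one]
    have hs : sin z.arg = u 1 := by rw [Complex.sin_arg, hzn, div_one]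
    ext i; fin_cases i <;> simp [dir, hc, hs]
  have harg := Complex.arg_mem_Ioc z
  rcases lt_or_ge z.arg 0 with h | h
  · refine ⟨z.arg + π, ⟨by linarith [harg.1], by linarith⟩, Or.inr ?_⟩
    rw [dir_add_pi, neg_neg]; exact hdir
  · rcases harg.2.lt_or_eq with h' | h'
    · exact ⟨z.arg, ⟨h, h'⟩, Or.inl hdir⟩
    · refine ⟨0, ⟨le_rfl, pi_pos⟩, Or.inr ?_⟩
      rw [hdir, h', ← dir_add_pi, zero_add]

/-! ### The sliced Cramér distance as an integral norm -/

lemma cramer_eq {R : ℝ} {f g : Plane → ℝ} (hf : IsBump R f) (hg : IsBump R g) (u : UnitCircle)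
    (p : ℝ≥0∞) : cramer (-R) R p (proj u f) (proj u g)
      = eLpNorm (cumProj R (fun x => f x - g x) u) p (volume.restrict (Ioo (-R) R)) := by
  rw [cramer, volterraNorm]
  congr 1
  ext t
  rw [cumProj]
  congr 1
  ext s
  rw [proj_eq, proj_eq, proj_eq, ← integral_sub (hf.integrable_line (by simp) s)
    (hg.integrable_line (by simp) s)]

/-- The measure on heights and angles that defines the sliced distances: Lebesgue measure in the
height, and the uniform probability measure on the half circle `[0, π)` in the angle. -/
def sliceMeasure (R : ℝ) : Measure (ℝ × ℝ) :=
  ((ENNReal.ofReal π)⁻¹ • volume.restrict (Ico 0 π)).prod (volume.restrict (Ico (-R) R))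

lemma sliceMeasure_univ (R : ℝ) : sliceMeasure R univ = ENNReal.ofReal (2 * R) := by
  have hπ : ENNReal.ofReal π ≠ 0 := by simpa using pi_pos
  rw [sliceMeasure, ← univ_prod_univ, Measure.prod_prod]
  simp only [Measure.smul_apply, Measure.restrict_apply_univ, volume_Ico, smul_eq_mul, sub_zero,
    sub_neg_eq_add]
  rw [ENNReal.inv_mul_cancel hπ ENNReal.ofReal_ne_top, one_mul, two_mul]

instance (R : ℝ) : IsFiniteMeasure (sliceMeasure R) :=
  ⟨by rw [sliceMeasure_univ]; exact ENNReal.ofReal_lt_top⟩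

lemma ae_sliceMeasure_mem (R : ℝ) :
    ∀ᵐ q ∂sliceMeasure R, q.1 ∈ Ico 0 π ∧ q.2 ∈ Ico (-R) R := by
  rw [sliceMeasure]
  refine (Measure.ae_prod_iff_ae_ae ?_).2 ?_
  · exact ((measurableSet_Ico.preimage measurable_fst).inter
      (measurableSet_Ico.preimage measurable_snd))
  · refine Measure.ae_smul_measure ?_ _
    filter_upwards [ae_restrict_mem measurableSet_Ico] with x hx
    filter_upwards [ae_restrict_mem measurableSet_Ico] with y hy
    exact ⟨hx, hy⟩

lemma lintegral_sliceMeasure (R : ℝ) {G : ℝ × ℝ → ℝ≥0∞} (hG : Measurable G) :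
    ∫⁻ q, G q ∂sliceMeasure R
      = (ENNReal.ofReal π)⁻¹ * ∫⁻ θ in Ico 0 π, ∫⁻ t in Ico (-R) R, G (θ, t) := by
  rw [sliceMeasure, lintegral_prod _ hG.aemeasurable, lintegral_smul_measure, smul_eq_mul]

/-- The integral over the circle of an even function is an average over half the angles. -/
lemma lintegral_uniformCircle_of_even {Φ : UnitCircle → ℝ≥0∞} (hΦ : Measurable Φ)
    (heven : ∀ θ, Φ (dir (θ + π)) = Φ (dir θ)) :
    ∫⁻ u, Φ u ∂uniformCircle = (ENNReal.ofReal π)⁻¹ * ∫⁻ θ in Ico 0 π, Φ (dir θ) := by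
  have hsplit : Ioc 0 (2 * π) = Ioc 0 π ∪ Ioc π (2 * π) :=
    (Ioc_union_Ioc_eq_Ioc pi_pos.le (by linarith [pi_pos])).symm
  have hshift : ∫⁻ θ in Ioc π (2 * π), Φ (dir θ) = ∫⁻ θ in Ioc 0 π, Φ (dir θ) := by
    have he : (fun θ : ℝ => θ + π) ⁻¹' (Ioc π (2 * π)) = Ioc 0 π := by
      ext θ; simp only [mem_preimage, mem_Ioc]; constructor <;> rintro ⟨h1, h2⟩ <;>
        constructor <;> linarith
    rw [← (measurePreserving_add_right volume π).setLIntegral_comp_preimage_emb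
      (measurableEmbedding_addRight π), he]
    simp only [heven]
  rw [uniformCircle, lintegral_smul_measure, lintegral_map hΦ continuous_dir.measurable, hsplit,
    lintegral_union measurableSet_Ioc (Ioc_disjoint_Ioc_of_le le_rfl), hshift, smul_eq_mul,
    ← two_mul, ← mul_assoc, setLIntegral_congr (Ico_ae_eq_Ioc (a := 0) (b := π))]
  congr 1
  rw [ENNReal.ofReal_mul zero_le_two, ENNReal.mul_inv (by simp) (by simp)]
  simp only [ENNReal.ofReal_ofNat]
  rw [mul_right_comm, ENNReal.inv_mul_cancel (by simp) (by simp), one_mul]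

/-- The endpoints of `(-R, R)` are null; half-open intervals fit the division into cells. -/
lemma cramer_rpow_eq {R : ℝ} {f g : Plane → ℝ} (hf : IsBump R f) (hg : IsBump R g)
    (u : UnitCircle) {p : ℝ≥0∞} (hp0 : p ≠ 0) (hp' : p ≠ ∞) :
    cramer (-R) R p (proj u f) (proj u g) ^ p.toReal
      = ∫⁻ t in Ico (-R) R, ‖cumProj R (fun x => f x - g x) u t‖ₑ ^ p.toReal := by
  have hpr : 0 < p.toReal := ENNReal.toReal_pos hp0 hp'
  rw [cramer_eq hf hg, eLpNorm_eq_lintegral_rpow_enorm_toReal hp0 hp', ← ENNReal.rpow_mul,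
    one_div_mul_cancel hpr.ne', ENNReal.rpow_one, setLIntegral_congr Ioo_ae_eq_Ico]

lemma lintegral_cumProj_add_pi {R : ℝ} {d : Plane → ℝ} (h : IsBump R d) (h0 : ∫ x, d x = 0)
    (r θ : ℝ) : ∫⁻ t in Ico (-R) R, ‖cumProj R d (dir (θ + π)) t‖ₑ ^ r
      = ∫⁻ t in Ico (-R) R, ‖cumProj R d (dir θ) t‖ₑ ^ r := by
  have hpt : ∀ t, ‖cumProj R d (dir (θ + π)) t‖ₑ = ‖cumProj R d (dir θ) (-t)‖ₑ := by
    intro t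
    rw [dir_add_pi, Real.enorm_eq_ofReal_abs, Real.enorm_eq_ofReal_abs,
      h.abs_cumProj_neg h0 (norm_dir θ)]
  have he : (fun t : ℝ => -t) ⁻¹' (Ioo (-R) R) = Ioo (-R) R := by
    ext t; simp only [mem_preimage, mem_Ioo]; constructor <;> rintro ⟨h1, h2⟩ <;>
      constructor <;> linarith
  have hrefl := (Measure.measurePreserving_neg (volume : Measure ℝ)).setLIntegral_comp_preimage_emb
    (MeasurableEquiv.neg ℝ).measurableEmbedding
    (fun t => ‖cumProj R d (dir θ) t‖ₑ ^ r) (Ioo (-R) R)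
  rw [he] at hrefl
  simp only [hpt]
  rw [← setLIntegral_congr Ioo_ae_eq_Ico, ← setLIntegral_congr Ioo_ae_eq_Ico]
  exact hrefl

lemma lintegral_uniformCircle_eq_sliceMeasure (R : ℝ) {Φ : UnitCircle → ℝ → ℝ≥0∞}
    (hΦ : Measurable (Function.uncurry Φ))
    (heven : ∀ θ, ∫⁻ t in Ico (-R) R, Φ (dir (θ + π)) t = ∫⁻ t in Ico (-R) R, Φ (dir θ) t) :
    ∫⁻ u, (∫⁻ t in Ico (-R) R, Φ u t) ∂uniformCircle = ∫⁻ q, Φ (dir q.1) q.2 ∂sliceMeasure R := by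
  have hm : Measurable fun q : ℝ × ℝ => Φ (dir q.1) q.2 :=
    hΦ.comp ((continuous_dir.measurable.comp measurable_fst).prodMk measurable_snd)
  have hm' : Measurable fun u : UnitCircle => ∫⁻ t in Ico (-R) R, Φ u t :=
    Measurable.lintegral_prod_right hΦ
  rw [lintegral_uniformCircle_of_even hm' heven, lintegral_sliceMeasure R hm]

/-- Complex values are used because `ν_x` is complex-valued. -/
lemma slicedCramer_eq_eLpNorm {R : ℝ} (hR : 0 < R) {f g : Plane → ℝ} (hf : IsBump R f)
    (hg : IsBump R g) (h0 : ∫ x, (f x - g x) = 0) {p : ℝ≥0∞} (hp : 1 ≤ p) (hp' : p ≠ ∞) :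
    slicedCramer uniformCircle R p f g = eLpNorm
      (fun q : ℝ × ℝ => ((cumProj R (fun x => f x - g x) (dir q.1) q.2 : ℝ) : ℂ)) p
        (sliceMeasure R) := by
  have hd := hf.sub hg
  have hp0 : p ≠ 0 := (zero_lt_one.trans_le hp).ne'
  have hnorm : ∀ x : ℝ, ‖((x : ℝ) : ℂ)‖ₑ = ‖x‖ₑ := fun x => by
    rw [← ofReal_norm, ← ofReal_norm, Complex.norm_real]
  rw [slicedCramer, if_neg hp', eLpNorm_eq_lintegral_rpow_enorm_toReal hp0 hp']
  simp only [hnorm, cramer_rpow_eq hf hg _ hp0 hp']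
  congr 1
  exact lintegral_uniformCircle_eq_sliceMeasure R
    (Φ := fun u t => ‖cumProj R (fun x => f x - g x) u t‖ₑ ^ p.toReal)
    (((hd.continuous_cumProj_prod hR h0).measurable.enorm).pow_const _)
    fun θ => lintegral_cumProj_add_pi hd h0 _ θ

section Top

variable {R : ℝ} {f g : Plane → ℝ}

lemma slicedCramer_top_le (hf : IsBump R f) (hg : IsBump R g) {M : ℝ}
    (hM : ∀ u : Plane, ‖u‖ = 1 → ∀ t, |cumProj R (fun x => f x - g x) u t| ≤ M) :
    slicedCramer uniformCircle R ∞ f g ≤ ENNReal.ofReal M := by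
  rw [slicedCramer, if_pos rfl]
  refine iSup_le fun u => ?_
  rw [cramer_eq hf hg]
  refine (eLpNorm_le_of_ae_bound (C := M) (Eventually.of_forall fun t => hM u (by simp) t)).trans ?_
  simp

/-- By continuity, the essential supremum bounds every value. -/
lemma abs_cumProj_le_slicedCramer_top (hf : IsBump R f) (hg : IsBump R g)
    (h0 : ∫ x, (f x - g x) = 0) (hfin : slicedCramer uniformCircle R ∞ f g ≠ ∞)
    (u : UnitCircle) (t : ℝ) :
    |cumProj R (fun x => f x - g x) u t| ≤ (slicedCramer uniformCircle R ∞ f g).toReal := by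
  have hd := hf.sub hg
  have hu : ‖(u : Plane)‖ = 1 := by simp
  set F := cumProj R (fun x => f x - g x) u with hF
  set c := (slicedCramer uniformCircle R ∞ f g).toReal with hc
  by_cases ht : t ∈ Ioo (-R) R
  · have hcont : Continuous F := hd.continuous_cumProj hu
    have hle : eLpNorm F ∞ (volume.restrict (Ioo (-R) R)) ≤ slicedCramer uniformCircle R ∞ f g := by
      rw [← cramer_eq hf hg, slicedCramer, if_pos rfl]
      exact le_iSup (fun u : UnitCircle => cramer (-R) R ∞ (proj u f) (proj u g)) u
    have hae : (fun t => max |F t| c) =ᵐ[volume.restrict (Ioo (-R) R)] fun _ => c := by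
      filter_upwards [ae_le_eLpNormEssSup (f := F) (μ := volume.restrict (Ioo (-R) R))] with y hy
      rw [← eLpNorm_exponent_top] at hy
      have := ENNReal.toReal_mono hfin (hy.trans hle)
      rw [toReal_enorm, Real.norm_eq_abs] at this
      exact max_eq_right this
    have := Measure.eqOn_open_of_ae_eq hae isOpen_Ioo
      ((hcont.abs.max continuous_const).continuousOn) continuousOn_const ht
    exact max_eq_right_iff.1 this
  · rw [hF, hd.cumProj_eq_zero h0 hu ht, abs_zero]
    exact ENNReal.toReal_nonneg

end Top

lemma slicedCramer_ne_top {R : ℝ} (hR : 0 < R) {f g : Plane → ℝ} (hf : IsBump R f)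
    (hg : IsBump R g) (h0 : ∫ x, (f x - g x) = 0) {p : ℝ≥0∞} (hp : 1 ≤ p) :
    slicedCramer uniformCircle R p f g ≠ ∞ := by
  obtain ⟨B, hB0, hB⟩ := (hf.sub hg).exists_abs_cumProj_le hR h0
  by_cases hp' : p = ∞
  · subst hp'
    exact ((slicedCramer_top_le hf hg hB).trans_lt ENNReal.ofReal_lt_top).ne
  · rw [slicedCramer_eq_eLpNorm hR hf hg h0 hp hp']
    refine ((eLpNorm_le_of_ae_bound (C := B) (Eventually.of_forall fun q => ?_)).trans_lt ?_).ne
    · rw [Complex.norm_real]; exact hB _ (norm_dir _) _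
    · refine ENNReal.mul_lt_top (ENNReal.rpow_lt_top_of_nonneg (by positivity) ?_)
        ENNReal.ofReal_lt_top
      exact measure_ne_top _ _

/-! ### Discrete distances as norms of step functions -/

/-- The index of the cell containing `t` when `[a, b)` is divided into `n` equal cells. -/
def cell (a b : ℝ) (n : ℕ) (t : ℝ) : ℕ := ⌊(t - a) * n / (b - a)⌋₊

lemma measurable_cell (a b : ℝ) (n : ℕ) : Measurable (cell a b n) :=
  Nat.measurable_floor.comp (by fun_prop)

lemma cell_eq_iff {a b : ℝ} (hab : a < b) {n : ℕ} (hn : 0 < n) {t : ℝ} (ht : a ≤ t) (j : ℕ) :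
    cell a b n t = j ↔ t ∈ Ico (a + j * ((b - a) / n)) (a + (j + 1) * ((b - a) / n)) := by
  have hn' : (0 : ℝ) < n := by exact_mod_cast hn
  have hba : 0 < b - a := sub_pos.2 hab
  rw [cell, Nat.floor_eq_iff (by have := sub_nonneg.2 ht; positivity), mem_Ico,
    le_div_iff₀ hba, div_lt_iff₀ hba, ← le_sub_iff_add_le', ← sub_lt_iff_lt_add', ← mul_div_assoc,
    ← mul_div_assoc, div_le_iff₀ hn', lt_div_iff₀ hn']

lemma cell_lt {a b : ℝ} {n : ℕ} (hn : 0 < n) {t : ℝ} (ht : t ∈ Ico a b) : cell a b n t < n := by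
  have hn' : (0 : ℝ) < n := by exact_mod_cast hn
  have hba : 0 < b - a := by linarith [ht.1, ht.2]
  have := sub_nonneg.2 ht.1
  rw [cell, Nat.floor_lt (by positivity), div_lt_iff₀ hba]
  nlinarith [ht.2]

lemma abs_sub_cell_le {a b : ℝ} {n : ℕ} (hn : 0 < n) {t : ℝ} (ht : t ∈ Ico a b) :
    |t - (a + cell a b n t * ((b - a) / n))| ≤ (b - a) / n := by
  have h := (cell_eq_iff (ht.1.trans_lt ht.2) hn ht.1 _).1 (rfl : cell a b n t = _)
  rw [abs_of_nonneg (by linarith [h.1])]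
  linarith [h.2]

/-- The integral of a function that is constant on the cells. -/
lemma lintegral_cell {a b : ℝ} (hab : a < b) {n : ℕ} (hn : 0 < n) (G : ℕ → ℝ≥0∞) :
    ∫⁻ t in Ico a b, G (cell a b n t)
      = ENNReal.ofReal ((b - a) / n) * ∑ j ∈ Finset.range n, G j := by
  have hn' : (0 : ℝ) < n := by exact_mod_cast hn
  have hba : 0 < b - a := sub_pos.2 hab
  rw [← lintegral_map (f := G) (measurable_of_countable _) (measurable_cell a b n),
    lintegral_countable', tsum_eq_sum (s := Finset.range n), Finset.mul_sum]
  · refine Finset.sum_congr rfl fun j hj => ?_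
    have hj' : (j : ℝ) + 1 ≤ n := by exact_mod_cast Finset.mem_range.1 hj
    rw [Measure.map_apply (measurable_cell a b n) (measurableSet_singleton j),
      Measure.restrict_apply (measurable_cell a b n (measurableSet_singleton j)), mul_comm]
    have he : cell a b n ⁻¹' {j} ∩ Ico a b
        = Ico (a + j * ((b - a) / n)) (a + (j + 1) * ((b - a) / n)) := by
      ext t
      constructor
      · rintro ⟨h1, h2⟩
        exact (cell_eq_iff hab hn h2.1 j).1 h1
      · intro h
        have h1 : a ≤ t := le_trans (le_add_of_nonneg_right (by positivity)) h.1
        have h2 : a + (j + 1) * ((b - a) / n) ≤ b := by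
          have : (j + 1) * ((b - a) / n) ≤ n * ((b - a) / n) := by gcongr
          rw [mul_div_cancel₀ _ hn'.ne'] at this
          linarith
        exact ⟨(cell_eq_iff hab hn h1 j).2 h, h1, h.2.trans_le h2⟩
    rw [he, Real.volume_Ico]
    congr 2
    ring
  · intro j hj
    rw [Measure.map_apply (measurable_cell a b n) (measurableSet_singleton j),
      Measure.restrict_apply (measurable_cell a b n (measurableSet_singleton j))]
    have he : cell a b n ⁻¹' {j} ∩ Ico a b = ∅ := by
      ext t
      simp only [mem_inter_iff, mem_preimage, mem_singleton_iff, mem_empty_iff_false, iff_false]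
      rintro ⟨h1, h2⟩
      exact hj (Finset.mem_range.2 (h1 ▸ cell_lt hn h2))
    rw [he, measure_empty, mul_zero]

lemma grid_eq (R : ℝ) (n j : ℕ) : grid R n j = -R + j * ((R - -R) / n) := by
  rw [grid]; ring

lemma angle_eq (n l : ℕ) : angle n l = 0 + l * ((π - 0) / n) := by
  rw [angle]; ring

/-- The step function on angles and heights whose values are those of `ν_x` at the grid points. -/
def stepNu (R : ℝ) {n : ℕ} (x : Fin n → Fin n → ℝ) (q : ℝ × ℝ) : ℂ :=
  nu R x (grid R n (cell (-R) R n q.2)) (angle n (cell 0 π n q.1))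

lemma measurable_comp_cell {a b a' b' : ℝ} {n : ℕ} (G : ℕ → ℕ → ℂ) :
    Measurable fun q : ℝ × ℝ => G (cell a b n q.2) (cell a' b' n q.1) := by
  have h : Measurable fun q : ℝ × ℝ => (cell a b n q.2, cell a' b' n q.1) :=
    ((measurable_cell _ _ _).comp measurable_snd).prodMk
      ((measurable_cell _ _ _).comp measurable_fst)
  exact (measurable_of_countable (Function.uncurry G)).comp h

lemma measurable_stepNu (R : ℝ) {n : ℕ} (x : Fin n → Fin n → ℝ) : Measurable (stepNu R x) :=
  measurable_comp_cell fun j l => nu R x (grid R n j) (angle n l)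

/-- The endpoint `t_n = R` does not contribute to the discrete norm, as `ν_x` vanishes there. -/
lemma discreteSV_eq_sum {R : ℝ} (hR : 0 < R) {n : ℕ} (hn : 2 ≤ n) {p : ℝ≥0∞} (hp : 1 ≤ p)
    (hp' : p ≠ ∞) (x : Fin n → Fin n → ℝ) :
    discreteSV R p x = (1 / (n : ℝ) * ∑ l ∈ Finset.range n, 2 * R / (n : ℝ) *
      ∑ j ∈ Finset.range n, ‖nu R x (grid R n j) (angle n l)‖ ^ p.toReal) ^ (1 / p.toReal) := by
  have hpr : 0 < p.toReal := ENNReal.toReal_pos (zero_lt_one.trans_le hp).ne' hp'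
  rw [discreteSV, if_neg hp']
  simp only [Finset.sum_range_succ _ n, nu_right hR hn, norm_zero, zero_rpow hpr.ne', add_zero]

/-- The factors `1 / n` and `2 R / n` of the discrete norm are the masses of the cells of angles and
heights. -/
lemma discreteSV_eq_eLpNorm {R : ℝ} (hR : 0 < R) {n : ℕ} (hn : 2 ≤ n) {p : ℝ≥0∞} (hp : 1 ≤ p)
    (hp' : p ≠ ∞) (x : Fin n → Fin n → ℝ) :
    discreteSV R p x = (eLpNorm (stepNu R x) p (sliceMeasure R)).toReal := by
  have hp0 : p ≠ 0 := (zero_lt_one.trans_le hp).ne'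
  have hn0 : 0 < n := by omega
  have hn' : (0 : ℝ) < n := by exact_mod_cast hn0
  rw [discreteSV_eq_sum hR hn hp hp', eLpNorm_eq_lintegral_rpow_enorm_toReal hp0 hp',
    lintegral_sliceMeasure R ((measurable_stepNu R x).enorm.pow_const _), ← ENNReal.toReal_rpow]
  congr 1
  have h1 : ∀ θ : ℝ, ∫⁻ t in Ico (-R) R, ‖stepNu R x (θ, t)‖ₑ ^ p.toReal
      = ENNReal.ofReal ((R - -R) / n) * ∑ j ∈ Finset.range n,
        ‖nu R x (grid R n j) (angle n (cell 0 π n θ))‖ₑ ^ p.toReal := fun θ =>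
    lintegral_cell (by linarith) hn0
      (fun j => ‖nu R x (grid R n j) (angle n (cell 0 π n θ))‖ₑ ^ p.toReal)
  simp_rw [h1]
  rw [lintegral_cell pi_pos hn0 (fun l => ENNReal.ofReal ((R - -R) / n) *
    ∑ j ∈ Finset.range n, ‖nu R x (grid R n j) (angle n l)‖ₑ ^ p.toReal),
    ENNReal.toReal_mul, ENNReal.toReal_mul, ENNReal.toReal_inv,
    ENNReal.toReal_ofReal pi_pos.le, ENNReal.toReal_ofReal (by rw [sub_zero]; positivity),
    ENNReal.toReal_sum]
  · rw [sub_zero, ← mul_assoc, show π⁻¹ * (π / n) = 1 / n by field_simp]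
    congr 1
    refine Finset.sum_congr rfl fun l _ => ?_
    rw [ENNReal.toReal_mul, ENNReal.toReal_ofReal (by rw [sub_neg_eq_add]; positivity),
      ENNReal.toReal_sum (fun j _ => by finiteness)]
    congr 1
    · ring
    · refine Finset.sum_congr rfl fun j _ => ?_
      rw [← ENNReal.toReal_rpow, toReal_enorm]
  · intro l _
    exact ENNReal.mul_ne_top ENNReal.ofReal_ne_top (ENNReal.sum_ne_top.2 fun j _ => by finiteness)

lemma memLp_stepNu (R : ℝ) {n : ℕ} (hn : 0 < n) (p : ℝ≥0∞) (x : Fin n → Fin n → ℝ) :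
    MemLp (stepNu R x) p (sliceMeasure R) := by
  refine MemLp.of_bound (measurable_stepNu R x).aestronglyMeasurable
    (∑ j ∈ Finset.range n, ∑ l ∈ Finset.range n, ‖nu R x (grid R n j) (angle n l)‖) ?_
  filter_upwards [ae_sliceMeasure_mem R] with q hq
  have h1 := Finset.mem_range.2 (cell_lt hn hq.2)
  have h2 := Finset.mem_range.2 (cell_lt hn hq.1)
  exact (Finset.single_le_sum (f := fun l =>
      ‖nu R x (grid R n (cell (-R) R n q.2)) (angle n l)‖) (fun _ _ => norm_nonneg _) h2).trans
    (Finset.single_le_sum (f := fun j => ∑ l ∈ Finset.range n,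
      ‖nu R x (grid R n j) (angle n l)‖)
      (fun _ _ => Finset.sum_nonneg fun _ _ => norm_nonneg _) h1)

lemma norm_nu_le_discreteSV_top (R : ℝ) {n : ℕ} (x : Fin n → Fin n → ℝ) {j l : ℕ} (hj : j < n)
    (hl : l < n) : ‖nu R x (grid R n j) (angle n l)‖ ≤ discreteSV R ∞ x := by
  rw [discreteSV, if_pos rfl]
  exact le_ciSup (f := fun q : Fin n × Fin n => ‖nu R x (grid R n q.1) (angle n q.2)‖)
    (Set.finite_range _).bddAbove (⟨j, hj⟩, ⟨l, hl⟩)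

lemma discreteSV_top_le (R : ℝ) {n : ℕ} (hn : 0 < n) (x : Fin n → Fin n → ℝ) {M : ℝ}
    (hM : ∀ j l, j < n → l < n → ‖nu R x (grid R n j) (angle n l)‖ ≤ M) :
    discreteSV R ∞ x ≤ M := by
  have : Nonempty (Fin n) := ⟨⟨0, hn⟩⟩
  rw [discreteSV, if_pos rfl]
  exact ciSup_le fun q => hM _ _ q.1.2 q.2.2

/-! ### The discretization error -/

lemma abs_toReal_eLpNorm_sub_le {α : Type*} [MeasurableSpace α] {μ : Measure α} {p : ℝ≥0∞}
    (hp : 1 ≤ p) {φ ψ : α → ℂ} (hφ : MemLp φ p μ) (hψ : MemLp ψ p μ) :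
    |(eLpNorm φ p μ).toReal - (eLpNorm ψ p μ).toReal| ≤ (eLpNorm (φ - ψ) p μ).toReal := by
  have : Fact (1 ≤ p) := ⟨hp⟩
  have := abs_norm_sub_norm_le (hφ.toLp φ) (hψ.toLp ψ)
  rwa [← MemLp.toLp_sub, Lp.norm_toLp, Lp.norm_toLp, Lp.norm_toLp] at this

lemma IsBump.exists_norm_stepNu_sub_le {R : ℝ} {d : Plane → ℝ} (hR : 0 < R) (h : IsBump R d)
    (h0 : ∫ p, d p = 0) :
    ∃ C, 0 ≤ C ∧ ∀ n : ℕ, 2 ≤ n → ∀ q : ℝ × ℝ, q.1 ∈ Ico 0 π → q.2 ∈ Ico (-R) R →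
      ‖stepNu R (samples R n d) q - ((cumProj R d (dir q.1) q.2 : ℝ) : ℂ)‖ ≤ C / n := by
  obtain ⟨C, hC, hν⟩ := h.exists_norm_nu_sub_cumProj_le hR h0
  obtain ⟨K, hK, hF⟩ := h.exists_abs_cumProj_sub_le hR h0
  refine ⟨C + K * (2 * π + 2 * R), by positivity, fun n hn q hq1 hq2 => ?_⟩
  have hn0 : 0 < n := by omega
  have hn' : (0 : ℝ) < n := by exact_mod_cast hn0
  have hmem : grid R n (cell (-R) R n q.2) ∈ Icc (-R) R := by
    have hlt : (cell (-R) R n q.2 : ℝ) ≤ n := by exact_mod_cast (cell_lt hn0 hq2).le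
    rw [grid_eq]
    refine ⟨le_add_of_nonneg_right (by rw [sub_neg_eq_add]; positivity), ?_⟩
    calc _ ≤ -R + n * ((R - -R) / n) := by
          have : 0 ≤ (R - -R) / n := by rw [sub_neg_eq_add]; positivity
          gcongr
      _ = R := by field_simp; ring
  have h1 := hν n hn (angle n (cell 0 π n q.1)) _ hmem
  have h2 := hF (dir (angle n (cell 0 π n q.1))) (dir q.1) (norm_dir _) (norm_dir _)
    (grid R n (cell (-R) R n q.2)) q.2
  have h3 := norm_dir_sub_le (angle n (cell 0 π n q.1)) q.1
  have h4 := abs_sub_cell_le hn0 hq1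
  have h5 := abs_sub_cell_le hn0 hq2
  rw [abs_sub_comm, ← angle_eq, sub_zero] at h4
  rw [abs_sub_comm, ← grid_eq] at h5
  have h6 : |cumProj R d (dir (angle n (cell 0 π n q.1))) (grid R n (cell (-R) R n q.2))
      - cumProj R d (dir q.1) q.2| ≤ K * (2 * (π / n) + (R - -R) / n) := by
    refine h2.trans ?_
    gcongr
    linarith
  rw [← Real.norm_eq_abs, ← Complex.norm_real, Complex.ofReal_sub] at h6
  refine (norm_sub_le_norm_sub_add_norm_sub _ _ _).trans ((add_le_add h1 h6).trans_eq ?_)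
  ring

lemma continuous_comp_dir {Φ : UnitCircle × ℝ → ℝ} (hΦ : Continuous Φ) :
    Continuous fun q : ℝ × ℝ => ((Φ (dir q.1, q.2) : ℝ) : ℂ) :=
  Complex.continuous_ofReal.comp
    (hΦ.comp ((continuous_dir.comp continuous_fst).prodMk continuous_snd))

lemma IsBump.continuous_cumProj_dir {R : ℝ} {d : Plane → ℝ} (hR : 0 < R) (h : IsBump R d)
    (h0 : ∫ x, d x = 0) :
    Continuous fun q : ℝ × ℝ => ((cumProj R d (dir q.1) q.2 : ℝ) : ℂ) :=
  continuous_comp_dir (h.continuous_cumProj_prod hR h0)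

lemma toReal_eLpNorm_sliceMeasure_le {R : ℝ} (hR : 0 < R) {p : ℝ≥0∞} (hp : 1 ≤ p) (hp' : p ≠ ∞)
    {φ : ℝ × ℝ → ℂ} {C : ℝ} (hC : 0 ≤ C) (hφ : ∀ᵐ q ∂sliceMeasure R, ‖φ q‖ ≤ C) :
    (eLpNorm φ p (sliceMeasure R)).toReal ≤ max 1 (2 * R) * C := by
  have hpr : 1 ≤ p.toReal := by
    rw [← ENNReal.toReal_one]; exact ENNReal.toReal_mono hp' hp
  have h1 := ENNReal.toReal_mono (by finiteness) (eLpNorm_le_of_ae_bound (p := p) hφ)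
  rw [sliceMeasure_univ, ENNReal.toReal_mul, ENNReal.toReal_ofReal hC, ← ENNReal.toReal_rpow,
    ENNReal.toReal_ofReal (by positivity)] at h1
  refine h1.trans ?_
  gcongr
  calc (2 * R) ^ p.toReal⁻¹ ≤ (max 1 (2 * R)) ^ p.toReal⁻¹ := by gcongr; exact le_max_right _ _
    _ ≤ (max 1 (2 * R)) ^ (1 : ℝ) :=
        rpow_le_rpow_of_exponent_le (le_max_left _ _) (inv_le_one_of_one_le₀ hpr)
    _ = _ := rpow_one _

/-- The discretization error for `p = ∞`, where the limit is a supremum over all directions and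
not an essential supremum: it is compared with the discrete maximum point by point, and opposite
directions reduce it to the angles in `[0, π)`. -/
lemma abs_discreteSV_top_sub_le {R : ℝ} (hR : 0 < R) {f g : Plane → ℝ} (hf : IsBump R f)
    (hg : IsBump R g) (h0 : ∫ x, (f x - g x) = 0) {n : ℕ} (hn : 2 ≤ n) {C : ℝ} (hC : 0 ≤ C)
    (x y w : Fin n → Fin n → ℝ)
    (hxyw : ∀ t θ, nu R x t θ = nu R w t θ + nu R y t θ)
    (hstep : ∀ q : ℝ × ℝ, q.1 ∈ Ico 0 π → q.2 ∈ Ico (-R) R →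
      ‖stepNu R y q - ((cumProj R (fun x => f x - g x) (dir q.1) q.2 : ℝ) : ℂ)‖ ≤ C / n) :
    |discreteSV R ∞ x - (slicedCramer uniformCircle R ∞ f g).toReal|
      ≤ discreteSV R ∞ w + C / n := by
  have hd := hf.sub hg
  set F := cumProj R (fun x => f x - g x) with hF
  have hn0 : 0 < n := by omega
  have hn' : (0 : ℝ) < n := by exact_mod_cast hn0
  have hCn : 0 ≤ C / n := by positivity
  have hfin := slicedCramer_ne_top hR hf hg h0 le_top
  rw [abs_sub_le_iff]
  constructor
  · rw [sub_le_iff_le_add]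
    refine discreteSV_top_le R hn0 x fun j l hj hl => ?_
    have hq1 : angle n l ∈ Ico 0 π := by
      have hl' : (l : ℝ) < n := by exact_mod_cast hl
      refine ⟨by rw [angle]; positivity, ?_⟩
      rw [angle, div_lt_iff₀ hn']
      nlinarith [pi_pos]
    have hq2 : grid R n j ∈ Ico (-R) R := by
      have hj' : (j : ℝ) < n := by exact_mod_cast hj
      refine ⟨by rw [grid]; exact le_add_of_nonneg_right (by positivity), ?_⟩
      have : 2 * R * j / n < 2 * R := by
        rw [div_lt_iff₀ hn']; nlinarith
      rw [grid]; linarith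
    have hc1 : cell (-R) R n (grid R n j) = j := by
      rw [cell_eq_iff (by linarith) hn0 hq2.1, grid_eq]
      refine ⟨le_rfl, ?_⟩
      have : 0 < (R - -R) / n := by rw [sub_neg_eq_add]; positivity
      nlinarith
    have hc2 : cell 0 π n (angle n l) = l := by
      rw [cell_eq_iff pi_pos hn0 hq1.1, angle_eq]
      refine ⟨le_rfl, ?_⟩
      have : 0 < (π - 0) / n := by rw [sub_zero]; positivity
      nlinarith
    have h1 := hstep (angle n l, grid R n j) hq1 hq2
    simp only [stepNu, hc1, hc2] at h1
    have h2 := abs_cumProj_le_slicedCramer_top hf hg h0 hfin (dir (angle n l)) (grid R n j)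
    have h3 := norm_nu_le_discreteSV_top R w hj hl
    have h4 := norm_add_le (nu R w (grid R n j) (angle n l)) (nu R y (grid R n j) (angle n l))
    have h5 := norm_le_norm_sub_add (nu R y (grid R n j) (angle n l))
      ((F (dir (angle n l)) (grid R n j) : ℝ) : ℂ)
    rw [Complex.norm_real, Real.norm_eq_abs] at h5
    rw [hxyw]
    linarith
  · rw [sub_le_iff_le_add]
    have hSV : 0 ≤ discreteSV R ∞ w + C / n + discreteSV R ∞ x :=
      add_nonneg (add_nonneg ((norm_nonneg _).trans (norm_nu_le_discreteSV_top R w hn0 hn0)) hCn)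
        ((norm_nonneg _).trans (norm_nu_le_discreteSV_top R x hn0 hn0))
    have key : ∀ θ ∈ Ico 0 π, ∀ t, |F (dir θ) t|
        ≤ discreteSV R ∞ w + C / n + discreteSV R ∞ x := by
      intro θ hθ t
      by_cases ht : t ∈ Ioo (-R) R
      · have ht' : t ∈ Ico (-R) R := ⟨ht.1.le, ht.2⟩
        have h1 := hstep (θ, t) hθ ht'
        have h2 := norm_nu_le_discreteSV_top R w (cell_lt hn0 ht') (cell_lt hn0 hθ)
        have h3 := norm_nu_le_discreteSV_top R x (cell_lt hn0 ht') (cell_lt hn0 hθ)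
        simp only [stepNu] at h1
        have h4 := hxyw (grid R n (cell (-R) R n t)) (angle n (cell 0 π n θ))
        rw [← sub_eq_iff_eq_add'] at h4
        rw [← h4, norm_sub_rev] at h1
        have h5 := norm_le_norm_sub_add ((F (dir θ) t : ℝ) : ℂ)
          (nu R x (grid R n (cell (-R) R n t)) (angle n (cell 0 π n θ)) -
          nu R w (grid R n (cell (-R) R n t)) (angle n (cell 0 π n θ)))
        have h6 := norm_sub_le (nu R x (grid R n (cell (-R) R n t)) (angle n (cell 0 π n θ)))
          (nu R w (grid R n (cell (-R) R n t)) (angle n (cell 0 π n θ)))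
        rw [Complex.norm_real, Real.norm_eq_abs] at h5
        linarith
      · rw [hF, hd.cumProj_eq_zero h0 (norm_dir θ) ht, abs_zero]
        exact hSV
    refine ENNReal.toReal_le_of_le_ofReal hSV (slicedCramer_top_le hf hg fun u hu t => ?_)
    obtain ⟨θ, hθ, rfl | rfl⟩ := exists_dir_eq hu
    · exact key θ hθ t
    · rw [hd.abs_cumProj_neg h0 (norm_dir θ)]
      exact key θ hθ (-t)

/-- The discretization error for `p < ∞`, by the triangle inequality in `L^p`. -/
lemma abs_discreteSV_sub_le_of_ne_top {R : ℝ} (hR : 0 < R) {f g : Plane → ℝ} (hf : IsBump R f)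
    (hg : IsBump R g) (h0 : ∫ x, (f x - g x) = 0) {n : ℕ} (hn : 2 ≤ n) {C : ℝ} (hC : 0 ≤ C)
    (x y w : Fin n → Fin n → ℝ)
    (hxyw : ∀ t θ, nu R x t θ = nu R w t θ + nu R y t θ)
    (hstep : ∀ q : ℝ × ℝ, q.1 ∈ Ico 0 π → q.2 ∈ Ico (-R) R →
      ‖stepNu R y q - ((cumProj R (fun x => f x - g x) (dir q.1) q.2 : ℝ) : ℂ)‖ ≤ C / n)
    {p : ℝ≥0∞} (hp : 1 ≤ p) (hp' : p ≠ ∞) :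
    |discreteSV R p x - (slicedCramer uniformCircle R p f g).toReal|
      ≤ discreteSV R p w + max 1 (2 * R) * (C / n) := by
  have hd := hf.sub hg
  set F := cumProj R (fun x => f x - g x) with hF
  have hn0 : 0 < n := by omega
  have hn' : (0 : ℝ) < n := by exact_mod_cast hn0
  have hCn : 0 ≤ C / n := by positivity
  obtain ⟨B, hB0, hB⟩ := hd.exists_abs_cumProj_le hR h0
  set Fc : ℝ × ℝ → ℂ := fun q => ((F (dir q.1) q.2 : ℝ) : ℂ) with hFc
  have hFm : Measurable Fc := (hd.continuous_cumProj_dir hR h0).measurable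
  have hFL : MemLp Fc p (sliceMeasure R) :=
    MemLp.of_bound hFm.aestronglyMeasurable B (Eventually.of_forall fun q => by
      rw [hFc, Complex.norm_real]; exact hB _ (norm_dir _) _)
  have hx := memLp_stepNu R hn0 p x
  have hyL := memLp_stepNu R hn0 p y
  have hwL := memLp_stepNu R hn0 p w
  rw [discreteSV_eq_eLpNorm hR hn hp hp' x, discreteSV_eq_eLpNorm hR hn hp hp' w,
    slicedCramer_eq_eLpNorm hR hf hg h0 hp hp']
  refine (abs_toReal_eLpNorm_sub_le hp hx hFL).trans ?_
  have e : stepNu R x - Fc = stepNu R w + (stepNu R y - Fc) := by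
    ext q
    simp only [Pi.sub_apply, Pi.add_apply, stepNu, hxyw]
    ring
  have hb : ∀ᵐ q ∂sliceMeasure R, ‖(stepNu R y - Fc) q‖ ≤ C / n := by
    filter_upwards [ae_sliceMeasure_mem R] with q hq
    exact hstep q hq.1 hq.2
  have hdet := toReal_eLpNorm_sliceMeasure_le hR hp hp' hCn hb
  rw [e]
  refine (ENNReal.toReal_mono ?_ (eLpNorm_add_le hwL.1 (hyL.sub hFL).1 hp)).trans ?_
  · exact ENNReal.add_ne_top.2 ⟨hwL.eLpNorm_ne_top, (hyL.sub hFL).eLpNorm_ne_top⟩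
  · rw [ENNReal.toReal_add hwL.eLpNorm_ne_top (hyL.sub hFL).eLpNorm_ne_top]
    gcongr

/-- The discretization error: the discrete sliced norm of an array differs from the sliced Cramér
distance by at most `O(1/n)`, uniformly in `p`, plus the discrete sliced norm of the difference
between the array and the exact samples. -/
lemma exists_abs_discreteSV_sub_le {R : ℝ} (hR : 0 < R) {f g : Plane → ℝ} (hf : IsBump R f)
    (hg : IsBump R g) (h0 : ∫ x, (f x - g x) = 0) :
    ∃ C, 0 ≤ C ∧ ∀ n : ℕ, 2 ≤ n → ∀ p : ℝ≥0∞, 1 ≤ p → ∀ x : Fin n → Fin n → ℝ,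
      |discreteSV R p x - (slicedCramer uniformCircle R p f g).toReal|
        ≤ discreteSV R p (fun i j => x i j - samples R n (fun z => f z - g z) i j) + C / n := by
  obtain ⟨C, hC, hstep⟩ := (hf.sub hg).exists_norm_stepNu_sub_le hR h0
  refine ⟨max 1 (2 * R) * C, by positivity, fun n hn p hp x => ?_⟩
  have hxyw : ∀ t θ, nu R x t θ
      = nu R (fun i j => x i j - samples R n (fun z => f z - g z) i j) t θ
        + nu R (samples R n (fun z => f z - g z)) t θ := by
    intro t θ
    rw [← nu_add hR hn]
    simp
  rw [mul_div_assoc]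
  by_cases hp' : p = ∞
  · subst hp'
    refine (abs_discreteSV_top_sub_le hR hf hg h0 hn hC x _ _ hxyw (hstep n hn)).trans ?_
    gcongr
    exact le_mul_of_one_le_left (by positivity) (le_max_left _ _)
  · exact abs_discreteSV_sub_le_of_ne_top hR hf hg h0 hn hC x _ _ hxyw (hstep n hn) hp hp'

/-! ### Comparison of the discrete norms -/

/-- The mean over the grid of the squares of the values of `ν_x`. -/
def meanSq (R : ℝ) {n : ℕ} (x : Fin n → Fin n → ℝ) : ℝ :=
  ∑ q ∈ Finset.range n ×ˢ Finset.range n,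
    1 / (n : ℝ) ^ 2 * ‖nu R x (grid R n q.2) (angle n q.1)‖ ^ 2

lemma meanSq_nonneg (R : ℝ) {n : ℕ} (x : Fin n → Fin n → ℝ) : 0 ≤ meanSq R x :=
  Finset.sum_nonneg fun _ _ => by positivity

lemma sum_weights {n : ℕ} (hn : 0 < n) :
    ∑ _q ∈ Finset.range n ×ˢ Finset.range n, 1 / (n : ℝ) ^ 2 = 1 := by
  have hn' : (0 : ℝ) < n := by exact_mod_cast hn
  rw [Finset.sum_const, Finset.card_product, Finset.card_range, nsmul_eq_mul]
  push_cast
  field_simp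

lemma discreteSV_top_nonneg (R : ℝ) {n : ℕ} (hn : 0 < n) (x : Fin n → Fin n → ℝ) :
    0 ≤ discreteSV R ∞ x :=
  (norm_nonneg _).trans (norm_nu_le_discreteSV_top R x hn hn)

/-- The discrete norm in terms of the `p`-th power mean over the grid. -/
lemma discreteSV_le_powerMean {R : ℝ} (hR : 0 < R) {n : ℕ} (hn : 2 ≤ n) {p : ℝ≥0∞} (hp : 1 ≤ p)
    (hp' : p ≠ ∞) (x : Fin n → Fin n → ℝ) :
    discreteSV R p x ≤ max 1 (2 * R) * (∑ q ∈ Finset.range n ×ˢ Finset.range n,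
      1 / (n : ℝ) ^ 2 * ‖nu R x (grid R n q.2) (angle n q.1)‖ ^ p.toReal) ^ (1 / p.toReal) := by
  have hpr : 1 ≤ p.toReal := by
    rw [← ENNReal.toReal_one]; exact ENNReal.toReal_mono hp' hp
  have e : 1 / (n : ℝ) * ∑ l ∈ Finset.range n, 2 * R / (n : ℝ) *
      ∑ j ∈ Finset.range n, ‖nu R x (grid R n j) (angle n l)‖ ^ p.toReal
      = 2 * R * ∑ q ∈ Finset.range n ×ˢ Finset.range n,
      1 / (n : ℝ) ^ 2 * ‖nu R x (grid R n q.2) (angle n q.1)‖ ^ p.toReal := by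
    rw [Finset.sum_product, Finset.mul_sum, Finset.mul_sum]
    refine Finset.sum_congr rfl fun l _ => ?_
    rw [← Finset.mul_sum]
    ring
  have hs : 0 ≤ ∑ q ∈ Finset.range n ×ˢ Finset.range n,
      1 / (n : ℝ) ^ 2 * ‖nu R x (grid R n q.2) (angle n q.1)‖ ^ p.toReal :=
    Finset.sum_nonneg fun _ _ => by positivity
  rw [discreteSV_eq_sum hR hn hp hp', e, mul_rpow (by positivity) hs]
  gcongr
  calc (2 * R) ^ (1 / p.toReal) ≤ (max 1 (2 * R)) ^ (1 / p.toReal) := by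
        gcongr; exact le_max_right _ _
    _ ≤ (max 1 (2 * R)) ^ (1 : ℝ) :=
        rpow_le_rpow_of_exponent_le (le_max_left _ _)
          (by rw [div_le_one (by linarith)]; exact hpr)
    _ = _ := rpow_one _

/-- Power means increase with the exponent. -/
lemma discreteSV_le_sqrt_meanSq {R : ℝ} (hR : 0 < R) {n : ℕ} (hn : 2 ≤ n) {p : ℝ≥0∞} (hp : 1 ≤ p)
    (hp2 : p ≤ 2) (x : Fin n → Fin n → ℝ) :
    discreteSV R p x ≤ max 1 (2 * R) * √(meanSq R x) := by
  have hp' : p ≠ ∞ := ne_top_of_le_ne_top (by norm_num) hp2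
  have hpr : 1 ≤ p.toReal := by
    rw [← ENNReal.toReal_one]; exact ENNReal.toReal_mono hp' hp
  have hpr2 : p.toReal ≤ 2 := by
    rw [← ENNReal.toReal_ofNat 2]; exact ENNReal.toReal_mono (by norm_num) hp2
  have hr0 : 0 < p.toReal := by linarith
  refine (discreteSV_le_powerMean hR hn hp hp' x).trans ?_
  gcongr
  set S := ∑ q ∈ Finset.range n ×ˢ Finset.range n,
      1 / (n : ℝ) ^ 2 * ‖nu R x (grid R n q.2) (angle n q.1)‖ ^ p.toReal with hS
  have hS0 : 0 ≤ S := Finset.sum_nonneg fun _ _ => by positivity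
  have key := rpow_arith_mean_le_arith_mean_rpow (Finset.range n ×ˢ Finset.range n)
    (fun _ => 1 / (n : ℝ) ^ 2) (fun q => ‖nu R x (grid R n q.2) (angle n q.1)‖ ^ p.toReal)
    (fun _ _ => by positivity) (sum_weights (by omega)) (fun _ _ => by positivity)
    (p := 2 / p.toReal) (by rw [le_div_iff₀ hr0]; linarith)
  have e : ∀ a : ℝ, 0 ≤ a → (a ^ p.toReal) ^ (2 / p.toReal) = a ^ 2 := by
    intro a ha
    rw [← rpow_mul ha, mul_div_cancel₀ _ hr0.ne', rpow_two]
  simp only [e _ (norm_nonneg _)] at key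
  refine Real.le_sqrt_of_sq_le ?_
  rw [← rpow_two, ← rpow_mul hS0, one_div_mul_eq_div]
  exact key

/-- Interpolation between the mean square and the maximum. -/
lemma discreteSV_le_interpolation {R : ℝ} (hR : 0 < R) {n : ℕ} (hn : 2 ≤ n) {p : ℝ≥0∞}
    (hp2 : 2 ≤ p) (x : Fin n → Fin n → ℝ) :
    discreteSV R p x ≤ max 1 (2 * R) *
      (√(meanSq R x) ^ (2 * (1 / p).toReal) * discreteSV R ∞ x ^ (1 - 2 * (1 / p).toReal)) := by
  have hM0 := discreteSV_top_nonneg R (by omega : 0 < n) x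
  by_cases hp' : p = ∞
  · subst hp'
    simp only [ENNReal.div_top, ENNReal.toReal_zero, mul_zero, rpow_zero, sub_zero, rpow_one,
      one_mul]
    exact le_mul_of_one_le_left hM0 (le_max_left _ _)
  have hp : 1 ≤ p := le_trans (by norm_num) hp2
  have hpr2 : 2 ≤ p.toReal := by
    rw [← ENNReal.toReal_ofNat 2]; exact ENNReal.toReal_mono hp' hp2
  have hr0 : 0 < p.toReal := by linarith
  refine (discreteSV_le_powerMean hR hn hp hp' x).trans ?_
  gcongr
  have h1 : ∑ q ∈ Finset.range n ×ˢ Finset.range n,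
      1 / (n : ℝ) ^ 2 * ‖nu R x (grid R n q.2) (angle n q.1)‖ ^ p.toReal
      ≤ meanSq R x * discreteSV R ∞ x ^ (p.toReal - 2) := by
    rw [meanSq, Finset.sum_mul]
    refine Finset.sum_le_sum fun q hq => ?_
    rw [Finset.mem_product, Finset.mem_range, Finset.mem_range] at hq
    have hle := norm_nu_le_discreteSV_top R x hq.2 hq.1
    have e : ‖nu R x (grid R n q.2) (angle n q.1)‖ ^ p.toReal
        = ‖nu R x (grid R n q.2) (angle n q.1)‖ ^ 2
          * ‖nu R x (grid R n q.2) (angle n q.1)‖ ^ (p.toReal - 2) := by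
      rw [← rpow_two, ← rpow_add_of_nonneg (norm_nonneg _) (by norm_num) (by linarith)]
      congr 1; ring
    rw [e, ← mul_assoc]
    gcongr
  have hQ := meanSq_nonneg R x
  refine (rpow_le_rpow (Finset.sum_nonneg fun _ _ => by positivity) h1 (by positivity)).trans_eq ?_
  rw [mul_rpow hQ (by positivity), ← rpow_mul hM0]
  congr 1
  · rw [sqrt_eq_rpow, ← rpow_mul hQ, ENNReal.toReal_div, ENNReal.toReal_one]
    congr 1; ring
  · rw [ENNReal.toReal_div, ENNReal.toReal_one]
    congr 1; field_simp

lemma meanSq_le_sq_top (R : ℝ) {n : ℕ} (hn : 0 < n) (x : Fin n → Fin n → ℝ) :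
    meanSq R x ≤ discreteSV R ∞ x ^ 2 := by
  calc meanSq R x ≤ ∑ _q ∈ Finset.range n ×ˢ Finset.range n,
        1 / (n : ℝ) ^ 2 * discreteSV R ∞ x ^ 2 := by
        refine Finset.sum_le_sum fun q hq => ?_
        rw [Finset.mem_product, Finset.mem_range, Finset.mem_range] at hq
        have := norm_nu_le_discreteSV_top R x hq.2 hq.1
        gcongr
    _ = _ := by rw [← Finset.sum_mul, sum_weights hn, one_mul]

lemma discreteSV_le_top {R : ℝ} (hR : 0 < R) {n : ℕ} (hn : 2 ≤ n) {p : ℝ≥0∞} (hp : 1 ≤ p)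
    (x : Fin n → Fin n → ℝ) : discreteSV R p x ≤ max 1 (2 * R) * discreteSV R ∞ x := by
  have hM0 := discreteSV_top_nonneg R (by omega : 0 < n) x
  have hs : √(meanSq R x) ≤ discreteSV R ∞ x :=
    Real.sqrt_le_iff.2 ⟨hM0, meanSq_le_sq_top R (by omega) x⟩
  rcases le_total p 2 with hp2 | hp2
  · refine (discreteSV_le_sqrt_meanSq hR hn hp hp2 x).trans ?_
    gcongr
  · refine (discreteSV_le_interpolation hR hn hp2 x).trans ?_
    have h1 : 2 * (1 / p).toReal ≤ 1 := by
      have : (1 / p).toReal ≤ (1 / 2 : ℝ≥0∞).toReal :=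
        ENNReal.toReal_mono (by norm_num) (by gcongr)
      have h12 : (1 / 2 : ℝ≥0∞).toReal = 1 / 2 := by simp
      linarith
    gcongr
    calc √(meanSq R x) ^ (2 * (1 / p).toReal) * discreteSV R ∞ x ^ (1 - 2 * (1 / p).toReal)
        ≤ discreteSV R ∞ x ^ (2 * (1 / p).toReal)
          * discreteSV R ∞ x ^ (1 - 2 * (1 / p).toReal) := by gcongr
      _ = discreteSV R ∞ x := by
          rw [← rpow_add_of_nonneg hM0 (by positivity) (by linarith), add_sub_cancel, rpow_one]

lemma discreteSV_nonneg {R : ℝ} (hR : 0 < R) {n : ℕ} (hn : 2 ≤ n) {p : ℝ≥0∞} (hp : 1 ≤ p)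
    (x : Fin n → Fin n → ℝ) : 0 ≤ discreteSV R p x := by
  by_cases hp' : p = ∞
  · subst hp'; exact discreteSV_top_nonneg R (by omega) x
  · rw [discreteSV_eq_eLpNorm hR hn hp hp']; exact ENNReal.toReal_nonneg

lemma measurable_norm_nu {R : ℝ} (hR : 0 < R) {n : ℕ} (hn : 2 ≤ n) (t θ : ℝ) :
    Measurable fun x : Fin n → Fin n → ℝ => ‖nu R x t θ‖ := by
  simp_rw [nu_eq_kernel hR hn, Complex.norm_real]
  fun_prop

lemma measurable_discreteSV {R : ℝ} (hR : 0 < R) {n : ℕ} (hn : 2 ≤ n) (p : ℝ≥0∞) :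
    Measurable fun x : Fin n → Fin n → ℝ => discreteSV R p x := by
  by_cases hp' : p = ∞
  · subst hp'
    simp only [discreteSV, if_true]
    exact Measurable.iSup fun q => measurable_norm_nu hR hn _ _
  · simp only [discreteSV, if_neg hp']
    refine Measurable.pow_const (measurable_const.mul ?_) _
    refine Finset.measurable_sum _ fun l _ => measurable_const.mul ?_
    exact Finset.measurable_sum _ fun j _ => (measurable_norm_nu hR hn _ _).pow_const _

lemma measurable_meanSq {R : ℝ} (hR : 0 < R) {n : ℕ} (hn : 2 ≤ n) :
    Measurable fun x : Fin n → Fin n → ℝ => meanSq R x :=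
  Finset.measurable_sum _ fun _ _ =>
    measurable_const.mul ((measurable_norm_nu hR hn _ _).pow_const _)

/-! ### Gaussian exponential moments -/

/-- Linear combinations of independent centered Gaussians. -/
lemma hasLaw_sum_mul_gaussian {Ω ι : Type*} [MeasurableSpace Ω] {P : Measure Ω}
    [IsProbabilityMeasure P] {X : ι → Ω → ℝ} {v : ι → ℝ≥0}
    (hX : ∀ i, HasLaw (X i) (gaussianReal 0 (v i)) P) (hind : iIndepFun X P) (c : ι → ℝ)
    (T : Finset ι) :
    HasLaw (fun ω => ∑ i ∈ T, c i * X i ω)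
      (gaussianReal 0 (∑ i ∈ T, NNReal.mk (c i ^ 2) (sq_nonneg _) * v i)) P := by
  classical
  have hY : ∀ i, HasLaw (fun ω => c i * X i ω)
      (gaussianReal 0 (NNReal.mk (c i ^ 2) (sq_nonneg _) * v i)) P := by
    intro i
    simpa using gaussianReal_const_mul (hX i) (c i)
  have hindY : iIndepFun (fun i ω => c i * X i ω) P :=
    hind.comp (fun i x => c i * x) fun i => by fun_prop
  induction T using Finset.induction_on with
  | empty =>
    simp only [Finset.sum_empty, gaussianReal_zero_var]
    exact ⟨aemeasurable_const, by rw [Measure.map_const]; simp⟩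
  | insert i T hi ih =>
    have hI := (hindY.indepFun_finsetSum_of_notMem₀ (fun i => (hY i).aemeasurable) hi).symm
    have hsum : (∑ j ∈ T, fun ω => c j * X j ω) = fun ω => ∑ j ∈ T, c j * X j ω := by
      ext ω; simp
    rw [hsum] at hI
    have h := gaussianReal_add_gaussianReal_of_indepFun hI (hY i).map_eq ih.map_eq
    rw [add_zero] at h
    have e : (fun ω => ∑ j ∈ insert i T, c j * X j ω)
        = (fun ω => c i * X i ω) + fun ω => ∑ j ∈ T, c j * X j ω := by
      ext ω; simp [Finset.sum_insert hi]
    rw [Finset.sum_insert hi, e]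
    exact ⟨(hY i).aemeasurable.add ih.aemeasurable, h⟩

/-- A centered Gaussian of variance at most `V` has a bounded exponential square moment. -/
lemma integral_exp_sq_gaussianReal_le {v : ℝ≥0} {V : ℝ} (hV : 0 < V) (hv : (v : ℝ) ≤ V) :
    Integrable (fun x => exp (x ^ 2 / (4 * V))) (gaussianReal 0 v) ∧
      ∫ x, exp (x ^ 2 / (4 * V)) ∂(gaussianReal 0 v) ≤ 2 := by
  -- the Gaussian of variance zero is a Dirac mass and has no density
  by_cases hv0 : v = 0
  · subst hv0
    rw [gaussianReal_zero_var]
    exact ⟨integrable_dirac (by finiteness), by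
      rw [integral_dirac]; norm_num⟩
  have hvpos : (0 : ℝ) < v := by
    exact_mod_cast pos_iff_ne_zero.2 hv0
  set b : ℝ := 1 / (2 * v) - 1 / (4 * V) with hb
  have hb4 : 1 / (4 * v) ≤ b := by
    have h1 : 1 / (4 * V) ≤ 1 / (4 * (v : ℝ)) := by gcongr
    have h2 : 1 / (2 * (v : ℝ)) = 1 / (4 * v) + 1 / (4 * v) := by field_simp; norm_num
    linarith
  have hb0 : 0 < b := lt_of_lt_of_le (by positivity) hb4
  have hdens : ∀ x : ℝ, gaussianPDFReal 0 v x * exp (x ^ 2 / (4 * V))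
      = (√(2 * π * v))⁻¹ * exp (-b * x ^ 2) := by
    intro x
    rw [gaussianPDFReal, mul_assoc, ← exp_add, hb]
    congr 2
    field_simp
    ring
  constructor
  · rw [gaussianReal_of_var_ne_zero _ hv0, integrable_withDensity_iff_integrable_smul'
      (measurable_gaussianPDF 0 v) (ae_of_all _ fun _ => gaussianPDF_lt_top)]
    simp only [toReal_gaussianPDF, smul_eq_mul, hdens]
    exact (integrable_exp_neg_mul_sq hb0).const_mul _
  · rw [integral_gaussianReal_eq_integral_smul hv0]
    simp only [smul_eq_mul, hdens]
    rw [integral_const_mul, integral_gaussian, ← sqrt_inv, ← sqrt_mul (by positivity)]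
    have h1 : (2 * π * v)⁻¹ * (π / b) ≤ 2 ^ 2 := by
      have h2 : π / b ≤ π / (1 / (4 * v)) := by gcongr
      calc (2 * π * v)⁻¹ * (π / b) ≤ (2 * π * v)⁻¹ * (π / (1 / (4 * v))) := by gcongr
        _ = 2 := by field_simp; norm_num
        _ ≤ 2 ^ 2 := by norm_num
    exact Real.sqrt_le_iff.2 ⟨by norm_num, h1⟩

/-! ### The discrete norms of the noise -/

/-- The difference of the two noise arrays. -/
def noiseArray {Ω : Type*} (Z Z' : ℕ → ℕ → Ω → ℝ) (n : ℕ) (ω : Ω) : Fin n → Fin n → ℝ :=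
  fun i j => Z i j ω - Z' i j ω

/-- The scale of the values of `ν` on noise: their variances are at most `noiseVar R n σ`. -/
def noiseVar (R : ℝ) (n : ℕ) (σ : ℝ) : ℝ := (32 * R ^ 2 / π) ^ 2 * σ ^ 2 / n ^ 2

section Noise

variable {Ω : Type*} [MeasurableSpace Ω] {P : Measure Ω} {Z Z' : ℕ → ℕ → Ω → ℝ}
  {s s' : ℕ → ℕ → ℝ≥0} {σ : ℝ}

lemma IsNoise.mono (h : IsNoise P Z Z' s s' σ) {τ : ℝ} (hσ : 0 ≤ σ) (hτ : σ ≤ τ) :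
    IsNoise P Z Z' s s' τ where
  law := h.law
  law' := h.law'
  indep := h.indep
  bound n hn he := (h.bound n hn he).trans (by gcongr)

lemma IsNoise.aemeasurable_noiseArray (h : IsNoise P Z Z' s s' σ) (n : ℕ) :
    AEMeasurable (noiseArray Z Z' n) P := by
  refine aemeasurable_pi_lambda _ fun i => aemeasurable_pi_lambda _ fun j => ?_
  exact (h.law i j).aemeasurable.sub (h.law' i j).aemeasurable

variable [IsProbabilityMeasure P]

/-- The values of `ν` on noise are centered Gaussians with variance at most `noiseVar R n σ`: the
weights of the entries are `O(n⁻²)`. -/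
lemma IsNoise.exists_hasLaw_nu {R : ℝ} (hR : 0 < R) (h : IsNoise P Z Z' s s' σ) {n : ℕ}
    (hn : 2 ≤ n) (he : Even n) (t θ : ℝ) :
    ∃ (X : Ω → ℝ) (v : ℝ≥0), HasLaw X (gaussianReal 0 v) P ∧ (v : ℝ) ≤ noiseVar R n σ ∧
      ∀ ω, nu R (noiseArray Z Z' n ω) t θ = ((X ω : ℝ) : ℂ) := by
  have hn' : (0 : ℝ) < n := by positivity
  set κ : ℝ := 32 * R ^ 2 / (π * n ^ 2) with hκ
  set K : ℕ → ℕ → ℝ := fun i j => nuKernel R n t (grid R n i * cos θ + grid R n j * sin θ) with hK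
  have hKle : ∀ i j, K i j ^ 2 ≤ κ ^ 2 := fun i j =>
    sq_le_sq' (neg_le_of_abs_le (abs_nuKernel_le R n t _)) (le_of_abs_le (abs_nuKernel_le R n t _))
  set c : (ℕ × ℕ) ⊕ (ℕ × ℕ) → ℝ :=
    Sum.elim (fun a => K a.1 a.2) (fun a => -K a.1 a.2) with hc
  set v : (ℕ × ℕ) ⊕ (ℕ × ℕ) → ℝ≥0 :=
    Sum.elim (fun a => s a.1 a.2 ^ 2) (fun a => s' a.1 a.2 ^ 2) with hv
  set I := Finset.range n ×ˢ Finset.range n with hI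
  have hlaw := hasLaw_sum_mul_gaussian
    (X := fun q : (ℕ × ℕ) ⊕ (ℕ × ℕ) =>
      Sum.elim (fun a => Z a.1 a.2) (fun a => Z' a.1 a.2) q) (v := v)
    (fun q => by
      rcases q with a | a
      · exact h.law a.1 a.2
      · exact h.law' a.1 a.2) h.indep c (I.disjSum I)
  refine ⟨_, _, hlaw, ?_, fun ω => ?_⟩
  · have hb := h.bound n hn he
    have hsum : ∀ r : ℕ → ℕ → ℝ≥0, ∑ a ∈ I, K a.1 a.2 ^ 2 * (r a.1 a.2 : ℝ) ^ 2
        ≤ κ ^ 2 * ∑ k ∈ Finset.range n, ∑ j ∈ Finset.range n, (r j k : ℝ) ^ 2 := by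
      intro r
      rw [Finset.sum_comm, ← Finset.sum_product', Finset.mul_sum]
      refine Finset.sum_le_sum fun a _ => ?_
      exact mul_le_mul_of_nonneg_right (hKle _ _) (by positivity)
    have h1 := hsum s
    have h2 := hsum s'
    push_cast
    rw [Finset.sum_disjSum]
    simp only [hc, hv, Sum.elim_inl, Sum.elim_inr, neg_sq, NNReal.coe_pow]
    rw [← mul_add, one_div_mul_eq_div, div_le_iff₀ (by positivity)] at hb
    have e : noiseVar R n σ = κ ^ 2 * (σ ^ 2 * n ^ 2) := by
      rw [noiseVar, hκ]; field_simp
    rw [e]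
    refine (add_le_add h1 h2).trans ?_
    rw [← mul_add]
    gcongr
  · rw [nu_eq_kernel hR hn]
    congr 1
    rw [Finset.sum_disjSum]
    simp only [hc, Sum.elim_inl, Sum.elim_inr, neg_mul]
    rw [← Finset.sum_add_distrib, Finset.sum_product,
      Finset.sum_range (fun i => ∑ j ∈ Finset.range n, _)]
    refine Finset.sum_congr rfl fun i _ => ?_
    rw [Finset.sum_range]
    refine Finset.sum_congr rfl fun j _ => ?_
    simp only [hK, noiseArray]
    ring

lemma noiseVar_pos {R : ℝ} (hR : 0 < R) {n : ℕ} (hn : 0 < n) (hσ : 0 < σ) :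
    0 < noiseVar R n σ := by
  have hn' : (0 : ℝ) < n := by exact_mod_cast hn
  have := pi_pos
  rw [noiseVar]; positivity

lemma IsNoise.integral_exp_nu_le {R : ℝ} (hR : 0 < R) (hσ : 0 < σ) (h : IsNoise P Z Z' s s' σ)
    {n : ℕ} (hn : 2 ≤ n) (he : Even n) (t θ : ℝ) :
    Integrable (fun ω => exp (‖nu R (noiseArray Z Z' n ω) t θ‖ ^ 2 / (4 * noiseVar R n σ))) P ∧
      ∫ ω, exp (‖nu R (noiseArray Z Z' n ω) t θ‖ ^ 2 / (4 * noiseVar R n σ)) ∂P ≤ 2 := by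
  obtain ⟨X, v, hX, hv, hν⟩ := h.exists_hasLaw_nu hR hn he t θ
  obtain ⟨h1, h2⟩ := integral_exp_sq_gaussianReal_le (noiseVar_pos hR (by omega : 0 < n) hσ) hv
  simp only [hν, Complex.norm_real, Real.norm_eq_abs, sq_abs]
  rw [← hX.map_eq] at h1 h2
  refine ⟨h1.comp_aemeasurable hX.aemeasurable, ?_⟩
  rwa [integral_map hX.aemeasurable h1.aestronglyMeasurable] at h2

/-- By convexity of the exponential function, the mean square of the noise has a bounded
exponential moment, without any loss in `n`. -/
lemma IsNoise.integral_exp_meanSq_le {R : ℝ} (hR : 0 < R) (hσ : 0 < σ)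
    (h : IsNoise P Z Z' s s' σ) {n : ℕ} (hn : 2 ≤ n) (he : Even n) :
    Integrable (fun ω => exp (meanSq R (noiseArray Z Z' n ω) / (4 * noiseVar R n σ))) P ∧
      ∫ ω, exp (meanSq R (noiseArray Z Z' n ω) / (4 * noiseVar R n σ)) ∂P ≤ 2 := by
  have hV := noiseVar_pos hR (by omega : 0 < n) hσ
  have hle : ∀ ω, exp (meanSq R (noiseArray Z Z' n ω) / (4 * noiseVar R n σ))
      ≤ ∑ q ∈ Finset.range n ×ˢ Finset.range n, 1 / (n : ℝ) ^ 2 *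
        exp (‖nu R (noiseArray Z Z' n ω) (grid R n q.2) (angle n q.1)‖ ^ 2
          / (4 * noiseVar R n σ)) := by
    intro ω
    have := convexOn_exp.map_sum_le (t := Finset.range n ×ˢ Finset.range n)
      (w := fun _ => 1 / (n : ℝ) ^ 2)
      (p := fun q => ‖nu R (noiseArray Z Z' n ω) (grid R n q.2) (angle n q.1)‖ ^ 2
          / (4 * noiseVar R n σ)) (fun _ _ => by positivity) (sum_weights (by omega))
      (fun _ _ => mem_univ _)
    simp only [smul_eq_mul] at this
    refine le_of_eq_of_le ?_ this
    rw [meanSq, Finset.sum_div]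
    congr 1
    exact Finset.sum_congr rfl fun _ _ => by ring
  have hint : Integrable (fun ω => ∑ q ∈ Finset.range n ×ˢ Finset.range n, 1 / (n : ℝ) ^ 2 *
        exp (‖nu R (noiseArray Z Z' n ω) (grid R n q.2) (angle n q.1)‖ ^ 2
          / (4 * noiseVar R n σ))) P :=
    integrable_finsetSum _ fun q _ => (h.integral_exp_nu_le hR hσ hn he _ _).1.const_mul _
  have hm : AEMeasurable (fun ω =>
      exp (meanSq R (noiseArray Z Z' n ω) / (4 * noiseVar R n σ))) P :=
    (((measurable_meanSq hR hn).comp_aemeasurable (h.aemeasurable_noiseArray n)).div_const _).exp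
  have hi := hint.mono' hm.aestronglyMeasurable (Eventually.of_forall fun ω => by
    rw [Real.norm_of_nonneg (exp_pos _).le]; exact hle ω)
  refine ⟨hi, (integral_mono hi hint hle).trans ?_⟩
  rw [integral_finsetSum _ fun q _ => (h.integral_exp_nu_le hR hσ hn he _ _).1.const_mul _]
  calc _ ≤ ∑ _q ∈ Finset.range n ×ˢ Finset.range n, 1 / (n : ℝ) ^ 2 * 2 := by
        refine Finset.sum_le_sum fun q _ => ?_
        rw [integral_const_mul]
        gcongr
        exact (h.integral_exp_nu_le hR hσ hn he _ _).2
    _ = 2 := by rw [← Finset.sum_mul, sum_weights (by omega), one_mul]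

lemma exists_discreteSV_top_eq (R : ℝ) {n : ℕ} (hn : 0 < n) (x : Fin n → Fin n → ℝ) :
    ∃ j l, j < n ∧ l < n ∧ discreteSV R ∞ x = ‖nu R x (grid R n j) (angle n l)‖ := by
  have : Nonempty (Fin n) := ⟨⟨0, hn⟩⟩
  obtain ⟨q, hq⟩ := exists_eq_ciSup_of_finite
    (f := fun q : Fin n × Fin n => ‖nu R x (grid R n q.1) (angle n q.2)‖)
  exact ⟨q.1, q.2, q.1.2, q.2.2, by rw [discreteSV, if_pos rfl, ← hq]⟩

lemma le_sum_range_product {G : ℕ → ℕ → ℝ} (hG : ∀ i j, 0 ≤ G i j) {n i j : ℕ} (hi : i < n)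
    (hj : j < n) : G i j ≤ ∑ q ∈ Finset.range n ×ˢ Finset.range n, G q.1 q.2 :=
  Finset.single_le_sum (f := fun q : ℕ × ℕ => G q.1 q.2) (a := (i, j)) (fun _ _ => hG _ _)
    (Finset.mem_product.2 ⟨Finset.mem_range.2 hi, Finset.mem_range.2 hj⟩)

/-- The exponential moment of the maximum of the noise over the grid, by a union bound. -/
lemma IsNoise.integral_exp_top_le {R : ℝ} (hR : 0 < R) (hσ : 0 < σ)
    (h : IsNoise P Z Z' s s' σ) {n : ℕ} (hn : 2 ≤ n) (he : Even n) :
    Integrable (fun ω =>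
      exp (discreteSV R ∞ (noiseArray Z Z' n ω) ^ 2 / (4 * noiseVar R n σ))) P ∧
      ∫ ω, exp (discreteSV R ∞ (noiseArray Z Z' n ω) ^ 2 / (4 * noiseVar R n σ)) ∂P
        ≤ 2 * n ^ 2 := by
  have hle : ∀ ω, exp (discreteSV R ∞ (noiseArray Z Z' n ω) ^ 2 / (4 * noiseVar R n σ))
      ≤ ∑ q ∈ Finset.range n ×ˢ Finset.range n,
        exp (‖nu R (noiseArray Z Z' n ω) (grid R n q.2) (angle n q.1)‖ ^ 2
          / (4 * noiseVar R n σ)) := by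
    intro ω
    obtain ⟨j, l, hj, hl, e⟩ := exists_discreteSV_top_eq R (by omega : 0 < n) (noiseArray Z Z' n ω)
    rw [e]
    exact le_sum_range_product (G := fun l j =>
      exp (‖nu R (noiseArray Z Z' n ω) (grid R n j) (angle n l)‖ ^ 2
        / (4 * noiseVar R n σ))) (fun _ _ => (exp_pos _).le) hl hj
  have hint : Integrable (fun ω => ∑ q ∈ Finset.range n ×ˢ Finset.range n,
        exp (‖nu R (noiseArray Z Z' n ω) (grid R n q.2) (angle n q.1)‖ ^ 2
          / (4 * noiseVar R n σ))) P :=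
    integrable_finsetSum _ fun q _ => (h.integral_exp_nu_le hR hσ hn he _ _).1
  have hm : AEMeasurable (fun ω =>
      exp (discreteSV R ∞ (noiseArray Z Z' n ω) ^ 2 / (4 * noiseVar R n σ))) P :=
    ((((measurable_discreteSV hR hn ∞).comp_aemeasurable
      (h.aemeasurable_noiseArray n)).pow_const 2).div_const _).exp
  have hi := hint.mono' hm.aestronglyMeasurable (Eventually.of_forall fun ω => by
    rw [Real.norm_of_nonneg (exp_pos _).le]; exact hle ω)
  refine ⟨hi, (integral_mono hi hint hle).trans ?_⟩
  rw [integral_finsetSum _ fun q _ => (h.integral_exp_nu_le hR hσ hn he _ _).1]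
  calc _ ≤ ∑ _q ∈ Finset.range n ×ˢ Finset.range n, (2 : ℝ) :=
        Finset.sum_le_sum fun q _ => (h.integral_exp_nu_le hR hσ hn he _ _).2
    _ = 2 * n ^ 2 := by
        rw [Finset.sum_const, Finset.card_product, Finset.card_range, nsmul_eq_mul]
        push_cast; ring

/-! ### Tails and means of the noise -/

/-- An exponential square moment bounds the tail of a nonnegative random variable. -/
lemma measureReal_le_of_exp_moment {Y : Ω → ℝ} {V c K τ : ℝ} (hV : 0 < V) (hc : 0 < c)
    (hτ : 0 ≤ τ) (hY : ∀ ω, 0 ≤ Y ω) (hint : Integrable (fun ω => exp (Y ω / (4 * V))) P)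
    (hle : ∫ ω, exp (Y ω / (4 * V)) ∂P ≤ K) {A : Set Ω} (hA : ∀ ω ∈ A, τ ≤ c * √(Y ω)) :
    P.real A ≤ K * exp (-(τ ^ 2 / (4 * V * c ^ 2))) := by
  have hsub : A ⊆ {ω | exp (τ ^ 2 / (4 * V * c ^ 2)) ≤ exp (Y ω / (4 * V))} := by
    intro ω hω
    have h2 : τ ^ 2 ≤ c ^ 2 * Y ω := by
      have := pow_le_pow_left₀ hτ (hA ω hω) 2
      rwa [mul_pow, Real.sq_sqrt (hY ω)] at this
    refine exp_le_exp.2 ?_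
    rw [div_le_div_iff₀ (by positivity) (by positivity)]
    nlinarith
  have hmk := mul_meas_ge_le_integral_of_nonneg
    (Eventually.of_forall fun ω => (exp_pos (Y ω / (4 * V))).le) hint
    (exp (τ ^ 2 / (4 * V * c ^ 2)))
  rw [exp_neg, ← div_eq_mul_inv, le_div_iff₀ (exp_pos _), mul_comm]
  exact (mul_le_mul_of_nonneg_left (measureReal_mono hsub (measure_ne_top _ _))
    (exp_pos _).le).trans (hmk.trans hle)

end Noise

/-- Jensen's inequality for the exponential function: the mean is at most the logarithm of the
exponential moment. -/
lemma integral_le_of_exp_moment {Ω : Type*} [MeasurableSpace Ω] {P : Measure Ω}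
    [IsProbabilityMeasure P] {Y : Ω → ℝ} {a K : ℝ} (ha : 0 < a) (hK : 0 < K)
    (hY : ∀ ω, 0 ≤ Y ω) (hm : AEMeasurable Y P)
    (hint : Integrable (fun ω => exp (Y ω / a)) P) (hle : ∫ ω, exp (Y ω / a) ∂P ≤ K) :
    Integrable Y P ∧ ∫ ω, Y ω ∂P ≤ a * log K := by
  have h1 : ∀ ω, Y ω ≤ a * exp (Y ω / a) := fun ω => by
    have h2 : Y ω / a ≤ exp (Y ω / a) := by linarith [add_one_le_exp (Y ω / a)]
    rwa [div_le_iff₀ ha, mul_comm] at h2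
  have hi : Integrable Y P := (hint.const_mul a).mono' hm.aestronglyMeasurable
    (Eventually.of_forall fun ω => by rw [Real.norm_of_nonneg (hY ω)]; exact h1 ω)
  refine ⟨hi, ?_⟩
  -- the tangent line of the exponential function at `log K`
  have h3 : ∀ ω, Y ω ≤ a / K * exp (Y ω / a) + a * (log K - 1) := fun ω => by
    have h4 := add_one_le_exp (Y ω / a - log K)
    rw [exp_sub, exp_log hK] at h4
    have h5 : Y ω = a * (Y ω / a) := by field_simp
    have h6 : a / K * exp (Y ω / a) = a * (exp (Y ω / a) / K) := by ring
    rw [h6]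
    nlinarith
  have h7 := integral_mono hi ((hint.const_mul (a / K)).add (integrable_const _)) h3
  rw [integral_add' (hint.const_mul _) (integrable_const _), integral_const_mul] at h7
  simp only [integral_const, probReal_univ, one_smul] at h7
  have h8 : a / K * ∫ ω, exp (Y ω / a) ∂P ≤ a / K * K := by gcongr
  rw [div_mul_cancel₀ _ hK.ne'] at h8
  linarith

/-- A geometric mean of two quantities of sizes `b` and `c`, linearized at `(b, c)` in terms of the
squares of the quantities. -/
lemma rpow_mul_rpow_le {x y b c θ : ℝ} (hx : 0 ≤ x) (hy : 0 ≤ y) (hb : 0 < b) (hc : 0 < c)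
    (hθ0 : 0 ≤ θ) (hθ1 : θ ≤ 1) :
    x ^ θ * y ^ (1 - θ) ≤ b ^ θ * c ^ (1 - θ) *
      (θ * ((1 + x ^ 2 / b ^ 2) / 2) + (1 - θ) * ((1 + y ^ 2 / c ^ 2) / 2)) := by
  have h1 := Real.geom_mean_le_arith_mean2_weighted hθ0 (sub_nonneg.2 hθ1)
    (div_nonneg hx hb.le) (div_nonneg hy hc.le) (by ring)
  rw [div_rpow hx hb.le, div_rpow hy hc.le] at h1
  have h2 : ∀ r : ℝ, r ≤ (1 + r ^ 2) / 2 := fun r => by nlinarith [sq_nonneg (r - 1)]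
  have h3 := h2 (x / b)
  have h4 := h2 (y / c)
  rw [div_pow] at h3 h4
  have h5 : x ^ θ * y ^ (1 - θ)
      = b ^ θ * c ^ (1 - θ) * (x ^ θ / b ^ θ * (y ^ (1 - θ) / c ^ (1 - θ))) := by
    have := (rpow_pos_of_pos hb θ).ne'
    have := (rpow_pos_of_pos hc (1 - θ)).ne'
    field_simp
  rw [h5]
  refine mul_le_mul_of_nonneg_left (h1.trans ?_) (by positivity)
  exact add_le_add (mul_le_mul_of_nonneg_left h3 hθ0)
    (mul_le_mul_of_nonneg_left h4 (sub_nonneg.2 hθ1))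

lemma logExp_of_le_two {p : ℝ≥0∞} (hp : 1 ≤ p) (hp2 : p ≤ 2) : logExp p = 0 := by
  refine max_eq_right ?_
  have h1 : (2 : ℝ≥0∞)⁻¹ ≤ 1 / p := by rw [one_div]; exact ENNReal.inv_le_inv.2 hp2
  have h2 := ENNReal.toReal_mono (ENNReal.div_lt_top (by simp) (by positivity)).ne h1
  rw [ENNReal.toReal_inv, ENNReal.toReal_ofNat] at h2
  linarith

lemma toReal_one_div_le {p : ℝ≥0∞} (hp2 : 2 ≤ p) : (1 / p).toReal ≤ 1 / 2 := by
  have h1 : 1 / p ≤ (2 : ℝ≥0∞)⁻¹ := by rw [one_div]; exact ENNReal.inv_le_inv.2 hp2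
  have h2 := ENNReal.toReal_mono (by simp) h1
  rwa [ENNReal.toReal_inv, ENNReal.toReal_ofNat, ← one_div] at h2

lemma sqrt_noiseVar {R : ℝ} (hR : 0 < R) (n : ℕ) {σ : ℝ} (hσ : 0 ≤ σ) :
    √(noiseVar R n σ) = 32 * R ^ 2 / π * (σ / n) := by
  have := pi_pos
  rw [noiseVar, show (32 * R ^ 2 / π) ^ 2 * σ ^ 2 / (n : ℝ) ^ 2
    = (32 * R ^ 2 / π * (σ / n)) ^ 2 by ring, Real.sqrt_sq (by positivity)]

section Noise

variable {Ω : Type*} [MeasurableSpace Ω] {P : Measure Ω} [IsProbabilityMeasure P]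
  {Z Z' : ℕ → ℕ → Ω → ℝ} {s s' : ℕ → ℕ → ℝ≥0} {σ : ℝ}

lemma IsNoise.integral_meanSq_le {R : ℝ} (hR : 0 < R) (hσ : 0 < σ)
    (h : IsNoise P Z Z' s s' σ) {n : ℕ} (hn : 2 ≤ n) (he : Even n) :
    Integrable (fun ω => meanSq R (noiseArray Z Z' n ω)) P ∧
      ∫ ω, meanSq R (noiseArray Z Z' n ω) ∂P ≤ (4 * √(noiseVar R n σ)) ^ 2 := by
  have hV := noiseVar_pos hR (by omega : 0 < n) hσ
  obtain ⟨h1, h2⟩ := h.integral_exp_meanSq_le hR hσ hn he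
  obtain ⟨h3, h4⟩ := integral_le_of_exp_moment (by positivity) two_pos
    (fun ω => meanSq_nonneg R (noiseArray Z Z' n ω))
    ((measurable_meanSq hR hn).comp_aemeasurable (h.aemeasurable_noiseArray n)) h1 h2
  refine ⟨h3, h4.trans ?_⟩
  rw [mul_pow, Real.sq_sqrt hV.le]
  nlinarith [log_two_lt_d9]

lemma IsNoise.integral_top_sq_le {R : ℝ} (hR : 0 < R) (hσ : 0 < σ)
    (h : IsNoise P Z Z' s s' σ) {n : ℕ} (hn : 2 ≤ n) (he : Even n) :
    Integrable (fun ω => discreteSV R ∞ (noiseArray Z Z' n ω) ^ 2) P ∧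
      ∫ ω, discreteSV R ∞ (noiseArray Z Z' n ω) ^ 2 ∂P
        ≤ (4 * √(noiseVar R n σ) * √(log n)) ^ 2 := by
  have hV := noiseVar_pos hR (by omega : 0 < n) hσ
  have hn' : (2 : ℝ) ≤ n := by exact_mod_cast hn
  obtain ⟨h1, h2⟩ := h.integral_exp_top_le hR hσ hn he
  obtain ⟨h3, h4⟩ := integral_le_of_exp_moment (by positivity) (by positivity)
    (fun ω => sq_nonneg (discreteSV R ∞ (noiseArray Z Z' n ω)))
    (((measurable_discreteSV hR hn ∞).comp_aemeasurable
      (h.aemeasurable_noiseArray n)).pow_const 2) h1 h2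
  refine ⟨h3, h4.trans ?_⟩
  have hlog : log 2 ≤ log n := log_le_log two_pos hn'
  have hlog0 : 0 ≤ log (n : ℝ) := log_nonneg (by linarith)
  rw [mul_pow, mul_pow, Real.sq_sqrt hV.le, Real.sq_sqrt hlog0, log_mul two_ne_zero (by positivity),
    log_pow]
  push_cast
  nlinarith [mul_le_mul_of_nonneg_left hlog hV.le, mul_nonneg hV.le hlog0]

lemma IsNoise.integrable_discreteSV {R : ℝ} (hR : 0 < R) (hσ : 0 < σ)
    (h : IsNoise P Z Z' s s' σ) {n : ℕ} (hn : 2 ≤ n) (he : Even n) {p : ℝ≥0∞} (hp : 1 ≤ p) :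
    Integrable (fun ω => discreteSV R p (noiseArray Z Z' n ω)) P := by
  have hi := (h.integral_top_sq_le hR hσ hn he).1
  refine (((integrable_const (1 : ℝ)).add hi).const_mul (max 1 (2 * R))).mono'
    ((measurable_discreteSV hR hn p).comp_aemeasurable
      (h.aemeasurable_noiseArray n)).aestronglyMeasurable (Eventually.of_forall fun ω => ?_)
  rw [Real.norm_of_nonneg (discreteSV_nonneg hR hn hp _)]
  refine (discreteSV_le_top hR hn hp _).trans (mul_le_mul_of_nonneg_left ?_ (by positivity))
  simp only [Pi.add_apply]
  nlinarith [sq_nonneg (discreteSV R ∞ (noiseArray Z Z' n ω) - 1),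
    sq_nonneg (discreteSV R ∞ (noiseArray Z Z' n ω))]

/-- The mean of the noise. The logarithm stems from the maximum over the grid, and the
interpolation between the mean square and the maximum gives its exponent. -/
lemma IsNoise.integral_discreteSV_le {R : ℝ} (hR : 0 < R) (hσ : 0 < σ)
    (h : IsNoise P Z Z' s s' σ) {n : ℕ} (hn : 2 ≤ n) (he : Even n) {p : ℝ≥0∞} (hp : 1 ≤ p) :
    ∫ ω, discreteSV R p (noiseArray Z Z' n ω) ∂P
      ≤ max 1 (2 * R) * (4 * √(noiseVar R n σ) * log n ^ logExp p) := by
  have hn' : (2 : ℝ) ≤ n := by exact_mod_cast hn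
  have hlog : 0 < log (n : ℝ) := log_pos (by linarith)
  have hV := noiseVar_pos hR (by omega : 0 < n) hσ
  obtain ⟨hA, hA'⟩ := h.integral_meanSq_le hR hσ hn he
  obtain ⟨hM, hM'⟩ := h.integral_top_sq_le hR hσ hn he
  set b : ℝ := 4 * √(noiseVar R n σ) with hb
  have hb0 : 0 < b := by have := Real.sqrt_pos.2 hV; positivity
  set c : ℝ := b * √(log n) with hc
  have hc0 : 0 < c := by have := Real.sqrt_pos.2 hlog; positivity
  -- `θ` is the exponent of the mean square: `1` for `p ≤ 2` and `2 / p` for `p ≥ 2`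
  have key : ∀ θ : ℝ, 0 ≤ θ → θ ≤ 1 → logExp p = (1 - θ) / 2 →
      (∀ ω, discreteSV R p (noiseArray Z Z' n ω) ≤ max 1 (2 * R) *
        (√(meanSq R (noiseArray Z Z' n ω)) ^ θ
          * discreteSV R ∞ (noiseArray Z Z' n ω) ^ (1 - θ))) →
      ∫ ω, discreteSV R p (noiseArray Z Z' n ω) ∂P
        ≤ max 1 (2 * R) * (b * log n ^ logExp p) := by
    intro θ hθ0 hθ1 hexp hpt
    have hbc : b ^ θ * c ^ (1 - θ) = b * log n ^ logExp p := by
      rw [hc, mul_rpow hb0.le (Real.sqrt_nonneg _), ← mul_assoc, ← rpow_add hb0,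
        add_sub_cancel, rpow_one, Real.sqrt_eq_rpow, ← rpow_mul hlog.le, hexp]
      congr 2; ring
    have hpt' : ∀ ω, discreteSV R p (noiseArray Z Z' n ω)
        ≤ max 1 (2 * R) * (b * log n ^ logExp p) *
          (θ * ((1 + meanSq R (noiseArray Z Z' n ω) / b ^ 2) / 2)
            + (1 - θ) * ((1 + discreteSV R ∞ (noiseArray Z Z' n ω) ^ 2 / c ^ 2) / 2)) := by
      intro ω
      have h1 := rpow_mul_rpow_le (Real.sqrt_nonneg (meanSq R (noiseArray Z Z' n ω)))
        (discreteSV_top_nonneg R (by omega : 0 < n) (noiseArray Z Z' n ω)) hb0 hc0 hθ0 hθ1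
      rw [Real.sq_sqrt (meanSq_nonneg _ _), hbc] at h1
      rw [mul_assoc]
      exact (hpt ω).trans (mul_le_mul_of_nonneg_left h1 (by positivity))
    have hi1 : Integrable (fun ω =>
        θ * ((1 + meanSq R (noiseArray Z Z' n ω) / b ^ 2) / 2)) P :=
      (((integrable_const (1 : ℝ)).add (hA.div_const _)).div_const 2).const_mul θ
    have hi2 : Integrable (fun ω =>
        (1 - θ) * ((1 + discreteSV R ∞ (noiseArray Z Z' n ω) ^ 2 / c ^ 2) / 2)) P :=
      (((integrable_const (1 : ℝ)).add (hM.div_const _)).div_const 2).const_mul (1 - θ)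
    refine (integral_mono (h.integrable_discreteSV hR hσ hn he hp)
      ((hi1.add hi2).const_mul _) hpt').trans ?_
    rw [integral_const_mul]
    refine mul_le_of_le_one_right (by positivity) ?_
    rw [integral_add' hi1 hi2, integral_const_mul, integral_const_mul, integral_div, integral_div,
      integral_add (integrable_const _) (hA.div_const _),
      integral_add (integrable_const _) (hM.div_const _), integral_div, integral_div]
    simp only [integral_const, probReal_univ, one_smul]
    have e1 : (∫ ω, meanSq R (noiseArray Z Z' n ω) ∂P) / b ^ 2 ≤ 1 :=
      (div_le_one (by positivity)).2 hA'
    have e2 : (∫ ω, discreteSV R ∞ (noiseArray Z Z' n ω) ^ 2 ∂P) / c ^ 2 ≤ 1 :=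
      (div_le_one (by positivity)).2 hM'
    nlinarith [mul_le_mul_of_nonneg_left e1 hθ0,
      mul_le_mul_of_nonneg_left e2 (sub_nonneg.2 hθ1)]
  rcases le_total p 2 with hp2 | hp2
  · refine key 1 zero_le_one le_rfl (by rw [logExp_of_le_two hp hp2]; norm_num) fun ω => ?_
    rw [rpow_one, sub_self, rpow_zero, mul_one]
    exact discreteSV_le_sqrt_meanSq hR hn hp hp2 _
  · have h1 := toReal_one_div_le hp2
    refine key (2 * (1 / p).toReal) (by positivity) (by linarith) ?_
      fun ω => discreteSV_le_interpolation hR hn hp2 _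
    rw [logExp, max_eq_left (by linarith)]
    ring

/-- For `p ≤ 2` the mean square controls the norm, so the tail has no factor depending on `n`. -/
lemma IsNoise.measureReal_discreteSV_le {R : ℝ} (hR : 0 < R) (hσ : 0 < σ)
    (h : IsNoise P Z Z' s s' σ) {n : ℕ} (hn : 2 ≤ n) (he : Even n) {p : ℝ≥0∞} (hp : 1 ≤ p)
    (hp2 : p ≤ 2) {τ : ℝ} (hτ : 0 ≤ τ) :
    P.real {ω | τ ≤ discreteSV R p (noiseArray Z Z' n ω)}
      ≤ 2 * exp (-(τ ^ 2 / (4 * noiseVar R n σ * max 1 (2 * R) ^ 2))) := by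
  obtain ⟨h1, h2⟩ := h.integral_exp_meanSq_le hR hσ hn he
  exact measureReal_le_of_exp_moment (noiseVar_pos hR (by omega) hσ) (by positivity) hτ
    (fun _ => meanSq_nonneg _ _) h1 h2
    fun ω hω => le_trans hω (discreteSV_le_sqrt_meanSq hR hn hp hp2 _)

/-- For all `p` the maximum controls the norm, at the cost of a union bound over `n²` points. -/
lemma IsNoise.measureReal_discreteSV_le_sq_mul {R : ℝ} (hR : 0 < R) (hσ : 0 < σ)
    (h : IsNoise P Z Z' s s' σ) {n : ℕ} (hn : 2 ≤ n) (he : Even n) {p : ℝ≥0∞} (hp : 1 ≤ p)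
    {τ : ℝ} (hτ : 0 ≤ τ) :
    P.real {ω | τ ≤ discreteSV R p (noiseArray Z Z' n ω)}
      ≤ 2 * n ^ 2 * exp (-(τ ^ 2 / (4 * noiseVar R n σ * max 1 (2 * R) ^ 2))) := by
  obtain ⟨h1, h2⟩ := h.integral_exp_top_le hR hσ hn he
  refine measureReal_le_of_exp_moment (noiseVar_pos hR (by omega) hσ) (by positivity) hτ
    (fun _ => sq_nonneg _) h1 h2 fun ω hω => ?_
  rw [Real.sqrt_sq (discreteSV_top_nonneg R (by omega) _)]
  exact le_trans hω (discreteSV_le_top hR hn hp _)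

/-- The fourth moment of the maximum of the noise is `O(n⁻²)`, hence summable. -/
lemma IsNoise.integral_top_pow_four_le {R : ℝ} (hR : 0 < R) (hσ : 0 < σ)
    (h : IsNoise P Z Z' s s' σ) {n : ℕ} (hn : 2 ≤ n) (he : Even n) :
    Integrable (fun ω => discreteSV R ∞ (noiseArray Z Z' n ω) ^ 4) P ∧
      ∫ ω, discreteSV R ∞ (noiseArray Z Z' n ω) ^ 4 ∂P
        ≤ 64 * ((32 * R ^ 2 / π) ^ 2 * σ ^ 2) ^ 2 / n ^ 2 := by
  have hV := noiseVar_pos hR (by omega : 0 < n) hσ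
  have hn' : (0 : ℝ) < n := by exact_mod_cast (by omega : 0 < n)
  obtain ⟨h1, h2⟩ := h.integral_exp_top_le hR hσ hn he
  set V := noiseVar R n σ with hVdef
  have hle : ∀ ω, discreteSV R ∞ (noiseArray Z Z' n ω) ^ 4
      ≤ 32 * V ^ 2 * exp (discreteSV R ∞ (noiseArray Z Z' n ω) ^ 2 / (4 * V)) := fun ω => by
    have h3 := quadratic_le_exp_of_nonneg
      (x := discreteSV R ∞ (noiseArray Z Z' n ω) ^ 2 / (4 * V)) (by positivity)
    have h4 : 0 ≤ discreteSV R ∞ (noiseArray Z Z' n ω) ^ 2 / (4 * V) := by positivity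
    have h5 : discreteSV R ∞ (noiseArray Z Z' n ω) ^ 4
        = 32 * V ^ 2 * ((discreteSV R ∞ (noiseArray Z Z' n ω) ^ 2 / (4 * V)) ^ 2 / 2) := by
      field_simp; ring
    rw [h5]
    exact mul_le_mul_of_nonneg_left (by linarith) (by positivity)
  have hm : AEMeasurable (fun ω => discreteSV R ∞ (noiseArray Z Z' n ω) ^ 4) P :=
    ((measurable_discreteSV hR hn ∞).comp_aemeasurable (h.aemeasurable_noiseArray n)).pow_const 4
  have hi : Integrable (fun ω => discreteSV R ∞ (noiseArray Z Z' n ω) ^ 4) P :=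
    (h1.const_mul (32 * V ^ 2)).mono' hm.aestronglyMeasurable (Eventually.of_forall fun ω => by
      rw [Real.norm_of_nonneg (by positivity)]; exact hle ω)
  refine ⟨hi, (integral_mono hi (h1.const_mul _) hle).trans ?_⟩
  rw [integral_const_mul]
  refine (mul_le_mul_of_nonneg_left h2 (by positivity)).trans (le_of_eq ?_)
  rw [hVdef, noiseVar]
  field_simp
  norm_num

/-- The maximum of the noise tends to zero almost surely, since the fourth moments are summable. -/
lemma IsNoise.ae_tendsto_top {R : ℝ} (hR : 0 < R) (hσ : 0 < σ) (h : IsNoise P Z Z' s s' σ) :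
    ∀ᵐ ω ∂P, Tendsto (fun m : ℕ => discreteSV R ∞ (noiseArray Z Z' (2 * (m + 1)) ω)) atTop
      (𝓝 0) := by
  set κ : ℝ := 64 * ((32 * R ^ 2 / π) ^ 2 * σ ^ 2) ^ 2 with hκ
  have h4 := fun m : ℕ =>
    h.integral_top_pow_four_le hR hσ (n := 2 * (m + 1)) (by omega) (even_two_mul _)
  have hsumm : Summable fun m : ℕ => κ / ((2 * (m + 1) : ℕ) : ℝ) ^ 2 := by
    have h1 := (summable_nat_add_iff 1).2 (Real.summable_one_div_nat_pow.2 one_lt_two)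
    refine (h1.mul_left (κ / 4)).congr fun m => ?_
    push_cast
    field_simp
    norm_num
  have hm : ∀ m : ℕ, AEMeasurable (fun ω =>
      ENNReal.ofReal (discreteSV R ∞ (noiseArray Z Z' (2 * (m + 1)) ω) ^ 4)) P := fun m =>
    (h4 m).1.aestronglyMeasurable.aemeasurable.ennreal_ofReal
  have hfin : ∫⁻ ω, (∑' m : ℕ,
      ENNReal.ofReal (discreteSV R ∞ (noiseArray Z Z' (2 * (m + 1)) ω) ^ 4)) ∂P ≠ ∞ := by
    rw [lintegral_tsum hm]
    refine ne_top_of_le_ne_top hsumm.tsum_ofReal_ne_top (ENNReal.tsum_le_tsum fun m => ?_)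
    rw [← ofReal_integral_eq_lintegral_ofReal (h4 m).1
      (Eventually.of_forall fun ω => by positivity)]
    exact ENNReal.ofReal_le_ofReal (h4 m).2
  filter_upwards [ae_lt_top' (AEMeasurable.tsum hm) hfin] with ω hω
  have h5 := (ENNReal.tendsto_toReal ENNReal.zero_ne_top).comp
    (ENNReal.tendsto_atTop_zero_of_tsum_ne_top hω.ne)
  have h6 : Tendsto (fun m : ℕ => discreteSV R ∞ (noiseArray Z Z' (2 * (m + 1)) ω) ^ 4) atTop
      (𝓝 0) := by
    refine h5.congr fun m => ?_
    simp only [Function.comp_apply]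
    rw [ENNReal.toReal_ofReal (by positivity)]
  have h7 := h6.rpow_const (p := 1 / 4) (Or.inr (by norm_num))
  rw [zero_rpow (by norm_num)] at h7
  refine h7.congr fun m => ?_
  rw [← rpow_natCast, ← rpow_mul (discreteSV_top_nonneg R (by omega) _)]
  norm_num

end Noise

/-! ### The error of the noisy distance -/

section Error

variable {Ω : Type*} {Z Z' : ℕ → ℕ → Ω → ℝ} {R : ℝ} {f g : Plane → ℝ}

lemma noisySamples_sub_noisySamples (R : ℝ) (f g : Plane → ℝ) (Z Z' : ℕ → ℕ → Ω → ℝ) (n : ℕ)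
    (ω : Ω) : (fun i j => noisySamples R f Z n ω i j - noisySamples R g Z' n ω i j)
      = fun i j => samples R n (fun z => f z - g z) i j + noiseArray Z Z' n ω i j := by
  funext i j
  simp only [noisySamples, samples, noiseArray]
  ring

/-- The error is at most the norm of the noise plus the discretization error. -/
lemma err_le_add {C : ℝ} {n : ℕ} {p : ℝ≥0∞}
    (hdet : ∀ x : Fin n → Fin n → ℝ,
      |discreteSV R p x - (slicedCramer uniformCircle R p f g).toReal|
        ≤ discreteSV R p (fun i j => x i j - samples R n (fun z => f z - g z) i j) + C / n)
    (Z Z' : ℕ → ℕ → Ω → ℝ) (ω : Ω) :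
    err R f g Z Z' n p ω ≤ discreteSV R p (noiseArray Z Z' n ω) + C / n := by
  have h1 := hdet (fun i j => noisySamples R f Z n ω i j - noisySamples R g Z' n ω i j)
  have h2 : (fun i j => noisySamples R f Z n ω i j - noisySamples R g Z' n ω i j
      - samples R n (fun z => f z - g z) i j) = noiseArray Z Z' n ω := by
    funext i j
    rw [congrFun (congrFun (noisySamples_sub_noisySamples R f g Z Z' n ω) i) j]
    ring
  rwa [h2] at h1

variable [MeasurableSpace Ω] {P : Measure Ω} {s s' : ℕ → ℕ → ℝ≥0} {σ : ℝ}

lemma IsNoise.aemeasurable_err (h : IsNoise P Z Z' s s' σ) (hR : 0 < R) (f g : Plane → ℝ) {n : ℕ}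
    (hn : 2 ≤ n) (p : ℝ≥0∞) : AEMeasurable (err R f g Z Z' n p) P := by
  have h1 : AEMeasurable (fun ω => fun i j =>
      noisySamples R f Z n ω i j - noisySamples R g Z' n ω i j) P := by
    rw [funext fun ω => noisySamples_sub_noisySamples R f g Z Z' n ω]
    have h2 := h.aemeasurable_noiseArray n
    refine aemeasurable_pi_lambda _ fun i => aemeasurable_pi_lambda _ fun j => ?_
    exact aemeasurable_const.add
      (aemeasurable_pi_iff.1 (aemeasurable_pi_iff.1 h2 i) j)
  exact (((measurable_discreteSV hR hn p).comp_aemeasurable h1).sub_const _).abs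

variable [IsProbabilityMeasure P]

/-- The expected error at a positive noise level. -/
lemma IsNoise.integral_err_le (h : IsNoise P Z Z' s s' σ) (hR : 0 < R) (hσ : 0 < σ) {C : ℝ}
    {n : ℕ} (hn : 2 ≤ n) (he : Even n) {p : ℝ≥0∞} (hp : 1 ≤ p)
    (hle : ∀ ω, err R f g Z Z' n p ω ≤ discreteSV R p (noiseArray Z Z' n ω) + C / n) :
    Integrable (err R f g Z Z' n p) P ∧ ∫ ω, err R f g Z Z' n p ω ∂P
      ≤ 4 * max 1 (2 * R) * (32 * R ^ 2 / π) * σ * (log n ^ logExp p / n) + C / n := by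
  have h1 := h.integrable_discreteSV hR hσ hn he hp
  have h2 := h1.add (integrable_const (C / (n : ℝ)))
  have h3 : Integrable (err R f g Z Z' n p) P :=
    h2.mono' (h.aemeasurable_err hR f g hn p).aestronglyMeasurable
      (Eventually.of_forall fun ω => by
        rw [Real.norm_of_nonneg (show 0 ≤ err R f g Z Z' n p ω from abs_nonneg _)]
        exact hle ω)
  refine ⟨h3, (integral_mono h3 h2 hle).trans ?_⟩
  rw [integral_add' h1 (integrable_const _)]
  simp only [integral_const, probReal_univ, one_smul]
  gcongr
  refine (h.integral_discreteSV_le hR hσ hn he hp).trans (le_of_eq ?_)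
  rw [sqrt_noiseVar hR n hσ.le]
  ring

/-- If the discretization error is at most `t / 2`, the tail of the error is controlled by the tail
of the norm of the noise at `t / 2`. -/
lemma IsNoise.measureReal_err_le (h : IsNoise P Z Z' s s' σ) (hR : 0 < R) (hσ : 0 < σ) {C t : ℝ}
    {n : ℕ} (hn : 2 ≤ n) (he : Even n) (ht : 0 ≤ t) (hCt : C / n ≤ t / 2)
    (hle : ∀ p, 1 ≤ p → ∀ ω,
      err R f g Z Z' n p ω ≤ discreteSV R p (noiseArray Z Z' n ω) + C / n) :
    (∀ p : ℝ≥0∞, 1 ≤ p → p ≤ 2 → P.real {ω | t ≤ err R f g Z Z' n p ω}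
      ≤ 2 * exp (-(1 / (16 * (32 * R ^ 2 / π) ^ 2 * max 1 (2 * R) ^ 2)
        * ((n : ℝ) ^ 2 * t ^ 2 / σ ^ 2)))) ∧
    (∀ p : ℝ≥0∞, 1 ≤ p → P.real {ω | t ≤ err R f g Z Z' n p ω}
      ≤ 2 * (n : ℝ) ^ 2 * exp (-(1 / (16 * (32 * R ^ 2 / π) ^ 2 * max 1 (2 * R) ^ 2)
        * ((n : ℝ) ^ 2 * t ^ 2 / σ ^ 2)))) := by
  have hn' : (0 : ℝ) < n := by exact_mod_cast (by omega : 0 < n)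
  have hsub : ∀ p : ℝ≥0∞, 1 ≤ p → P.real {ω | t ≤ err R f g Z Z' n p ω}
      ≤ P.real {ω | t / 2 ≤ discreteSV R p (noiseArray Z Z' n ω)} := fun p hp =>
    measureReal_mono (fun ω hω => by
      have h1 : t ≤ err R f g Z Z' n p ω := hω
      have h2 := hle p hp ω
      show t / 2 ≤ discreteSV R p (noiseArray Z Z' n ω)
      linarith) (measure_ne_top _ _)
  have hL : 0 < max 1 (2 * R) := by positivity
  have hexp : (t / 2) ^ 2 / (4 * noiseVar R n σ * max 1 (2 * R) ^ 2)
      = 1 / (16 * (32 * R ^ 2 / π) ^ 2 * max 1 (2 * R) ^ 2) * ((n : ℝ) ^ 2 * t ^ 2 / σ ^ 2) := by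
    have := pi_pos
    rw [noiseVar]
    field_simp
    ring
  rw [← hexp]
  exact ⟨fun p hp hp2 => (hsub p hp).trans
      (h.measureReal_discreteSV_le hR hσ hn he hp hp2 (by positivity)),
    fun p hp => (hsub p hp).trans
      (h.measureReal_discreteSV_le_sq_mul hR hσ hn he hp (by positivity))⟩

/-- Almost sure convergence of the error, along the even sample sizes. -/
lemma IsNoise.ae_tendsto_err (h : IsNoise P Z Z' s s' σ) (hR : 0 < R) (hσ : 0 < σ) {C : ℝ}
    {p : ℝ≥0∞} (hp : 1 ≤ p) (hle : ∀ n : ℕ, 2 ≤ n → ∀ ω,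
      err R f g Z Z' n p ω ≤ discreteSV R p (noiseArray Z Z' n ω) + C / n) :
    ∀ᵐ ω ∂P, Tendsto (fun m : ℕ => err R f g Z Z' (2 * m) p ω) atTop (𝓝 0) := by
  filter_upwards [h.ae_tendsto_top hR hσ] with ω hω
  rw [← tendsto_add_atTop_iff_nat 1]
  have h1 : Tendsto (fun m : ℕ => C / ((2 * (m + 1) : ℕ) : ℝ)) atTop (𝓝 0) := by
    refine tendsto_const_nhds.div_atTop (tendsto_natCast_atTop_atTop.comp ?_)
    exact tendsto_atTop_mono (fun m => by simp only [id]; omega) tendsto_id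
  have h2 := (hω.const_mul (max 1 (2 * R))).add h1
  rw [mul_zero, zero_add] at h2
  refine squeeze_zero (fun m => abs_nonneg _) (fun m => ?_) h2
  exact (hle _ (by omega) ω).trans (by gcongr; exact discreteSV_le_top hR (by omega) hp _)

end Error

end SlicedCramer

end

theorem theorem4p2 (R : ℝ) (hR : 0 < R) (f g : SlicedCramer.Plane → ℝ)
    (hf : ContDiff ℝ ((⊤ : ℕ∞) : WithTop ℕ∞) f) (hg : ContDiff ℝ ((⊤ : ℕ∞) : WithTop ℕ∞) g)
    (hfsupp : Function.support f ⊆ Metric.closedBall 0 R)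
    (hgsupp : Function.support g ⊆ Metric.closedBall 0 R)
    (hfg : ∫ x, f x = ∫ x, g x) :
    -- the limiting distances are finite
    (∀ p : ℝ≥0∞, 1 ≤ p →
      SlicedCramer.slicedCramer SlicedCramer.uniformCircle R p f g ≠ ∞) ∧
    -- expected error
    (∃ A B : ℝ, 0 < A ∧ 0 < B ∧
      ∀ (Ω : Type*) [MeasurableSpace Ω] (P : Measure Ω) [IsProbabilityMeasure P]
        (Z Z' : ℕ → ℕ → Ω → ℝ) (s s' : ℕ → ℕ → ℝ≥0) (σ : ℝ), 0 ≤ σ →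
        SlicedCramer.IsNoise P Z Z' s s' σ →
        ∀ n : ℕ, 2 ≤ n → Even n → ∀ p : ℝ≥0∞, 1 ≤ p →
          Integrable (SlicedCramer.err R f g Z Z' n p) P ∧
          ∫ ω, SlicedCramer.err R f g Z Z' n p ω ∂P
            ≤ A * σ * (log n ^ SlicedCramer.logExp p / n) + B / n) ∧
    -- concentration
    (∃ A B C : ℝ, 0 < A ∧ 0 < B ∧ 0 < C ∧
      ∀ (Ω : Type*) [MeasurableSpace Ω] (P : Measure Ω) [IsProbabilityMeasure P]
        (Z Z' : ℕ → ℕ → Ω → ℝ) (s s' : ℕ → ℕ → ℝ≥0) (σ : ℝ), 0 < σ →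
        SlicedCramer.IsNoise P Z Z' s s' σ →
        ∀ t : ℝ, 0 ≤ t → ∀ n : ℕ, 2 ≤ n → Even n → C / t ≤ n →
          (∀ p : ℝ≥0∞, 1 ≤ p → p ≤ 2 →
            P.real {ω | t ≤ SlicedCramer.err R f g Z Z' n p ω}
              ≤ A * exp (-(B * ((n : ℝ) ^ 2 * t ^ 2 / σ ^ 2)))) ∧
          (∀ p : ℝ≥0∞, 2 < p →
            P.real {ω | t ≤ SlicedCramer.err R f g Z Z' n p ω}
              ≤ A * (n : ℝ) ^ 2 * exp (-(B * ((n : ℝ) ^ 2 * t ^ 2 / σ ^ 2))))) ∧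
    -- almost sure limit, along the even sample sizes `n = 2 m`
    (∀ (Ω : Type*) [MeasurableSpace Ω] (P : Measure Ω) [IsProbabilityMeasure P]
        (Z Z' : ℕ → ℕ → Ω → ℝ) (s s' : ℕ → ℕ → ℝ≥0) (σ : ℝ), 0 ≤ σ →
        SlicedCramer.IsNoise P Z Z' s s' σ →
        ∀ p : ℝ≥0∞, 1 ≤ p → ∀ᵐ ω ∂P,
          Tendsto (fun m : ℕ => SlicedCramer.discreteSC R p
              (SlicedCramer.noisySamples R f Z (2 * m) ω)
              (SlicedCramer.noisySamples R g Z' (2 * m) ω)) atTop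
            (𝓝 (SlicedCramer.slicedCramer SlicedCramer.uniformCircle R p f g).toReal)) := by
  have hbf : SlicedCramer.IsBump R f := ⟨hf, hfsupp⟩
  have hbg : SlicedCramer.IsBump R g := ⟨hg, hgsupp⟩
  have h0 : ∫ x, (f x - g x) = 0 := by
    rw [integral_sub hbf.integrable hbg.integrable, hfg, sub_self]
  obtain ⟨C, hC, hdet⟩ := SlicedCramer.exists_abs_discreteSV_sub_le hR hbf hbg h0
  have hπ := pi_pos
  have hL : 0 < max 1 (2 * R) := by positivity
  refine ⟨fun p hp => SlicedCramer.slicedCramer_ne_top hR hbf hbg h0 hp,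
    ⟨4 * max 1 (2 * R) * (32 * R ^ 2 / π), C + 1, by positivity, by positivity, ?_⟩,
    ⟨2, 1 / (16 * (32 * R ^ 2 / π) ^ 2 * max 1 (2 * R) ^ 2), 2 * C + 1, two_pos, by positivity,
      by positivity, ?_⟩, ?_⟩
  · intro Ω _ P _ Z Z' s s' σ hσ hZ n hn he p hp
    have hb := fun τ (hτ : σ < τ) => (hZ.mono hσ hτ.le).integral_err_le hR (hσ.trans_lt hτ) hn he hp
      (SlicedCramer.err_le_add (hdet n hn p hp) Z Z')
    refine ⟨(hb (σ + 1) (by linarith)).1, ?_⟩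
    -- the exponential moments need a positive noise level, so let the level decrease to `σ`
    have hlim : Tendsto (fun τ : ℝ => 4 * max 1 (2 * R) * (32 * R ^ 2 / π) * τ *
        (log n ^ SlicedCramer.logExp p / n) + C / n) (𝓝[>] σ)
        (𝓝 (4 * max 1 (2 * R) * (32 * R ^ 2 / π) * σ *
          (log n ^ SlicedCramer.logExp p / n) + C / n)) :=
      (Continuous.tendsto (by fun_prop) σ).mono_left nhdsWithin_le_nhds
    have h1 := ge_of_tendsto hlim (eventually_mem_nhdsWithin.mono fun τ hτ => (hb τ hτ).2)
    refine h1.trans ?_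
    gcongr
    linarith
  · intro Ω _ P _ Z Z' s s' σ hσ hZ t ht n hn he hCt
    have hn' : (2 : ℝ) ≤ n := by exact_mod_cast hn
    rcases ht.eq_or_lt with rfl | ht
    · -- `C / 0 = 0` poses no condition on `n`, and the bounds are at least `1`
      have hn2 : (1 : ℝ) ≤ (n : ℝ) ^ 2 := by nlinarith
      constructor
      · intro p _ _
        refine measureReal_le_one.trans ?_
        norm_num
      · intro p _
        refine measureReal_le_one.trans ?_
        norm_num
        linarith
    · -- the constant `2 * C + 1` makes the discretization error at most `t / 2`
      have hCn : C / n ≤ t / 2 := by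
        rw [div_le_iff₀ ht] at hCt
        rw [div_le_div_iff₀ (by linarith) two_pos]
        nlinarith
      obtain ⟨h1, h2⟩ := hZ.measureReal_err_le hR hσ hn he ht.le hCn
        fun p hp => SlicedCramer.err_le_add (hdet n hn p hp) Z Z'
      exact ⟨h1, fun p hp => h2 p (one_le_two.trans hp.le)⟩
  · intro Ω _ P _ Z Z' s s' σ hσ hZ p hp
    -- a larger, positive noise level is admissible too
    filter_upwards [(hZ.mono hσ (by linarith : σ ≤ σ + 1)).ae_tendsto_err hR (by linarith) hp
      fun n hn => SlicedCramer.err_le_add (hdet n hn p hp) Z Z'] with ω hω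
    exact tendsto_iff_norm_sub_tendsto_zero.2 hω
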